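/- Let $\mathcal C_1,\dots,\mathcal C_L$ be channels acting on finite binary strings, each of one of the following kinds: a deletion channel with parameter $q\in[0,1)$, which deletes every bit independently with probability $q$; an insertion channel with parameter $\eta\in[0,1)$, which inserts before every bit, independently, $j$ independent uniform bits with probability $(1-\eta)\eta^j$ ($j\ge 0$); or a symmetry channel with parameter $\sigma\in[0,1]\setminus\{1/2\}$, which flips every bit independently with probability $\sigma$. Let $\mathcal C=\mathcal C_1\circ\cdots\circ\mathcal C_L$ be their composition ($\mathcal C_L$ acts first). For $x\in\{0,1\}^n$ and $w\in\{0,1\}^k$ let $$K_{x,w}(\alpha)=\sum_{0\le l<n} e^{il\alpha}\,\mathbf 1[x_{l:l+k}=w],$$ where $x_{l:l+k}$ is the string of the $k$ consecutive bits of $x$ that starts at position $l$ (positions are counted from $0$; a window that does not fit into $x$ contributes $0$). Then there is a constant $C$, depending only on $\mathcal C_1,\dots,\mathcal C_L$, such that the following holds for all $n,k\ge 0$, $\alpha\in[-\pi,\pi]$, $\varepsilon>0$ and $\delta\in(0,1)$. There are a number $N$ of traces and an estimator $\mathcal A$, which maps a marker $w\in\{0,1\}^k$ and $N$ binary strings to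 a complex number, such that for all $w\in\{0,1\}^k$ and $x\in\{0,1\}^n$, if $\tilde x^1,\dots,\tilde x^N$ are independent samples of $\mathcal C(x)$, then $$\Pr\Big[\big|\mathcal A(w,\tilde x^1,\dots,\tilde x^N)-K_{x,w}(\alpha)\big|<\varepsilon\Big]>1-\delta,$$ and $$N\le C\,e^{Ck}(n+1)^{C}\,(1+C\alpha^2)^n\,(1+1/\varepsilon)^{C}\,(1+\log(1/\delta))^{C}.$$ If moreover $k+\log n\le\alpha^2 n$ (with $\log 0$ read as $0$), then $$N\le C\,(1+C\alpha^2)^n\,(1+1/\varepsilon)^{C}\,(1+\log(1/\delta))^{C}.$$ -/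

import Mathlib

open MeasureTheory

noncomputable section

/-- The law of a coin that shows `true` with probability `p`. -/
def coin (p : ℝ) (h0 : 0 ≤ p) (h1 : p ≤ 1) : PMF Bool :=
  PMF.ofFintype (fun b => ENNReal.ofReal (if b then p else 1 - p)) (by
    rw [Fintype.sum_bool, ← ENNReal.ofReal_add (by simpa using h0) (by simpa using h1)]
    simp)

/-- The law of the number `j ≥ 0` with probabilities `(1 - η) η ^ j`, that is, `Geom (1 - η)`. -/
def geom (η : ℝ) (h0 : 0 ≤ η) (h1 : η < 1) : PMF ℕ :=
  ⟨fun j => ENNReal.ofReal ((1 - η) * η ^ j), by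
    have hs : HasSum (fun j : ℕ => (1 - η) * η ^ j) 1 := by
      have h := (hasSum_geometric_of_lt_one h0 h1).mul_left (1 - η)
      rwa [mul_inv_cancel₀ (by linarith)] at h
    have hn : ∀ j : ℕ, 0 ≤ (1 - η) * η ^ j := fun j =>
      mul_nonneg (by linarith) (pow_nonneg h0 j)
    have h := ENNReal.ofReal_tsum_of_nonneg hn hs.summable
    rw [hs.tsum_eq, ENNReal.ofReal_one] at h
    rw [h]
    exact ENNReal.summable.hasSum⟩

/-- A string of `j` independent uniformly distributed bits. -/
def uniformBits (j : ℕ) : PMF (List Bool) :=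
  (PMF.uniformOfFintype (Fin j → Bool)).map List.ofFn

/-- A deletion, insertion or symmetry channel, with its parameter. A symmetry channel with
parameter `1 / 2` erases all information about the values of the bits and is excluded. -/
inductive SyncChannel : Type
  | deletion (δ : ℝ) (h0 : 0 ≤ δ) (h1 : δ < 1) : SyncChannel
  | insertion (η : ℝ) (h0 : 0 ≤ η) (h1 : η < 1) : SyncChannel
  | symmetry (σ : ℝ) (h0 : 0 ≤ σ) (h1 : σ ≤ 1) (h2 : σ ≠ 1 / 2) : SyncChannel

/-- The random string by which a channel replaces one input bit: a deletion channel removes the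
bit with probability `δ`, an insertion channel puts `Geom (1 - η)` uniform bits before it, and a
symmetry channel flips it with probability `σ`. -/
def SyncChannel.block : SyncChannel → Bool → PMF (List Bool)
  | .deletion δ h0 h1, b => (coin δ h0 h1.le).map fun d => if d then [] else [b]
  | .insertion η h0 h1, b =>
      (geom η h0 h1).bind fun j => (uniformBits j).map fun u => u ++ [b]
  | .symmetry σ h0 h1 _, b => (coin σ h0 h1).map fun d => [xor b d]

/-- The law of the output of a channel: its input bits are replaced independently. -/
def SyncChannel.trace (c : SyncChannel) : List Bool → PMF (List Bool)
  | [] => PMF.pure []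
  | b :: x => (c.block b).bind fun u => (c.trace x).map fun v => u ++ v

/-- The composite channel `𝒞₁ ∘ ⋯ ∘ 𝒞_L`, where `𝒞_L` acts first. -/
def compositeTrace : List SyncChannel → List Bool → PMF (List Bool)
  | [], x => PMF.pure x
  | c :: cs, x => (compositeTrace cs x).bind c.trace

/-- All sets of bit strings are measurable. -/
instance instMeasurableSpaceBitString : MeasurableSpace (List Bool) := ⊤

/-- The joint law of `N` independent traces of `x`. -/
def tracesLaw (cs : List SyncChannel) (x : List Bool) (N : ℕ) :
    Measure (Fin N → List Bool) :=
  Measure.pi fun _ => (compositeTrace cs x).toMeasure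

/-- The sum of `e ^ (i l α)` over the positions `l` (counted from `0`) at which the string `w`
occurs in `x`. -/
def kmerValue (x w : List Bool) (α : ℝ) : ℂ :=
  ∑ l ∈ Finset.range x.length,
    if (x.drop l).take w.length = w then Complex.exp (Complex.I * l * α) else 0

/-- An estimation procedure: the number of traces that it uses for given length `n`, marker length
`k`, frequency `α`, accuracy `ε` and failure probability `δ`, and the estimate that it computes
from the marker and this number of traces. -/
structure KmerAlgorithm where
  samples : (n k : ℕ) → (α ε δ : ℝ) → ℕ
  estimate : (n k : ℕ) → (α ε δ : ℝ) → (Fin k → Bool) →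
    (Fin (samples n k α ε δ) → List Bool) → ℂ

/-- For every marker and every input string, the estimate is `ε`-accurate with probability greater
than `1 - δ`, for all parameters. -/
def KmerAlgorithm.Solves (A : KmerAlgorithm) (cs : List SyncChannel) : Prop :=
  ∀ (n k : ℕ) (α ε δ : ℝ), α ∈ Set.Icc (-Real.pi) Real.pi → 0 < ε → 0 < δ → δ < 1 →
    ∀ (w : Fin k → Bool) (x : Fin n → Bool),
      1 - δ < (tracesLaw cs (List.ofFn x) (A.samples n k α ε δ)).real
        {t | ‖A.estimate n k α ε δ w t - kmerValue (List.ofFn x) (List.ofFn w) α‖ < ε}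

/-- The sample complexity is at most
`(1 + O(α²)) ^ n * poly(1/ε) * polylog(1/δ)`, up to a factor `exp(O(k)) * poly(n)`
that disappears as soon as `k + log n ≤ α² n`. -/
def KmerAlgorithm.GoodSampleComplexity (A : KmerAlgorithm) : Prop :=
  ∃ C : ℕ, ∀ (n k : ℕ) (α ε δ : ℝ),
    α ∈ Set.Icc (-Real.pi) Real.pi → 0 < ε → 0 < δ → δ < 1 →
      (A.samples n k α ε δ : ℝ) ≤
        C * (Real.exp (C * k) * (n + 1) ^ C) * (1 + C * α ^ 2) ^ n * (1 + 1 / ε) ^ C *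
          (1 + Real.log (1 / δ)) ^ C ∧
      ((k : ℝ) + Real.log n ≤ α ^ 2 * n →
        (A.samples n k α ε δ : ℝ) ≤
          C * (1 + C * α ^ 2) ^ n * (1 + 1 / ε) ^ C * (1 + Real.log (1 / δ)) ^ C)

end

/-! Read bits as signs. A position sum adds, over all sets of positions of a string, the product of
the signs there times a function of the gaps before, between and after them; take this function to
be a product `h₀(g₀) ⋯ h_m(g_m)`. Inserted bits have mean sign zero, so only marked input bits that
survive contribute to the mean over a trace, and the blocks replacing the unmarked bits merely
randomise the gap lengths, independently. Hence the mean over traces of a position sum is a position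
sum of the input in which each `h_i` is replaced by its image under a linear averaging operator: one
operator for every gap before a marked bit, another for the last gap
(`exists_expectation_compositeTrace`).

The indicator of the marker `w` at a position is a product of factors `(1 ± sign)/2`. Expanded and
summed against `e^{ilα}`, it turns the target into a combination of position sums, of total weight
at most 1, with point indicators at the middle gaps, an indicator "long enough" at the last gap, and
a delayed power of `ζ = e^{iα}` at the first (`exists_prefix_expansion`,
`sum_pow_mul_walshSum_drop`). An estimator with small bias is a position sum of the trace whose gap
functions are approximate preimages of these:

Middle gaps: preimages of point indicators are truncated with exponentially decaying error, so that
summing the error over the middle gaps costs `e^{O(k)}` and no power of `n` depending on `k`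
(`ApproxInvertible`). A deletion channel with `q ≥ 1/2` has no decaying preimage; it is split into
deletion channels with smaller parameters, and truncations compose (`ApproxInvertible.comp`).

Last gap: constants are fixed by the operator, so "at least `e`" is 1 minus `e` point indicators.

First gap: powers `z^g` are carried to multiples of powers, and the equation for `z` is a Möbius
transformation fixing 1 whose inverse moves the unit circle off itself only to second order. So
`ζ^g` is the image of `γ z^g` with `|z|² ≤ 1 + O(α²)` if `α` is small. For other `α`, inverting all
`n` values costs `e^{O(n)}`, which is affordable (`exists_first_approx`).

The estimator at a trace `y` is then bounded by a prefactor times about `(1 + O(α²))^{|y|}`. The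
length of a trace has exponential moments `E R^{|y|} ≤ (1 + O(R - 1))^n`, which bounds the second
moment (`exists_kmer_estimator_second_moment`). Chebyshev's inequality for group means and a
majority vote among the groups give the confidence. If `k + log n ≤ α² n`, then `e^{O(k)} poly(n)`
is itself at most a constant times `e^{O(α² n)}`. -/

noncomputable section

/-! ### Expectations under probability mass functions -/

open scoped ENNReal

/-- The expectation of a complex function under a probability mass function. -/
def expectation {β : Type*} (p : PMF β) (f : β → ℂ) : ℂ :=
  ∑' a, ((p a).toReal : ℂ) * f a

/-- The expectation of a nonnegative extended real function. -/
def posExpectation {β : Type*} (p : PMF β) (f : β → ℝ≥0∞) : ℝ≥0∞ :=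
  ∑' a, p a * f a

theorem posExpectation_pure {β : Type*} (a : β) (f : β → ℝ≥0∞) :
    posExpectation (PMF.pure a) f = f a := by
  classical
  unfold posExpectation
  rw [tsum_eq_single a]
  · simp
  · intro b hb
    simp [PMF.pure_apply, hb]

theorem posExpectation_bind {β γ : Type*} (p : PMF β) (q : β → PMF γ) (f : γ → ℝ≥0∞) :
    posExpectation (p.bind q) f = posExpectation p fun a => posExpectation (q a) f := by
  unfold posExpectation
  simp_rw [PMF.bind_apply, ← ENNReal.tsum_mul_right, ← ENNReal.tsum_mul_left]
  rw [ENNReal.tsum_comm]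
  simp_rw [mul_assoc]

theorem posExpectation_map {β γ : Type*} (p : PMF β) (φ : β → γ) (f : γ → ℝ≥0∞) :
    posExpectation (p.map φ) f = posExpectation p fun a => f (φ a) := by
  unfold PMF.map
  rw [posExpectation_bind]
  simp [posExpectation_pure]

theorem posExpectation_mono {β : Type*} (p : PMF β) {f g : β → ℝ≥0∞} (h : ∀ a, f a ≤ g a) :
    posExpectation p f ≤ posExpectation p g :=
  ENNReal.tsum_le_tsum fun a => mul_le_mul_right (h a) _

theorem posExpectation_const_mul {β : Type*} (p : PMF β) (c : ℝ≥0∞) (f : β → ℝ≥0∞) :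
    posExpectation p (fun a => c * f a) = c * posExpectation p f := by
  unfold posExpectation
  rw [← ENNReal.tsum_mul_left]
  exact tsum_congr fun a => by ring

theorem summable_of_posExpectation_ne_top {β : Type*} {p : PMF β} {f : β → ℂ}
    (h : posExpectation p (fun a => ‖f a‖ₑ) ≠ ∞) :
    Summable fun a => ((p a).toReal : ℂ) * f a := by
  apply Summable.of_norm
  have := ENNReal.summable_toReal h
  refine this.congr fun a => ?_
  simp [ENNReal.toReal_mul]

theorem expectation_pure {β : Type*} (a : β) (f : β → ℂ) :
    expectation (PMF.pure a) f = f a := by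
  classical
  unfold expectation
  rw [tsum_eq_single a]
  · simp
  · intro b hb
    simp [PMF.pure_apply, hb]

/-- Fubini; the finite absolute moment under the composed law gives summability of the double
family. -/
theorem expectation_bind {β γ : Type*} (p : PMF β) (q : β → PMF γ) (f : γ → ℂ)
    (h : posExpectation (p.bind q) (fun a => ‖f a‖ₑ) ≠ ∞) :
    expectation (p.bind q) f = expectation p fun a => expectation (q a) f := by
  have hs : Summable fun z : γ × β => ((p z.2).toReal : ℂ) * ((q z.2 z.1).toReal * f z.1) := by
    apply Summable.of_norm
    have h' : ∑' z : γ × β, p z.2 * (q z.2 z.1 * ‖f z.1‖ₑ) ≠ ∞ := by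
      rw [ENNReal.tsum_prod' (f := fun z : γ × β => p z.2 * (q z.2 z.1 * ‖f z.1‖ₑ))]
      convert h using 1
      unfold posExpectation
      refine tsum_congr fun y => ?_
      rw [PMF.bind_apply, ← ENNReal.tsum_mul_right]
      exact tsum_congr fun a => by ring
    refine (ENNReal.summable_toReal h').congr fun z => ?_
    simp [ENNReal.toReal_mul]
  unfold expectation
  simp_rw [← tsum_mul_left]
  rw [Summable.tsum_comm (f := fun b a => ((p a).toReal : ℂ) * ((q a b).toReal * f b)) hs]
  refine tsum_congr fun y => ?_
  rw [PMF.bind_apply, ENNReal.tsum_toReal_eq, Complex.ofReal_tsum, ← tsum_mul_right]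
  · exact tsum_congr fun a => by push_cast [ENNReal.toReal_mul]; ring
  · intro a
    exact ENNReal.mul_ne_top (p.apply_ne_top a) ((q a).apply_ne_top y)

theorem expectation_map {β γ : Type*} (p : PMF β) (φ : β → γ) (f : γ → ℂ)
    (h : posExpectation p (fun a => ‖f (φ a)‖ₑ) ≠ ∞) :
    expectation (p.map φ) f = expectation p fun a => f (φ a) := by
  have h' : posExpectation (p.map φ) (fun a => ‖f a‖ₑ) ≠ ∞ := by
    rwa [posExpectation_map]
  unfold PMF.map at h' ⊢
  rw [expectation_bind _ _ _ h']
  simp [expectation_pure]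

theorem expectation_add {β : Type*} {p : PMF β} {f g : β → ℂ}
    (hf : posExpectation p (fun a => ‖f a‖ₑ) ≠ ∞) (hg : posExpectation p (fun a => ‖g a‖ₑ) ≠ ∞) :
    expectation p (fun a => f a + g a) = expectation p f + expectation p g := by
  unfold expectation
  rw [← (summable_of_posExpectation_ne_top hf).tsum_add (summable_of_posExpectation_ne_top hg)]
  exact tsum_congr fun a => by ring

theorem expectation_const_mul {β : Type*} (p : PMF β) (c : ℂ) (f : β → ℂ) :
    expectation p (fun a => c * f a) = c * expectation p f := by
  unfold expectation
  rw [← tsum_mul_left]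
  exact tsum_congr fun a => by ring

theorem expectation_finset_sum {β ι : Type*} {p : PMF β} (s : Finset ι) {f : ι → β → ℂ}
    (hf : ∀ i ∈ s, posExpectation p (fun a => ‖f i a‖ₑ) ≠ ∞) :
    expectation p (fun a => ∑ i ∈ s, f i a) = ∑ i ∈ s, expectation p (f i) := by
  unfold expectation
  simp_rw [Finset.mul_sum]
  exact Summable.tsum_finsetSum fun i hi => summable_of_posExpectation_ne_top (hf i hi)

theorem expectation_fintype {β : Type*} [Fintype β] (p : PMF β) (f : β → ℂ) :
    expectation p f = ∑ a, ((p a).toReal : ℂ) * f a :=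
  tsum_fintype _

theorem posExpectation_fintype {β : Type*} [Fintype β] (p : PMF β) (f : β → ℝ≥0∞) :
    posExpectation p f = ∑ a, p a * f a :=
  tsum_fintype _

theorem posExpectation_const {β : Type*} (p : PMF β) (c : ℝ≥0∞) :
    posExpectation p (fun _ => c) = c := by
  unfold posExpectation
  rw [ENNReal.tsum_mul_right, p.tsum_coe, one_mul]

end

noncomputable section

/-! ### Sums over sets of positions, indexed by their lists of gaps -/

/-- The bits as signs. -/
def bitSign (b : Bool) : ℂ := if b then -1 else 1

/-- Translation of the first entry of the argument by one. -/
def bumpHead (H : List ℕ → ℂ) : List ℕ → ℂ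
  | [] => H []
  | g :: l => H ((g + 1) :: l)

/-- The sum over all sets of positions of `x` of the product of the weights `s` of the bits at
these positions, times the value of `H` at the list of the lengths of the gaps before, between and
after the positions. -/
def walshSum (s : Bool → ℂ) : (List ℕ → ℂ) → List Bool → ℂ
  | H, [] => H [0]
  | H, b :: x => walshSum s (bumpHead H) x + s b * walshSum s (fun l => H (0 :: l)) x

/-- The product function of a list of functions, on lists of the same length. -/
def prodFun : List (ℕ → ℂ) → List ℕ → ℂ
  | [], [] => 1
  | h :: hs, g :: l => h g * prodFun hs l
  | [], _ :: _ => 0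
  | _ :: _, [] => 0

/-- The translate of a sequence. -/
def shiftSeq (h : ℕ → ℂ) : ℕ → ℂ := fun j => h (j + 1)

/-- The indicator sequence of a single number. -/
def diracSeq (d : ℕ) : ℕ → ℂ := fun j => if j = d then 1 else 0

theorem prodFun_nil_cons (g : ℕ) (l : List ℕ) : prodFun [] (g :: l) = 0 := rfl

theorem prodFun_cons_nil (h : ℕ → ℂ) (hs : List (ℕ → ℂ)) : prodFun (h :: hs) [] = 0 := rfl

theorem prodFun_cons_cons (h : ℕ → ℂ) (hs : List (ℕ → ℂ)) (g : ℕ) (l : List ℕ) :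
    prodFun (h :: hs) (g :: l) = h g * prodFun hs l := rfl

theorem prodFun_eq_zero : ∀ (hs : List (ℕ → ℂ)) (l : List ℕ), hs.length ≠ l.length →
    prodFun hs l = 0
  | [], [], h => absurd rfl h
  | [], _ :: _, _ => rfl
  | _ :: _, [], _ => rfl
  | h :: hs, g :: l, hl => by
    rw [prodFun_cons_cons, prodFun_eq_zero hs l (by simpa using hl), mul_zero]

theorem prodFun_append_singleton : ∀ (hs : List (ℕ → ℂ)) (l : List ℕ) (h : ℕ → ℂ) (g : ℕ),
    prodFun (hs ++ [h]) (l ++ [g]) = prodFun hs l * h g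
  | [], [], h, g => by simp [prodFun]
  | [], a :: l, h, g => by
    rw [prodFun_eq_zero _ _ (by simp), prodFun_nil_cons, zero_mul]
  | a :: hs, [], h, g => by
    rw [prodFun_eq_zero _ _ (by simp), prodFun_cons_nil, zero_mul]
  | a :: hs, b :: l, h, g => by
    rw [List.cons_append, List.cons_append, prodFun_cons_cons, prodFun_cons_cons,
      prodFun_append_singleton hs l h g, mul_assoc]

theorem prodFun_map_dirac : ∀ e l : List ℕ,
    prodFun (e.map diracSeq) l = if l = e then 1 else 0
  | [], [] => by simp [prodFun]
  | [], _ :: _ => by simp [prodFun]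
  | _ :: _, [] => by simp [prodFun]
  | a :: e, b :: l => by
    rw [List.map_cons, prodFun_cons_cons, prodFun_map_dirac e l]
    by_cases h1 : b = a <;> by_cases h2 : l = e <;> simp [diracSeq, h1, h2]

theorem bumpHead_prodFun_cons (h : ℕ → ℂ) (hs : List (ℕ → ℂ)) :
    bumpHead (prodFun (h :: hs)) = prodFun (shiftSeq h :: hs) := by
  funext l
  cases l <;> rfl

theorem walshSum_add (s : Bool → ℂ) (H H' : List ℕ → ℂ) (x : List Bool) :
    walshSum s (fun l => H l + H' l) x = walshSum s H x + walshSum s H' x := by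
  induction x generalizing H H' with
  | nil => rfl
  | cons b x ih =>
    have : bumpHead (fun l => H l + H' l) = fun l => bumpHead H l + bumpHead H' l := by
      funext l; cases l <;> rfl
    simp only [walshSum, this, ih]
    ring

theorem walshSum_const_mul (s : Bool → ℂ) (c : ℂ) (H : List ℕ → ℂ) (x : List Bool) :
    walshSum s (fun l => c * H l) x = c * walshSum s H x := by
  induction x generalizing H with
  | nil => rfl
  | cons b x ih =>
    have : bumpHead (fun l => c * H l) = fun l => c * bumpHead H l := by
      funext l; cases l <;> rfl
    simp only [walshSum, this, ih]
    ring

theorem walshSum_zero (s : Bool → ℂ) (x : List Bool) : walshSum s (fun _ => 0) x = 0 := by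
  simpa using walshSum_const_mul s 0 (fun _ => 0) x

theorem walshSum_finset_sum {ι : Type*} (s : Bool → ℂ) (t : Finset ι) (H : ι → List ℕ → ℂ)
    (x : List Bool) :
    walshSum s (fun l => ∑ i ∈ t, H i l) x = ∑ i ∈ t, walshSum s (H i) x := by
  classical
  induction t using Finset.induction_on with
  | empty => simpa using walshSum_zero s x
  | insert a t ha ih =>
    simp_rw [Finset.sum_insert ha]
    rw [walshSum_add, ih]

/-- A set of positions has one more gap than elements, so an empty list of gaps never occurs. -/
theorem walshSum_congr_of_ne_nil (s : Bool → ℂ) {H H' : List ℕ → ℂ}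
    (h : ∀ l ≠ [], H l = H' l) (x : List Bool) : walshSum s H x = walshSum s H' x := by
  induction x generalizing H H' with
  | nil => exact h _ (by simp)
  | cons b x ih =>
    simp only [walshSum]
    rw [ih (H := bumpHead H) (H' := bumpHead H'), ih (H := fun l => H (0 :: l))]
    · intro l _; exact h _ (by simp)
    · intro l hl
      cases l with
      | nil => exact absurd rfl hl
      | cons g l => exact h _ (by simp)

theorem walshSum_prodFun_nil (s : Bool → ℂ) (x : List Bool) :
    walshSum s (prodFun []) x = 0 := by
  rw [walshSum_congr_of_ne_nil s (H' := fun _ => 0), walshSum_zero]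
  intro l hl
  cases l with
  | nil => exact absurd rfl hl
  | cons g l => rfl

/-- Either the first bit is unmarked and lengthens the first gap by one, or it is marked and closes
that gap at length 0. This recursion drives the inductions over strings. -/
theorem walshSum_prodFun_cons (s : Bool → ℂ) (h : ℕ → ℂ) (hs : List (ℕ → ℂ)) (b : Bool)
    (x : List Bool) :
    walshSum s (prodFun (h :: hs)) (b :: x) =
      walshSum s (prodFun (shiftSeq h :: hs)) x + h 0 * s b * walshSum s (prodFun hs) x := by
  simp only [walshSum, bumpHead_prodFun_cons, prodFun_cons_cons]
  rw [walshSum_const_mul]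
  ring

theorem walshSum_prodFun_singleton (s : Bool → ℂ) (h : ℕ → ℂ) (x : List Bool) :
    walshSum s (prodFun [h]) x = h x.length := by
  induction x generalizing h with
  | nil => simp [walshSum, prodFun]
  | cons b x ih =>
    rw [walshSum_prodFun_cons, ih, walshSum_prodFun_nil]
    simp [shiftSeq]

theorem norm_walshSum_le {s : Bool → ℂ} (hs : ∀ b, ‖s b‖ ≤ 1) {H H' : List ℕ → ℂ}
    (h' : ∀ l, ‖H l‖ ≤ (H' l).re) (x : List Bool) :
    ‖walshSum s H x‖ ≤ (walshSum (fun _ => 1) H' x).re := by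
  induction x generalizing H H' with
  | nil => exact h' _
  | cons b x ih =>
    simp only [walshSum, one_mul, Complex.add_re]
    refine (norm_add_le _ _).trans (add_le_add (ih ?_) ?_)
    · intro l; cases l <;> exact h' _
    · rw [norm_mul]
      calc _ ≤ 1 * ‖walshSum s (fun l => H (0 :: l)) x‖ := by
            gcongr; exact hs b
        _ ≤ _ := by rw [one_mul]; exact ih fun l => h' _

/-- Sort by the first marked position `r`: the suffix behind it contributes at most `B`. Since `k`
is not empty there is such a position, so `r` stays below the length. -/
theorem norm_walshSum_prodFun_cons_le {s : Bool → ℂ} (hs : ∀ b, ‖s b‖ ≤ 1) {B : ℝ}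
    (h : ℕ → ℂ) {k : List (ℕ → ℂ)} (hk : k ≠ [])
    (hB : ∀ y, ‖walshSum s (prodFun k) y‖ ≤ B) (x : List Bool) :
    ‖walshSum s (prodFun (h :: k)) x‖ ≤ B * ∑ r ∈ Finset.range x.length, ‖h r‖ := by
  induction x generalizing h with
  | nil =>
    have : prodFun (h :: k) [0] = 0 := by
      cases k with
      | nil => exact absurd rfl hk
      | cons a k => rw [prodFun_cons_cons, prodFun_cons_nil, mul_zero]
    simp [walshSum, this]
  | cons b x ih =>
    rw [walshSum_prodFun_cons, List.length_cons, Finset.sum_range_succ', mul_add]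
    refine (norm_add_le _ _).trans (add_le_add (ih _) ?_)
    rw [norm_mul, norm_mul]
    have h1 := hB x
    have h2 := hs b
    have h0 : 0 ≤ ‖walshSum s (prodFun k) x‖ := norm_nonneg _
    calc ‖h 0‖ * ‖s b‖ * ‖walshSum s (prodFun k) x‖ ≤ ‖h 0‖ * 1 * B := by gcongr
      _ = _ := by ring

theorem walshSum_prodFun_add (s : Bool → ℂ) (h h' : ℕ → ℂ) (k : List (ℕ → ℂ)) (x : List Bool) :
    walshSum s (prodFun ((fun g => h g + h' g) :: k)) x =
      walshSum s (prodFun (h :: k)) x + walshSum s (prodFun (h' :: k)) x := by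
  rw [← walshSum_add]
  congr 1
  funext l
  cases l with
  | nil => simp [prodFun_cons_nil]
  | cons g l => simp only [prodFun_cons_cons]; ring

theorem walshSum_prodFun_smul (s : Bool → ℂ) (c : ℂ) (h : ℕ → ℂ) (k : List (ℕ → ℂ))
    (x : List Bool) :
    walshSum s (prodFun ((fun g => c * h g) :: k)) x = c * walshSum s (prodFun (h :: k)) x := by
  rw [← walshSum_const_mul]
  congr 1
  funext l
  cases l with
  | nil => simp [prodFun_cons_nil]
  | cons g l => simp only [prodFun_cons_cons]; ring

/-- Only the values of the first function at arguments below the length matter. -/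
theorem walshSum_prodFun_congr {s : Bool → ℂ} {h h' : ℕ → ℂ} {k : List (ℕ → ℂ)}
    (hk : k ≠ []) {x : List Bool} (heq : ∀ g < x.length, h g = h' g) :
    walshSum s (prodFun (h :: k)) x = walshSum s (prodFun (h' :: k)) x := by
  induction x generalizing h h' with
  | nil =>
    obtain ⟨a, k, rfl⟩ := List.exists_cons_of_ne_nil hk
    simp [walshSum, prodFun]
  | cons b x ih =>
    rw [walshSum_prodFun_cons, walshSum_prodFun_cons, heq 0 (by simp),
      ih (h := shiftSeq h) (h' := shiftSeq h')]
    intro g hg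
    exact heq _ (by simpa using hg)

/-- For a fixed string the sum is finite and linear in the first function, so pointwise convergence
suffices. -/
theorem hasSum_walshSum_prodFun {s : Bool → ℂ} {a : ℕ → ℂ} {f : ℕ → ℕ → ℂ} {h : ℕ → ℂ}
    (hf : ∀ g, HasSum (fun j => a j * f j g) (h g)) (k : List (ℕ → ℂ)) (x : List Bool) :
    HasSum (fun j => a j * walshSum s (prodFun (f j :: k)) x)
      (walshSum s (prodFun (h :: k)) x) := by
  induction x generalizing f h with
  | nil =>
    simp only [walshSum, prodFun_cons_cons]
    simpa only [mul_assoc] using (hf 0).mul_right (prodFun k [])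
  | cons b x ih =>
    simp only [walshSum_prodFun_cons]
    have h1 := ih (f := fun j => shiftSeq (f j)) (h := shiftSeq h) fun g => hf (g + 1)
    have h2 := (hf 0).mul_right (s b * walshSum s (prodFun k) x)
    convert h1.add h2 using 1
    · funext j; ring
    · ring

end

noncomputable section

/-! ### Averaging operators on sequences -/

/-- Exponential growth with a given constant and rate. -/
def GrowthLe (B R : ℝ) (h : ℕ → ℂ) : Prop := ∀ g, ‖h g‖ ≤ B * R ^ g

theorem GrowthLe.nonneg {B R : ℝ} {h : ℕ → ℂ} (hh : GrowthLe B R h) : 0 ≤ B := by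
  simpa using (norm_nonneg _).trans (hh 0)

theorem GrowthLe.mono {B B' R R' : ℝ} {h : ℕ → ℂ} (hh : GrowthLe B R h) (hB : B ≤ B')
    (hR0 : 0 ≤ R) (hR : R ≤ R') : GrowthLe B' R' h := fun g =>
  (hh g).trans (mul_le_mul hB (pow_le_pow_left₀ hR0 hR g) (pow_nonneg hR0 g)
    (hh.nonneg.trans hB))

theorem GrowthLe.add {B B' R : ℝ} {h h' : ℕ → ℂ} (hh : GrowthLe B R h) (hh' : GrowthLe B' R h') :
    GrowthLe (B + B') R (fun g => h g + h' g) := fun g => by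
  rw [add_mul]
  exact (norm_add_le _ _).trans (add_le_add (hh g) (hh' g))

theorem GrowthLe.const_mul {B R : ℝ} {h : ℕ → ℂ} (hh : GrowthLe B R h) (c : ℂ) :
    GrowthLe (‖c‖ * B) R (fun g => c * h g) := fun g => by
  rw [norm_mul, mul_assoc]
  exact mul_le_mul_of_nonneg_left (hh g) (norm_nonneg _)

theorem growthLe_of_norm_le {B R : ℝ} (hR : 1 ≤ R) {h : ℕ → ℂ} (hh : ∀ g, ‖h g‖ ≤ B) :
    GrowthLe B R h := fun g => by
  have hB : 0 ≤ B := (norm_nonneg _).trans (hh 0)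
  calc ‖h g‖ ≤ B * 1 := by simpa using hh g
    _ ≤ B * R ^ g := by gcongr; exact one_le_pow₀ hR

theorem norm_diracSeq_le (d g : ℕ) : ‖diracSeq d g‖ ≤ 1 := by
  unfold diracSeq; split_ifs <;> simp

/-- The probability weights of a law on the natural numbers with an exponential tail. -/
structure LightTailed (a : ℕ → ℝ) : Prop where
  nonneg : ∀ j, 0 ≤ a j
  hasSum : HasSum a 1
  tail : ∃ R > 1, Summable fun j => a j * R ^ j

/-- The mean of a sequence over translates drawn from the law `a`. -/
def avgSeq (a : ℕ → ℝ) (h : ℕ → ℂ) : ℕ → ℂ := fun i => ∑' j, (a j : ℂ) * h (i + j)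

/-- The sequence of means of `h` at a sum of one variable of law `b` and `g` variables of
law `a`, all of them independent. -/
def gapOp (a b : ℕ → ℝ) (h : ℕ → ℂ) : ℕ → ℂ := fun g => avgSeq b ((avgSeq a)^[g] h) 0

theorem LightTailed.summable_of_le_one {a : ℕ → ℝ} (ha : LightTailed a) {u : ℝ} (h0 : 0 ≤ u)
    (h1 : u ≤ 1) : Summable fun j => a j * u ^ j :=
  Summable.of_nonneg_of_le (fun j => mul_nonneg (ha.nonneg j) (pow_nonneg h0 j))
    (fun j => mul_le_of_le_one_right (ha.nonneg j) (pow_le_one₀ h0 h1)) ha.hasSum.summable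

/-- By convexity `R ^ j` lies below its chord between `1` and a rate `R₁` with finite moment. The
bound is linear in `R - 1`, and this survives up to the final factor `(1 + O(α²)) ^ n`. -/
theorem LightTailed.exists_tsum_le {a : ℕ → ℝ} (ha : LightTailed a) :
    ∃ C ≥ 0, ∃ R₀ > 1, ∀ R, 1 ≤ R → R ≤ R₀ →
      Summable (fun j => a j * R ^ j) ∧ ∑' j, a j * R ^ j ≤ 1 + C * (R - 1) := by
  obtain ⟨R₁, hR₁, hs⟩ := ha.tail
  have hΦ : 1 ≤ ∑' j, a j * R₁ ^ j := by
    rw [← ha.hasSum.tsum_eq]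
    exact ha.hasSum.summable.tsum_le_tsum
      (fun j => le_mul_of_one_le_right (ha.nonneg j) (one_le_pow₀ hR₁.le)) hs
  refine ⟨(∑' j, a j * R₁ ^ j - 1) / (R₁ - 1), div_nonneg (by linarith) (by linarith), R₁, hR₁,
    fun R h1 h2 => ?_⟩
  have hd : 0 < R₁ - 1 := by linarith
  set t := (R - 1) / (R₁ - 1) with ht
  have ht0 : 0 ≤ t := div_nonneg (by linarith) hd.le
  have ht1 : t ≤ 1 := (div_le_one hd).2 (by linarith)
  have htR : R = (1 - t) * 1 + t * R₁ := by
    have : t * (R₁ - 1) = R - 1 := div_mul_cancel₀ _ hd.ne'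
    linarith
  have hle : ∀ j, a j * R ^ j ≤ (1 - t) * a j + t * (a j * R₁ ^ j) := by
    intro j
    have := (convexOn_pow (𝕜 := ℝ) j).2 (Set.mem_Ici.2 zero_le_one)
      (Set.mem_Ici.2 (zero_le_one.trans hR₁.le)) (sub_nonneg.2 ht1) ht0 (sub_add_cancel 1 t)
    simp only [smul_eq_mul, one_pow, ← htR] at this
    nlinarith [mul_le_mul_of_nonneg_left this (ha.nonneg j)]
  have hs' : Summable fun j => (1 - t) * a j + t * (a j * R₁ ^ j) :=
    (ha.hasSum.summable.mul_left _).add (hs.mul_left _)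
  have hsR : Summable fun j => a j * R ^ j :=
    Summable.of_nonneg_of_le
      (fun j => mul_nonneg (ha.nonneg j) (pow_nonneg (by linarith) j)) hle hs'
  refine ⟨hsR, (hsR.tsum_le_tsum hle hs').trans (le_of_eq ?_)⟩
  rw [(ha.hasSum.summable.mul_left _).tsum_add (hs.mul_left _), tsum_mul_left, tsum_mul_left,
    ha.hasSum.tsum_eq]
  rw [ht]; field_simp; ring

/-- All mass away from `0` is contracted by at least `u`, which leaves `a 0 + (1 - a 0) u < 1`. -/
theorem LightTailed.tsum_lt_one {a : ℕ → ℝ} (ha : LightTailed a) (h0 : a 0 < 1) {u : ℝ}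
    (hu0 : 0 < u) (hu1 : u < 1) : ∃ ρ, 0 < ρ ∧ ρ < 1 ∧ ∑' j, a j * u ^ j ≤ ρ := by
  refine ⟨a 0 + (1 - a 0) * u, ?_, ?_, ?_⟩
  · have := ha.nonneg 0
    have : 0 < (1 - a 0) * u := mul_pos (by linarith) hu0
    linarith
  · nlinarith
  · have hs := ha.summable_of_le_one hu0.le hu1.le
    rw [hs.tsum_eq_zero_add]
    have h1 : ∑' j, a (j + 1) = 1 - a 0 := by
      have := ha.hasSum.summable.tsum_eq_zero_add
      rw [ha.hasSum.tsum_eq] at this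
      linarith
    rw [← h1, ← tsum_mul_right]
    have hs1 : Summable fun j => a (j + 1) := (summable_nat_add_iff 1).2 ha.hasSum.summable
    have hs2 : Summable fun j => a (j + 1) * u ^ (j + 1) := (summable_nat_add_iff 1).2 hs
    have : ∑' j, a (j + 1) * u ^ (j + 1) ≤ ∑' j, a (j + 1) * u :=
      hs2.tsum_le_tsum (fun j => by
        have := pow_le_of_le_one hu0.le hu1.le (Nat.succ_ne_zero j)
        exact mul_le_mul_of_nonneg_left this (ha.nonneg _)) (hs1.mul_right u)
    simpa using this

section
variable {a b : ℕ → ℝ} {B R : ℝ} {h h' : ℕ → ℂ}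

theorem summable_avgSeq (hn : ∀ j, 0 ≤ a j) (hs : Summable fun j => a j * R ^ j)
    (hh : GrowthLe B R h) (i : ℕ) : Summable fun j => (a j : ℂ) * h (i + j) := by
  refine Summable.of_norm_bounded (hs.mul_left (B * R ^ i)) fun j => ?_
  rw [norm_mul, Complex.norm_real, Real.norm_of_nonneg (hn j)]
  calc a j * ‖h (i + j)‖ ≤ a j * (B * R ^ (i + j)) := by gcongr; exacts [hn j, hh _]
    _ = B * R ^ i * (a j * R ^ j) := by rw [pow_add]; ring

theorem GrowthLe.avgSeq (hn : ∀ j, 0 ≤ a j) (hs : Summable fun j => a j * R ^ j)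
    (hh : GrowthLe B R h) : GrowthLe (B * ∑' j, a j * R ^ j) R (avgSeq a h) := by
  intro i
  calc ‖∑' j, (a j : ℂ) * h (i + j)‖ ≤ ∑' j, B * R ^ i * (a j * R ^ j) := by
        refine tsum_of_norm_bounded (hs.mul_left (B * R ^ i)).hasSum fun j => ?_
        rw [norm_mul, Complex.norm_real, Real.norm_of_nonneg (hn j)]
        calc a j * ‖h (i + j)‖ ≤ a j * (B * R ^ (i + j)) := by gcongr; exacts [hn j, hh _]
          _ = B * R ^ i * (a j * R ^ j) := by rw [pow_add]; ring
    _ = _ := by rw [tsum_mul_left]; ring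

theorem GrowthLe.avgSeq_iterate (hn : ∀ j, 0 ≤ a j) (hs : Summable fun j => a j * R ^ j)
    (hh : GrowthLe B R h) (g : ℕ) :
    GrowthLe (B * (∑' j, a j * R ^ j) ^ g) R ((_root_.avgSeq a)^[g] h) := by
  induction g generalizing h B with
  | zero => simpa using hh
  | succ g ih =>
    rw [Function.iterate_succ_apply, pow_succ', ← mul_assoc]
    exact ih (hh.avgSeq hn hs)

theorem GrowthLe.gapOp (hn : ∀ j, 0 ≤ a j) (hs : Summable fun j => a j * R ^ j)
    (hnb : ∀ j, 0 ≤ b j) (hsb : Summable fun j => b j * R ^ j) (hh : GrowthLe B R h) :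
    GrowthLe (B * ∑' j, b j * R ^ j) (∑' j, a j * R ^ j) (gapOp a b h) := by
  intro g
  have := (hh.avgSeq_iterate hn hs g).avgSeq hnb hsb 0
  simp only [pow_zero, mul_one] at this
  refine this.trans (le_of_eq (by ring))

theorem avgSeq_add (hn : ∀ j, 0 ≤ a j) (hs : Summable fun j => a j * R ^ j)
    {B' : ℝ} (hh : GrowthLe B R h) (hh' : GrowthLe B' R h') :
    avgSeq a (fun g => h g + h' g) = fun g => avgSeq a h g + avgSeq a h' g := by
  funext i
  unfold avgSeq
  rw [← (summable_avgSeq hn hs hh i).tsum_add (summable_avgSeq hn hs hh' i)]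
  exact tsum_congr fun j => by ring

theorem avgSeq_smul (a : ℕ → ℝ) (c : ℂ) (h : ℕ → ℂ) :
    avgSeq a (fun g => c * h g) = fun g => c * avgSeq a h g := by
  funext i
  unfold avgSeq
  rw [← tsum_mul_left]
  exact tsum_congr fun j => by ring

theorem avgSeq_iterate_add (hn : ∀ j, 0 ≤ a j) (hs : Summable fun j => a j * R ^ j)
    {B' : ℝ} (hh : GrowthLe B R h) (hh' : GrowthLe B' R h') (g : ℕ) :
    (avgSeq a)^[g] (fun g => h g + h' g) = fun i => (avgSeq a)^[g] h i + (avgSeq a)^[g] h' i := by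
  induction g generalizing h h' B B' with
  | zero => rfl
  | succ g ih =>
    rw [Function.iterate_succ_apply, avgSeq_add hn hs hh hh',
      ih (hh.avgSeq hn hs) (hh'.avgSeq hn hs)]
    rfl

theorem avgSeq_iterate_smul (a : ℕ → ℝ) (c : ℂ) (h : ℕ → ℂ) (g : ℕ) :
    (avgSeq a)^[g] (fun g => c * h g) = fun i => c * (avgSeq a)^[g] h i := by
  induction g generalizing h with
  | zero => rfl
  | succ g ih =>
    rw [Function.iterate_succ_apply, avgSeq_smul, ih]
    rfl

theorem gapOp_add (hn : ∀ j, 0 ≤ a j) (hs : Summable fun j => a j * R ^ j)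
    (hnb : ∀ j, 0 ≤ b j) (hsb : Summable fun j => b j * R ^ j)
    {B' : ℝ} (hh : GrowthLe B R h) (hh' : GrowthLe B' R h') :
    gapOp a b (fun g => h g + h' g) = fun g => gapOp a b h g + gapOp a b h' g := by
  funext g
  unfold gapOp
  rw [avgSeq_iterate_add hn hs hh hh',
    avgSeq_add hnb hsb (hh.avgSeq_iterate hn hs g) (hh'.avgSeq_iterate hn hs g)]

theorem gapOp_smul (a b : ℕ → ℝ) (c : ℂ) (h : ℕ → ℂ) :
    gapOp a b (fun g => c * h g) = fun g => c * gapOp a b h g := by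
  funext g
  unfold gapOp
  rw [avgSeq_iterate_smul, avgSeq_smul]

theorem gapOp_zero (a b : ℕ → ℝ) (h : ℕ → ℂ) : gapOp a b h 0 = avgSeq b h 0 := rfl

theorem gapOp_succ (a b : ℕ → ℝ) (h : ℕ → ℂ) (g : ℕ) :
    gapOp a b h (g + 1) = gapOp a b (avgSeq a h) g := rfl

end

/-- An operator on sequences that is linear on sequences of small exponential growth, preserves
small exponential growth, upper bounds and exponential decay. -/
structure RegularOp (T : (ℕ → ℂ) → ℕ → ℂ) : Prop where
  growth : ∀ R' > 1, ∃ R > 1, (∀ B h, GrowthLe B R h → ∃ B', GrowthLe B' R' (T h)) ∧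
    ∀ B B' h h', GrowthLe B R h → GrowthLe B' R h' →
      T (fun g => h g + h' g) = fun g => T h g + T h' g
  smul : ∀ c h, T (fun g => c * h g) = fun g => c * T h g
  bdd : ∀ B h, (∀ g, ‖h g‖ ≤ B) → ∀ g, ‖T h g‖ ≤ B
  decay : ∀ u, 0 < u → u < 1 → ∃ A ρ : ℝ, 1 ≤ A ∧ 0 < ρ ∧ ρ < 1 ∧
    ∀ B h, GrowthLe B u h → GrowthLe (B * A) ρ (T h)

theorem regularOp_gapOp {a b : ℕ → ℝ} (ha : LightTailed a) (hb : LightTailed b) (h0 : a 0 < 1) :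
    RegularOp (gapOp a b) where
  growth R' hR' := by
    obtain ⟨C, hC, R₁, hR₁, h₁⟩ := ha.exists_tsum_le
    obtain ⟨C₂, hC₂, R₂, hR₂, h₂⟩ := hb.exists_tsum_le
    have hd : 0 < (R' - 1) / (C + 1) := div_pos (by linarith) (by linarith)
    -- The first two bounds make the generating functions of both laws converge at `R`. The third
    -- gives `1 + C (R - 1) ≤ R'`, and the generating function of `a` at `R` is the new growth rate.
    set R := min (min R₁ R₂) (1 + (R' - 1) / (C + 1)) with hR
    have h1R : 1 < R := by
      rw [hR]; exact lt_min (lt_min hR₁ hR₂) (by linarith)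
    have hRR₁ : R ≤ R₁ := (min_le_left _ _).trans (min_le_left _ _)
    have hRR₂ : R ≤ R₂ := (min_le_left _ _).trans (min_le_right _ _)
    have hRR' : 1 + C * (R - 1) ≤ R' := by
      have : R ≤ 1 + (R' - 1) / (C + 1) := min_le_right _ _
      have h3 : (R - 1) * (C + 1) ≤ R' - 1 := by
        rw [← le_div_iff₀ (by linarith)]; linarith
      nlinarith
    obtain ⟨hs, hle⟩ := h₁ R h1R.le hRR₁
    obtain ⟨hsb, -⟩ := h₂ R h1R.le hRR₂
    refine ⟨R, h1R, fun B h hh => ⟨_, (hh.gapOp ha.nonneg hs hb.nonneg hsb).mono le_rfl ?_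
      (hle.trans hRR')⟩, fun B B' h h' hh hh' => gapOp_add ha.nonneg hs hb.nonneg hsb hh hh'⟩
    exact tsum_nonneg fun j => mul_nonneg (ha.nonneg j) (pow_nonneg (by linarith) j)
  smul := gapOp_smul a b
  bdd B h hh g := by
    have h1 : GrowthLe B 1 h := fun g => by simpa using hh g
    have hs : ∀ {c : ℕ → ℝ}, LightTailed c → Summable fun j => c j * 1 ^ j := fun hc =>
      hc.summable_of_le_one zero_le_one le_rfl
    have := h1.gapOp ha.nonneg (hs ha) hb.nonneg (hs hb) g
    simpa [ha.hasSum.tsum_eq, hb.hasSum.tsum_eq] using this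
  decay u hu0 hu1 := by
    -- Decay survives because a block is nonempty with positive probability.
    obtain ⟨ρ, hρ0, hρ1, hρ⟩ := ha.tsum_lt_one h0 hu0 hu1
    have hsa := ha.summable_of_le_one hu0.le hu1.le
    have hsb := hb.summable_of_le_one hu0.le hu1.le
    refine ⟨1, ρ, le_rfl, hρ0, hρ1, fun B h hh => ?_⟩
    refine (hh.gapOp ha.nonneg hsa hb.nonneg hsb).mono ?_ ?_ hρ
    · have : ∑' j, b j * u ^ j ≤ 1 := by
        rw [← hb.hasSum.tsum_eq]
        exact hsb.tsum_le_tsum (fun j => mul_le_of_le_one_right (hb.nonneg j)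
          (pow_le_one₀ hu0.le hu1.le)) hb.hasSum.summable
      exact mul_le_mul_of_nonneg_left this hh.nonneg
    · exact tsum_nonneg fun j => mul_nonneg (ha.nonneg j) (pow_nonneg hu0.le j)

theorem RegularOp.comp {T U : (ℕ → ℂ) → ℕ → ℂ} (hT : RegularOp T) (hU : RegularOp U) :
    RegularOp fun h => T (U h) where
  growth R' hR' := by
    obtain ⟨R₁, hR₁, h₁, h₁'⟩ := hT.growth R' hR'
    obtain ⟨R, hR, h₂, h₂'⟩ := hU.growth R₁ hR₁
    refine ⟨R, hR, fun B h hh => ?_, fun B B' h h' hh hh' => ?_⟩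
    · obtain ⟨B₁, hB₁⟩ := h₂ B h hh
      exact h₁ B₁ _ hB₁
    · obtain ⟨B₁, hB₁⟩ := h₂ B h hh
      obtain ⟨B₂, hB₂⟩ := h₂ B' h' hh'
      rw [h₂' B B' h h' hh hh', h₁' _ _ _ _ hB₁ hB₂]
  smul c h := by rw [hU.smul, hT.smul]
  bdd B h hh := hT.bdd B _ (hU.bdd B h hh)
  decay u hu0 hu1 := by
    obtain ⟨A, ρ, hA, hρ0, hρ1, h⟩ := hU.decay u hu0 hu1
    obtain ⟨A', ρ', hA', hρ0', hρ1', h'⟩ := hT.decay ρ hρ0 hρ1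
    refine ⟨A * A', ρ', one_le_mul_of_one_le_of_one_le hA hA', hρ0', hρ1', fun B f hf => ?_⟩
    rw [← mul_assoc]
    exact h' _ _ (h _ _ hf)

theorem RegularOp.const_mul {T : (ℕ → ℂ) → ℕ → ℂ} (hT : RegularOp T) {c : ℂ} (hc : ‖c‖ ≤ 1) :
    RegularOp fun h g => c * T h g where
  growth R' hR' := by
    obtain ⟨R, hR, h₁, h₁'⟩ := hT.growth R' hR'
    refine ⟨R, hR, fun B h hh => ?_, fun B B' h h' hh hh' => ?_⟩
    · obtain ⟨B₁, hB₁⟩ := h₁ B h hh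
      exact ⟨_, hB₁.const_mul c⟩
    · rw [h₁' B B' h h' hh hh']
      funext g; ring
  smul d h := by
    funext g
    rw [hT.smul]; ring
  bdd B h hh g := by
    rw [norm_mul]
    have := hT.bdd B h hh g
    nlinarith [norm_nonneg c, norm_nonneg (T h g)]
  decay u hu0 hu1 := by
    obtain ⟨A, ρ, hA, hρ0, hρ1, h⟩ := hT.decay u hu0 hu1
    refine ⟨A, ρ, hA, hρ0, hρ1, fun B f hf => ((h B f hf).const_mul c).mono ?_ hρ0.le le_rfl⟩
    have : 0 ≤ B * A := mul_nonneg hf.nonneg (by linarith)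
    nlinarith [norm_nonneg c]

theorem regularOp_id : RegularOp fun h => h where
  growth R' hR' := ⟨R', hR', fun B _ hh => ⟨B, hh⟩, fun _ _ _ _ _ _ => rfl⟩
  smul _ _ := rfl
  bdd _ _ hh := hh
  decay u hu0 hu1 := ⟨1, u, le_rfl, hu0, hu1, fun B h hh => by rwa [mul_one]⟩

theorem RegularOp.map_zero {T : (ℕ → ℂ) → ℕ → ℂ} (hT : RegularOp T) :
    T (fun _ => 0) = fun _ => 0 := by
  simpa using hT.smul 0 (fun _ => 0)

theorem RegularOp.add_of_bdd {T : (ℕ → ℂ) → ℕ → ℂ} (hT : RegularOp T)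
    {B B' : ℝ} {h h' : ℕ → ℂ} (hh : ∀ g, ‖h g‖ ≤ B)
    (hh' : ∀ g, ‖h' g‖ ≤ B') : T (fun g => h g + h' g) = fun g => T h g + T h' g := by
  obtain ⟨R, hR, -, h2⟩ := hT.growth 2 (by norm_num)
  exact h2 B B' h h' (growthLe_of_norm_le hR.le hh) (growthLe_of_norm_le hR.le hh')

theorem RegularOp.sum_of_bdd {T : (ℕ → ℂ) → ℕ → ℂ} (hT : RegularOp T)
    {ι : Type*} (t : Finset ι) {h : ι → ℕ → ℂ}
    (hh : ∀ i ∈ t, ∃ B, ∀ g, ‖h i g‖ ≤ B) :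
    T (fun g => ∑ i ∈ t, h i g) = fun g => ∑ i ∈ t, T (h i) g := by
  classical
  induction t using Finset.induction_on with
  | empty => simpa using hT.map_zero
  | insert i t hi ih =>
    simp_rw [Finset.sum_insert hi]
    obtain ⟨B, hB⟩ := hh i (by simp)
    have hh' : ∀ j ∈ t, ∃ B, ∀ g, ‖h j g‖ ≤ B := fun j hj => hh j (by simp [hj])
    choose! B' hB' using hh'
    rw [hT.add_of_bdd hB (h' := fun g => ∑ i ∈ t, h i g) (B' := ∑ i ∈ t, B' i), ih]
    · exact fun j hj => ⟨_, hB' j hj⟩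
    · exact fun g => (norm_sum_le _ _).trans (Finset.sum_le_sum fun j hj => hB' j hj g)

end

noncomputable section

/-! ### Approximate inverses -/

/-- The action of an operator on sequences in every variable of a function of lists. -/
def liftOp (T : (ℕ → ℂ) → ℕ → ℂ) : List ℕ → (List ℕ → ℂ) → ℂ
  | [], H => H []
  | g :: l, H => T (fun j => liftOp T l fun l' => H (j :: l')) g

section
variable {T : (ℕ → ℂ) → ℕ → ℂ}

theorem liftOp_smul (hT : RegularOp T) (c : ℂ) (l : List ℕ) (H : List ℕ → ℂ) :
    liftOp T l (fun l' => c * H l') = c * liftOp T l H := by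
  induction l generalizing H with
  | nil => rfl
  | cons g l ih => simp only [liftOp, ih, hT.smul]

theorem liftOp_zero (hT : RegularOp T) (l : List ℕ) : liftOp T l (fun _ => 0) = 0 := by
  simpa using liftOp_smul hT 0 l (fun _ => 0)

theorem norm_liftOp_le (hT : RegularOp T) {B : ℝ} (l : List ℕ) {H : List ℕ → ℂ}
    (hH : ∀ l, ‖H l‖ ≤ B) : ‖liftOp T l H‖ ≤ B := by
  induction l generalizing H with
  | nil => exact hH _
  | cons g l ih => exact hT.bdd B _ (fun j => ih fun l' => hH _) g

theorem liftOp_add (hT : RegularOp T) {B B' : ℝ} (l : List ℕ) {H H' : List ℕ → ℂ}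
    (hH : ∀ l, ‖H l‖ ≤ B) (hH' : ∀ l, ‖H' l‖ ≤ B') :
    liftOp T l (fun l' => H l' + H' l') = liftOp T l H + liftOp T l H' := by
  induction l generalizing H H' with
  | nil => rfl
  | cons g l ih =>
    simp only [liftOp]
    have h1 := congrFun (hT.add_of_bdd (B := B) (B' := B')
      (h := fun j => liftOp T l fun l' => H (j :: l'))
      (h' := fun j => liftOp T l fun l' => H' (j :: l'))
      (fun j => norm_liftOp_le hT l fun _ => hH _)
      fun j => norm_liftOp_le hT l fun _ => hH' _) g
    rw [← h1]
    congr 1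
    funext j
    exact ih (fun _ => hH _) fun _ => hH' _

theorem liftOp_sum (hT : RegularOp T) {ι : Type*} (t : Finset ι) (l : List ℕ)
    {H : ι → List ℕ → ℂ} {B : ι → ℝ} (hH : ∀ i l, ‖H i l‖ ≤ B i) :
    liftOp T l (fun l' => ∑ i ∈ t, H i l') = ∑ i ∈ t, liftOp T l (H i) := by
  classical
  induction t using Finset.induction_on with
  | empty => simpa using liftOp_zero hT l
  | insert i t hi ih =>
    simp_rw [Finset.sum_insert hi]
    rw [liftOp_add hT (B' := ∑ i ∈ t, B i) l (hH i), ih]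
    exact fun l => (norm_sum_le _ _).trans (Finset.sum_le_sum fun j _ => hH j l)

theorem liftOp_prodFun (hT : RegularOp T) : ∀ (hs : List (ℕ → ℂ)) (l : List ℕ),
    liftOp T l (prodFun hs) = prodFun (hs.map T) l
  | [], [] => rfl
  | _ :: _, [] => rfl
  | [], g :: l => by
    simp only [liftOp, prodFun_nil_cons, liftOp_zero hT, hT.map_zero, List.map_nil]
  | h :: hs, g :: l => by
    simp only [liftOp, prodFun_cons_cons, liftOp_smul hT, List.map_cons]
    rw [liftOp_prodFun hT hs l]
    have := congrFun (hT.smul (prodFun (hs.map T) l) h) g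
    simp only [mul_comm (prodFun (hs.map T) l)] at this
    exact this

/-- The one-variable decay estimate is applied in each variable in turn and costs a factor `A` each
time. -/
theorem norm_liftOp_le_of_decay {u A ρ : ℝ}
    (hd : ∀ B h, GrowthLe B u h → GrowthLe (B * A) ρ (T h)) {B : ℝ} (l : List ℕ)
    {H : List ℕ → ℂ} (hH : ∀ l, ‖H l‖ ≤ B * u ^ l.sum) :
    ‖liftOp T l H‖ ≤ B * A ^ l.length * ρ ^ l.sum := by
  induction l generalizing H B with
  | nil => simpa [liftOp] using hH []
  | cons g l ih =>
    have h1 : GrowthLe (B * A ^ l.length * ρ ^ l.sum) u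
        fun j => liftOp T l fun l' => H (j :: l') := by
      intro j
      refine (ih (B := B * u ^ j) fun l' => ?_).trans (le_of_eq (by ring))
      refine (hH _).trans (le_of_eq ?_)
      rw [List.sum_cons, pow_add]; ring
    refine (hd _ _ h1 g).trans (le_of_eq ?_)
    rw [List.sum_cons, List.length_cons, pow_add, pow_succ]; ring

end

/-- Products of indicator sequences can be approximated, with exponentially decaying errors, by
the images of finitely supported functions of moderate norm. -/
def ApproxInvertible (T : (ℕ → ℂ) → ℕ → ℂ) : Prop :=
  ∀ r : ℝ, 1 ≤ r → ∃ (A : ℕ) (ρ : ℝ), 1 ≤ A ∧ 0 < ρ ∧ ρ < 1 ∧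
    ∀ (e : List ℕ) (θ : ℝ), 0 < θ → θ ≤ 1 →
      ∃ (ι : Type) (_ : Fintype ι) (c : ι → ℂ) (j : ι → List ℕ),
        (∀ i, (j i).length = e.length) ∧
        ∑ i, r ^ (j i).sum * ‖c i‖ ≤ (A : ℝ) ^ (e.sum + e.length + 1) * (1 / θ) ^ A ∧
        ∀ g, ‖∑ i, c i * prodFun ((j i).map fun d => T (diracSeq d)) g -
          (if g = e then 1 else 0)‖ ≤ θ * ρ ^ g.sum

/-- The lists of length `m` with entries below `D`. -/
def boxLists (D : ℕ) : ℕ → Finset (List ℕ)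
  | 0 => {[]}
  | m + 1 => (Finset.range D ×ˢ boxLists D m).image fun z => z.1 :: z.2

theorem mem_boxLists {D : ℕ} : ∀ {m : ℕ} {l : List ℕ},
    l ∈ boxLists D m ↔ l.length = m ∧ ∀ g ∈ l, g < D
  | 0, l => by
    simp only [boxLists, Finset.mem_singleton, List.length_eq_zero_iff]
    exact ⟨fun h => ⟨h, by simp [h]⟩, fun h => h.1⟩
  | m + 1, [] => by simp [boxLists]
  | m + 1, g :: l => by
    simp only [boxLists, Finset.mem_image, Finset.mem_product, Finset.mem_range, Prod.exists,
      mem_boxLists (m := m), List.cons.injEq, List.length_cons, List.mem_cons, forall_eq_or_imp,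
      Nat.add_right_cancel_iff]
    constructor
    · rintro ⟨a, b, ⟨h1, h2, h3⟩, rfl, rfl⟩
      exact ⟨h2, h1, h3⟩
    · rintro ⟨h2, h1, h3⟩
      exact ⟨g, l, ⟨h1, h2, h3⟩, rfl, rfl⟩

theorem sum_boxLists_pow_le {u : ℝ} (h0 : 0 < u) (h1 : u < 1) (D m : ℕ) :
    ∑ l ∈ boxLists D m, u ^ l.sum ≤ (1 / (1 - u)) ^ m := by
  induction m with
  | zero => simp [boxLists]
  | succ m ih =>
    rw [boxLists, Finset.sum_image (by rintro ⟨a, b⟩ _ ⟨c, d⟩ _ h; simpa using h),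
      Finset.sum_product]
    simp only [List.sum_cons, pow_add, ← Finset.mul_sum, ← Finset.sum_mul]
    have h2 : ∑ i ∈ Finset.range D, u ^ i ≤ 1 / (1 - u) := by
      rw [one_div, ← tsum_geometric_of_lt_one h0.le h1]
      exact (summable_geometric_of_lt_one h0.le h1).sum_le_tsum _ fun i _ => pow_nonneg h0.le i
    rw [pow_one, mul_comm]
    exact mul_le_mul ih h2 (Finset.sum_nonneg fun i _ => pow_nonneg h0.le i)
      (pow_nonneg (by rw [one_div, inv_nonneg]; linarith) m)

theorem norm_prodFun_map_le {A u : ℝ} (hu : 0 ≤ u) (hA : 0 ≤ A)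
    {h : ℕ → ℕ → ℂ} (hb : ∀ d, GrowthLe (A ^ (d + 1)) u (h d)) : ∀ e l : List ℕ,
    ‖prodFun (e.map h) l‖ ≤ A ^ (e.sum + e.length) * u ^ l.sum
  | [], [] => by simp [prodFun]
  | [], g :: l => by simpa [prodFun] using pow_nonneg hu _
  | d :: e, [] => by simpa [prodFun] using pow_nonneg hA _
  | d :: e, g :: l => by
    rw [List.map_cons, prodFun_cons_cons, norm_mul]
    refine (mul_le_mul (hb d g) (norm_prodFun_map_le hu hA hb e l) (norm_nonneg _)
      (mul_nonneg (pow_nonneg hA _) (pow_nonneg hu _))).trans (le_of_eq ?_)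
    simp only [List.sum_cons, List.length_cons]
    ring

/-- A cutoff that is just large enough: it overshoots by at most one factor `1 / v`, so `(1 / v) ^
D` stays linear in the required precision `X`. -/
theorem exists_pow_mul_le_one {v X : ℝ} (h0 : 0 < v) (h1 : v < 1) (hX : 1 ≤ X) :
    ∃ D : ℕ, v ^ D * X ≤ 1 ∧ (1 / v) ^ D ≤ X / v := by
  obtain ⟨n, hn1, hn2⟩ := exists_nat_pow_near hX (one_lt_one_div h0 h1)
  refine ⟨n + 1, ?_, ?_⟩
  · rw [one_div, inv_pow] at hn2
    have := pow_pos h0 (n + 1)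
    calc v ^ (n + 1) * X ≤ v ^ (n + 1) * (v ^ (n + 1))⁻¹ := by gcongr
      _ = 1 := mul_inv_cancel₀ this.ne'
  · rw [pow_succ, mul_one_div]
    gcongr

/-- The product of the exact preimages is cut off at total gap `D`. With `u = v²`, half of the decay
of the discarded part gives the small factor `v ^ D` and the other half remains as decay, which `T`
preserves up to constants. As `D` is logarithmic in the precision, weights `r ^ sum` below the
cutoff are only polynomial in it. -/
theorem approxInvertible_of_exact {T : (ℕ → ℂ) → ℕ → ℂ} (hT : RegularOp T) {A u : ℝ}
    (hA : 1 ≤ A) (hu0 : 0 < u) (hu1 : u < 1) {h : ℕ → ℕ → ℂ} (hinv : ∀ d, T (h d) = diracSeq d)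
    (hb : ∀ d, GrowthLe (A ^ (d + 1)) u (h d)) : ApproxInvertible T := by
  intro r hr
  set v := √u with hv
  have hv0 : 0 < v := Real.sqrt_pos.2 hu0
  have hv1 : v < 1 := by rw [hv, Real.sqrt_lt' one_pos]; simpa using hu1
  have hvu : v * v = u := Real.mul_self_sqrt hu0.le
  obtain ⟨A₂, ρ, hA₂, hρ0, hρ1, hdec⟩ := hT.decay v hv0 hv1
  -- With `r < (1 / v) ^ s`, the weight below the cutoff is at most `((1 / v) ^ D) ^ s ≤ (X / v) ^
  -- s`.
  obtain ⟨s, hs⟩ := pow_unbounded_of_one_lt r (one_lt_one_div hv0 hv1)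
  obtain ⟨N, hN⟩ := exists_nat_ge (A + A₂ + 1 / v + 1 / (1 - u))
  have hiv : 1 < 1 / v := one_lt_one_div hv0 hv1
  have hiu : 0 < 1 / (1 - u) := one_div_pos.2 (by linarith)
  have hNA : A ≤ N := by linarith
  have hNA₂ : A₂ ≤ N := by linarith
  have hNv : 1 / v ≤ N := by linarith
  have hNu : 1 / (1 - u) ≤ N := by linarith
  have hN1 : (1 : ℝ) ≤ N := hA.trans hNA
  have hN1' : 1 ≤ N := by exact_mod_cast hN1
  refine ⟨N ^ (2 * s + 2) + s, ρ, ?_, hρ0, hρ1, fun e θ hθ0 hθ1 => ?_⟩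
  · have := Nat.one_le_pow (2 * s + 2) N hN1'
    omega
  set E := e.sum + e.length with hE
  set m := e.length with hm
  -- The precision needed: `A ^ E` bounds the preimages, `A₂ ^ m` is the cost of carrying the tail
  -- through `T` in `m` variables.
  set X := A ^ E * A₂ ^ m / θ with hX
  have hX1 : 1 ≤ X := by
    rw [hX, le_div_iff₀ hθ0, one_mul]
    exact hθ1.trans (one_le_mul_of_one_le_of_one_le (one_le_pow₀ hA) (one_le_pow₀ hA₂))
  obtain ⟨D, hD1, hD2⟩ := exists_pow_mul_le_one hv0 hv1 hX1
  set c : List ℕ → ℂ := fun j => if j.sum < D then prodFun (e.map h) j else 0 with hc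
  refine ⟨boxLists D m, inferInstance, fun j => c j, fun j => j,
    fun j => (mem_boxLists.1 j.2).1, ?_, ?_⟩
  · rw [Finset.sum_coe_sort (boxLists D m) fun j => r ^ j.sum * ‖c j‖]
    have h1 : ∀ j ∈ boxLists D m, r ^ j.sum * ‖c j‖ ≤ (X / v) ^ s * A ^ E * u ^ j.sum := by
      intro j _
      have hXv : 0 ≤ X / v := div_nonneg (by linarith) hv0.le
      by_cases hj : j.sum < D
      · simp only [hc, hj, if_true]
        rw [mul_assoc]
        refine mul_le_mul ?_ (norm_prodFun_map_le hu0.le (by linarith) hb e j) (norm_nonneg _)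
          (pow_nonneg hXv s)
        calc r ^ j.sum ≤ ((1 / v) ^ s) ^ j.sum := by gcongr
          _ ≤ ((1 / v) ^ s) ^ D := by
            gcongr
            exact one_le_pow₀ hiv.le
          _ = ((1 / v) ^ D) ^ s := by rw [← pow_mul, ← pow_mul, mul_comm]
          _ ≤ _ := by gcongr
      · simp only [hc, hj, if_false, norm_zero, mul_zero]
        positivity
    refine (Finset.sum_le_sum h1).trans ?_
    rw [← Finset.mul_sum]
    have hiθ : 1 ≤ 1 / θ := by rw [le_div_iff₀ hθ0]; linarith
    have hXN : X / v ≤ (N : ℝ) ^ (2 * (E + 1)) * (1 / θ) := by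
      calc X / v = A ^ E * A₂ ^ m * (1 / v) * (1 / θ) := by rw [hX]; ring
        _ ≤ (N : ℝ) ^ E * N ^ m * N * (1 / θ) := by gcongr
        _ = (N : ℝ) ^ (E + m + 1) * (1 / θ) := by ring
        _ ≤ _ := by
          refine mul_le_mul_of_nonneg_right (pow_le_pow_right₀ hN1 (by omega)) (by positivity)
    calc (X / v) ^ s * A ^ E * ∑ j ∈ boxLists D m, u ^ j.sum
        ≤ ((N : ℝ) ^ (2 * (E + 1)) * (1 / θ)) ^ s * (N : ℝ) ^ E * (N : ℝ) ^ m := by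
          refine mul_le_mul (mul_le_mul (pow_le_pow_left₀ (div_nonneg (by linarith) hv0.le) hXN _)
            (pow_le_pow_left₀ (by linarith) hNA _) (by positivity) (by positivity))
            ((sum_boxLists_pow_le hu0 hu1 D m).trans (pow_le_pow_left₀ hiu.le hNu _))
            (Finset.sum_nonneg fun _ _ => pow_nonneg hu0.le _) (by positivity)
      _ = (N : ℝ) ^ (2 * (E + 1) * s + E + m) * (1 / θ) ^ s := by
          rw [mul_pow, ← pow_mul]; ring
      _ ≤ (N : ℝ) ^ ((2 * s + 2) * (E + 1)) * (1 / θ) ^ (N ^ (2 * s + 2) + s) := by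
          have : m ≤ E := by omega
          exact mul_le_mul (pow_le_pow_right₀ hN1 (by nlinarith))
            (pow_le_pow_right₀ hiθ (by omega)) (by positivity) (by positivity)
      _ ≤ _ := by
          rw [pow_mul]
          push_cast
          gcongr
          exact le_add_of_nonneg_right (Nat.cast_nonneg s)
  · intro g
    rw [Finset.sum_coe_sort (boxLists D m)
      fun j => c j * prodFun (j.map fun d => T (diracSeq d)) g]
    by_cases hg : g.length = m
    swap
    · rw [Finset.sum_eq_zero, if_neg]
      · simpa using mul_nonneg hθ0.le (pow_nonneg hρ0.le _)
      · rintro rfl; exact hg rfl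
      · intro j hj
        rw [prodFun_eq_zero, mul_zero]
        rw [List.length_map, (mem_boxLists.1 hj).1]
        exact fun h => hg h.symm
    have hcb : ∀ j l, ‖c j * prodFun (j.map diracSeq) l‖ ≤ ‖c j‖ := by
      intro j l
      rw [norm_mul, prodFun_map_dirac]
      split_ifs <;> simp
    have hfull : ∀ l, ‖prodFun (e.map h) l‖ ≤ A ^ E := fun l =>
      (norm_prodFun_map_le hu0.le (by linarith) hb e l).trans
        (mul_le_of_le_one_right (pow_nonneg (by linarith) _) (pow_le_one₀ hu0.le hu1.le))
    -- The truncation error before the operator acts. Its image under `T` in every variable is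
    -- exactly the error to be bounded.
    set tail : List ℕ → ℂ := fun l =>
      ∑ j ∈ boxLists D m, c j * prodFun (j.map diracSeq) l + (-1) * prodFun (e.map h) l with htail
    have htl : ∀ l, ‖tail l‖ ≤ A ^ E * v ^ D * v ^ l.sum := by
      intro l
      have hsum : ∑ j ∈ boxLists D m, c j * prodFun (j.map diracSeq) l =
          if l ∈ boxLists D m then c l else 0 := by
        simp_rw [prodFun_map_dirac, mul_ite, mul_one, mul_zero, Finset.sum_ite_eq]
      have hnn : 0 ≤ A ^ E * v ^ D * v ^ l.sum := by positivity
      simp only [htail, hsum]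
      by_cases hl : l.length = m
      swap
      · rw [if_neg (fun h => hl (mem_boxLists.1 h).1), prodFun_eq_zero]
        · simpa using hnn
        · rw [List.length_map]; exact fun h => hl h.symm
      by_cases hlD : l.sum < D
      · have hmem : l ∈ boxLists D m :=
          mem_boxLists.2 ⟨hl, fun g hg => (List.single_le_sum (by simp) g hg).trans_lt hlD⟩
        rw [if_pos hmem]
        simp only [hc, hlD, if_true]
        simpa using hnn
      · have h0 : (if l ∈ boxLists D m then c l else 0) = 0 := by
          simp [hc, hlD]
        rw [h0, zero_add, neg_one_mul, norm_neg]
        refine (norm_prodFun_map_le hu0.le (by linarith) hb e l).trans ?_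
        rw [← hvu, mul_pow, mul_assoc]
        have := pow_le_pow_of_le_one hv0.le hv1.le (not_lt.1 hlD)
        gcongr
    have hlift := norm_liftOp_le_of_decay hdec g htl
    have hexp : liftOp T g tail = ∑ j ∈ boxLists D m,
        c j * prodFun (j.map fun d => T (diracSeq d)) g - if g = e then 1 else 0 := by
      simp only [htail]
      rw [liftOp_add hT (B := ∑ j ∈ boxLists D m, ‖c j‖) (B' := A ^ E) g,
        liftOp_sum hT _ g hcb, liftOp_smul hT, liftOp_prodFun hT, List.map_map]
      · have : T ∘ h = diracSeq := funext hinv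
        rw [this, prodFun_map_dirac, neg_one_mul, ← sub_eq_add_neg]
        congr 1
        refine Finset.sum_congr rfl fun j _ => ?_
        rw [liftOp_smul hT, liftOp_prodFun hT, List.map_map]
        rfl
      · exact fun l => (norm_sum_le _ _).trans (Finset.sum_le_sum fun j _ => hcb j l)
      · intro l
        simpa using hfull l
    rw [← hexp]
    refine hlift.trans ?_
    rw [hg]
    gcongr
    have h2 : v ^ D * (A ^ E * A₂ ^ m) ≤ θ := by
      have : v ^ D * (A ^ E * A₂ ^ m) = (v ^ D * X) * θ := by rw [hX]; field_simp
      rw [this]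
      nlinarith
    calc A ^ E * v ^ D * A₂ ^ m = v ^ D * (A ^ E * A₂ ^ m) := by ring
      _ ≤ θ := h2

end

/-! ### Composition and scaling of approximate inverses. -/

noncomputable section

/-- Approximate the target by images under `T` of indicators, then each of these indicators by
images under `U`. The second stage costs more for indicators at larger gaps, exponentially in the
sum of the gaps; the free weight `r` in `ApproxInvertible` exists to pay for this. -/
theorem ApproxInvertible.comp {T U : (ℕ → ℂ) → ℕ → ℂ} (hT : RegularOp T) (hU : RegularOp U)
    (hTi : ApproxInvertible T) (hUi : ApproxInvertible U) :
    ApproxInvertible fun h => T (U h) := by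
  intro r hr
  obtain ⟨Ab, ρb, hAb, hρb0, hρb1, hb⟩ := hUi r hr
  obtain ⟨A₁, ρ₁, hA₁, hρ₁0, hρ₁1, hdec⟩ := hT.decay ρb hρb0 hρb1
  have hAb' : (1 : ℝ) ≤ Ab := by exact_mod_cast hAb
  -- The weight for `T` is the base of the cost for `U`, so the weighted sum of the coefficients of
  -- the first stage already contains the cost of the second.
  obtain ⟨Aa, ρa, hAa, hρa0, hρa1, ha⟩ := hTi Ab hAb'
  have hAa' : (1 : ℝ) ≤ Aa := by exact_mod_cast hAa
  obtain ⟨N, hN⟩ := exists_nat_ge ((Aa : ℝ) + Ab + A₁ + 2)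
  have hNa : (Aa : ℝ) ≤ N := by linarith
  have hNb : (Ab : ℝ) ≤ N := by linarith
  have hN₁ : A₁ ≤ N := by linarith
  have hN2 : (2 : ℝ) ≤ N := by linarith
  have hN1 : (1 : ℝ) ≤ N := by linarith
  set K := 1 + (3 + Aa) * Ab + 1 + Aa with hK
  set K' := (Aa + 1) * Ab + Aa with hK'
  refine ⟨N ^ K + K', max ρ₁ ρa, ?_, lt_max_of_lt_left hρ₁0, max_lt hρ₁1 hρa1,
    fun e θ hθ0 hθ1 => ?_⟩
  · have := Nat.one_le_pow K N (by exact_mod_cast hN1)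
    omega
  have hiθ : 1 ≤ 1 / θ := by rw [le_div_iff₀ hθ0]; linarith
  set m := e.length with hm
  set w := e.sum + m + 1 with hw
  have hw1 : 1 ≤ w := by omega
  have hmw : m + 1 ≤ w := by omega
  obtain ⟨ι, _, c, j, hj, hcn, hca⟩ := ha e (θ / 2) (by linarith) (by linarith)
  set Na : ℝ := (Aa : ℝ) ^ w * (1 / (θ / 2)) ^ Aa with hNa_def
  have hNa1 : 1 ≤ Na := by
    refine one_le_mul_of_one_le_of_one_le (one_le_pow₀ hAa') (one_le_pow₀ ?_)
    rw [le_div_iff₀ (by linarith)]; linarith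
  -- Errors of the second stage are amplified by the total coefficient `Na` of the first and by `A₁
  -- ^ m` from passing through `T`; they may use up `θ / 2`.
  set θb := θ / (2 * Na * A₁ ^ m) with hθb
  have hden : 1 ≤ Na * A₁ ^ m := one_le_mul_of_one_le_of_one_le hNa1 (one_le_pow₀ hA₁)
  have hθb0 : 0 < θb := div_pos hθ0 (by positivity)
  have hθb1 : θb ≤ 1 := by
    rw [hθb, div_le_one (by positivity)]
    linarith
  choose κ hκ d l hl hdn hda using fun i => hb (j i) θb hθb0 hθb1
  refine ⟨Σ i, κ i, inferInstance, fun z => c z.1 * d z.1 z.2, fun z => l z.1 z.2,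
    fun z => (hl z.1 z.2).trans (hj z.1), ?_, ?_⟩
  · rw [Fintype.sum_sigma]
    have h1 : ∀ i, ∑ z, r ^ (l i z).sum * ‖c i * d i z‖ ≤
        ((Ab : ℝ) ^ (j i).sum * ‖c i‖) * ((Ab : ℝ) ^ (m + 1) * (1 / θb) ^ Ab) := by
      intro i
      calc ∑ z, r ^ (l i z).sum * ‖c i * d i z‖ = ‖c i‖ * ∑ z, r ^ (l i z).sum * ‖d i z‖ := by
            rw [Finset.mul_sum]
            exact Finset.sum_congr rfl fun z _ => by rw [norm_mul]; ring
        _ ≤ ‖c i‖ * ((Ab : ℝ) ^ ((j i).sum + (j i).length + 1) * (1 / θb) ^ Ab) := by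
            gcongr; exact hdn i
        _ = _ := by rw [hj, ← hm, add_assoc, pow_add]; ring
    refine (Finset.sum_le_sum fun i _ => h1 i).trans ?_
    rw [← Finset.sum_mul]
    have hNaN : Na ≤ (N : ℝ) ^ (w * (1 + Aa)) * (1 / θ) ^ Aa := by
      have : 1 / (θ / 2) = 2 * (1 / θ) := by field_simp
      rw [hNa_def, this, mul_pow, ← mul_assoc]
      gcongr
      calc (Aa : ℝ) ^ w * 2 ^ Aa ≤ (N : ℝ) ^ w * N ^ Aa := by gcongr
        _ = (N : ℝ) ^ (w + Aa) := by ring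
        _ ≤ _ := pow_le_pow_right₀ hN1 (by nlinarith)
    have hθbN : 1 / θb ≤ (N : ℝ) ^ (w * (3 + Aa)) * (1 / θ) ^ (Aa + 1) := by
      calc 1 / θb = 2 * Na * A₁ ^ m * (1 / θ) := by rw [hθb]; field_simp
        _ ≤ N * ((N : ℝ) ^ (w * (1 + Aa)) * (1 / θ) ^ Aa) * N ^ m * (1 / θ) := by gcongr
        _ = (N : ℝ) ^ (w * (1 + Aa) + m + 1) * (1 / θ) ^ (Aa + 1) := by ring
        _ ≤ _ := by
          refine mul_le_mul_of_nonneg_right (pow_le_pow_right₀ hN1 (by nlinarith)) (by positivity)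
    calc _ ≤ Na * ((Ab : ℝ) ^ (m + 1) * (1 / θb) ^ Ab) := by gcongr
      _ ≤ ((N : ℝ) ^ (w * (1 + Aa)) * (1 / θ) ^ Aa) *
          ((N : ℝ) ^ w * ((N : ℝ) ^ (w * (3 + Aa)) * (1 / θ) ^ (Aa + 1)) ^ Ab) := by
        have : (Ab : ℝ) ^ (m + 1) ≤ (N : ℝ) ^ w :=
          (pow_le_pow_left₀ (by linarith) hNb _).trans (pow_le_pow_right₀ hN1 (by omega))
        have hp : (0 : ℝ) ≤ 1 / θb := by positivity
        gcongr
      _ = ((N : ℝ) ^ K) ^ w * (1 / θ) ^ K' := by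
        rw [mul_pow, ← pow_mul, ← pow_mul, ← pow_mul, hK, hK']; ring
      _ ≤ _ := by
        push_cast
        refine mul_le_mul (pow_le_pow_left₀ (by positivity)
          (le_add_of_nonneg_right (by positivity)) _)
          (pow_le_pow_right₀ hiθ (by omega)) (by positivity) (by positivity)
  · intro g
    rw [Fintype.sum_sigma]
    by_cases hg : g.length = m
    swap
    · rw [Finset.sum_eq_zero, if_neg]
      · simpa using mul_nonneg hθ0.le (pow_nonneg (hρ₁0.le.trans (le_max_left _ _)) _)
      · rintro rfl; exact hg rfl
      · intro i _
        refine Finset.sum_eq_zero fun z _ => ?_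
        rw [prodFun_eq_zero, mul_zero]
        rw [List.length_map, hl, hj]
        exact fun h => hg h.symm
    set err : ι → List ℕ → ℂ := fun i l' =>
      ∑ z, d i z * prodFun ((l i z).map fun d => U (diracSeq d)) l' +
        (-1) * prodFun ((j i).map diracSeq) l' with herr
    have herr_le : ∀ i l', ‖err i l'‖ ≤ θb * ρb ^ l'.sum := by
      intro i l'
      have := hda i l'
      simp only [herr, prodFun_map_dirac, neg_one_mul, ← sub_eq_add_neg]
      exact this
    have hprod : ∀ hs : List ℕ, ∀ l', ‖prodFun (hs.map fun d => U (diracSeq d)) l'‖ ≤ 1 := by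
      intro hs
      induction hs with
      | nil => intro l'; cases l' <;> simp [prodFun]
      | cons a hs ih =>
        intro l'
        cases l' with
        | nil => simp [prodFun]
        | cons b l' =>
          rw [List.map_cons, prodFun_cons_cons, norm_mul]
          exact mul_le_one₀ (hU.bdd 1 _ (norm_diracSeq_le a) b) (norm_nonneg _) (ih l')
    have hlift : ∀ i, liftOp T g (err i) =
        ∑ z, d i z * prodFun ((l i z).map fun d => T (U (diracSeq d))) g -
          prodFun ((j i).map fun d => T (diracSeq d)) g := by
      intro i
      simp only [herr]
      have hb1 : ∀ z l', ‖d i z * prodFun ((l i z).map fun d => U (diracSeq d)) l'‖ ≤ ‖d i z‖ :=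
        fun z l' => by
          rw [norm_mul]
          exact mul_le_of_le_one_right (norm_nonneg _) (hprod _ _)
      rw [liftOp_add hT (B := ∑ z, ‖d i z‖) (B' := 1) g, liftOp_sum hT _ g hb1,
        liftOp_smul hT, liftOp_prodFun hT, List.map_map, neg_one_mul, ← sub_eq_add_neg]
      · congr 1
        refine Finset.sum_congr rfl fun z _ => ?_
        rw [liftOp_smul hT, liftOp_prodFun hT, List.map_map]
        rfl
      · exact fun l' => (norm_sum_le _ _).trans (Finset.sum_le_sum fun z _ => hb1 z l')
      · intro l'
        rw [prodFun_map_dirac]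
        split_ifs <;> simp
    have hsplit : ∑ i, ∑ z, c i * d i z * prodFun ((l i z).map fun d => T (U (diracSeq d))) g -
        (if g = e then 1 else 0) =
        (∑ i, c i * prodFun ((j i).map fun d => T (diracSeq d)) g - if g = e then 1 else 0) +
          ∑ i, c i * liftOp T g (err i) := by
      simp_rw [hlift, mul_sub, Finset.sum_sub_distrib, Finset.mul_sum, mul_assoc]
      ring
    rw [hsplit]
    refine (norm_add_le _ _).trans ?_
    have h1 := hca g
    have h2 : ‖∑ i, c i * liftOp T g (err i)‖ ≤ θ / 2 * ρ₁ ^ g.sum := by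
      calc _ ≤ ∑ i, ‖c i‖ * (θb * A₁ ^ m * ρ₁ ^ g.sum) := by
            refine (norm_sum_le _ _).trans (Finset.sum_le_sum fun i _ => ?_)
            rw [norm_mul]
            gcongr
            rw [← hg]
            exact norm_liftOp_le_of_decay hdec g (herr_le i)
        _ ≤ (∑ i, (Ab : ℝ) ^ (j i).sum * ‖c i‖) * (θb * A₁ ^ m * ρ₁ ^ g.sum) := by
            rw [← Finset.sum_mul]
            gcongr with i
            exact le_mul_of_one_le_left (norm_nonneg _) (one_le_pow₀ hAb')
        _ ≤ Na * (θb * A₁ ^ m * ρ₁ ^ g.sum) := by gcongr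
        _ = θ / 2 * ρ₁ ^ g.sum := by rw [hθb]; field_simp
    have h3 : ρ₁ ^ g.sum ≤ max ρ₁ ρa ^ g.sum := by gcongr; exact le_max_left _ _
    have h4 : ρa ^ g.sum ≤ max ρ₁ ρa ^ g.sum := by gcongr; exact le_max_right _ _
    nlinarith

theorem prodFun_map_const_mul (κ : ℂ) (f : ℕ → ℕ → ℂ) : ∀ j g : List ℕ,
    prodFun (j.map fun d g => κ * f d g) g = κ ^ j.length * prodFun (j.map f) g
  | [], [] => by simp [prodFun]
  | [], _ :: _ => by simp [prodFun]
  | _ :: _, [] => by simp [prodFun]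
  | a :: j, b :: g => by
    rw [List.map_cons, List.map_cons, prodFun_cons_cons, prodFun_cons_cons,
      prodFun_map_const_mul κ f j g, List.length_cons]
    ring

/-- The coefficients are multiplied by `κ⁻¹` once for each gap, which the bound exponential in the
length absorbs. -/
theorem ApproxInvertible.const_mul {T : (ℕ → ℂ) → ℕ → ℂ} (hT : ApproxInvertible T) {κ : ℂ}
    (hκ : κ ≠ 0) : ApproxInvertible fun h g => κ * T h g := by
  intro r hr
  obtain ⟨A, ρ, hA, hρ0, hρ1, h⟩ := hT r hr
  obtain ⟨N, hN⟩ := exists_nat_ge (‖κ⁻¹‖ + 1)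
  have hN1 : (1 : ℝ) ≤ N := by linarith [norm_nonneg κ⁻¹]
  have hN1' : 1 ≤ N := by exact_mod_cast hN1
  refine ⟨A * N, ρ, Nat.one_le_iff_ne_zero.2 (by positivity), hρ0, hρ1, fun e θ hθ0 hθ1 => ?_⟩
  obtain ⟨ι, _, c, j, hj, hcn, hca⟩ := h e θ hθ0 hθ1
  refine ⟨ι, inferInstance, fun i => (κ⁻¹) ^ e.length * c i, j, hj, ?_, fun g => ?_⟩
  · have hiθ : 1 ≤ 1 / θ := by rw [le_div_iff₀ hθ0]; linarith
    calc ∑ i, r ^ (j i).sum * ‖κ⁻¹ ^ e.length * c i‖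
        = ‖κ⁻¹‖ ^ e.length * ∑ i, r ^ (j i).sum * ‖c i‖ := by
          rw [Finset.mul_sum]
          refine Finset.sum_congr rfl fun i _ => ?_
          rw [norm_mul, norm_pow]; ring
      _ ≤ (N : ℝ) ^ (e.sum + e.length + 1) *
          ((A : ℝ) ^ (e.sum + e.length + 1) * (1 / θ) ^ (A * N)) := by
          refine mul_le_mul ?_ (hcn.trans ?_)
            (Finset.sum_nonneg fun i _ => by positivity) (by positivity)
          · exact (pow_le_pow_left₀ (norm_nonneg _) (by linarith) _).trans
              (pow_le_pow_right₀ hN1 (by omega))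
          · refine mul_le_mul_of_nonneg_left (pow_le_pow_right₀ hiθ ?_) (by positivity)
            exact Nat.le_mul_of_pos_right _ hN1'
      _ = _ := by push_cast; rw [mul_pow]; ring
  · convert hca g using 3
    refine Finset.sum_congr rfl fun i _ => ?_
    rw [prodFun_map_const_mul, hj]
    have : κ⁻¹ ^ e.length * κ ^ e.length = 1 := by
      rw [← mul_pow, inv_mul_cancel₀ hκ, one_pow]
    linear_combination c i * prodFun ((j i).map fun d => T (diracSeq d)) g * this

theorem approxInvertible_id : ApproxInvertible fun h => h := by
  refine approxInvertible_of_exact regularOp_id (A := 2) (u := 1 / 2) (by norm_num) (by norm_num)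
    (by norm_num) (h := diracSeq) (fun _ => rfl) fun d g => ?_
  unfold diracSeq
  split_ifs with hg
  · subst hg
    rw [pow_succ, mul_right_comm, ← mul_pow]
    norm_num
  · simp only [norm_zero]; positivity

/-- The approximate inverse images of the indicator sequences. -/
theorem ApproxInvertible.exists_approx {T : (ℕ → ℂ) → ℕ → ℂ} (hT : RegularOp T)
    (hTi : ApproxInvertible T) : ∃ A : ℕ, 1 ≤ A ∧ ∀ (d : ℕ) (θ : ℝ), 0 < θ → θ ≤ 1 →
      ∃ h : ℕ → ℂ, (∀ g, ‖h g‖ ≤ (A : ℝ) ^ (d + 2) * (1 / θ) ^ A) ∧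
        ∀ g, ‖T h g - diracSeq d g‖ ≤ θ := by
  obtain ⟨A, ρ, hA, hρ0, hρ1, h⟩ := hTi 1 le_rfl
  refine ⟨A, hA, fun d θ hθ0 hθ1 => ?_⟩
  obtain ⟨ι, _, c, j, hj, hcn, hca⟩ := h [d] θ hθ0 hθ1
  have hj' : ∀ i, ∃ a, j i = [a] := fun i => List.length_eq_one_iff.1 (hj i)
  choose a ha using hj'
  refine ⟨fun g => ∑ i, c i * diracSeq (a i) g, fun g => ?_, fun g => ?_⟩
  · refine le_trans ?_ (by simpa using hcn)
    refine (norm_sum_le _ _).trans (Finset.sum_le_sum fun i _ => ?_)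
    rw [norm_mul]
    exact mul_le_of_le_one_right (norm_nonneg _) (norm_diracSeq_le _ _)
  · rw [hT.sum_of_bdd Finset.univ (h := fun i g => c i * diracSeq (a i) g)]
    · have := hca [g]
      simp only [ha, List.map_cons, List.map_nil, prodFun, mul_one, List.cons.injEq, and_true]
        at this
      refine le_trans (le_of_eq ?_) (this.trans
        (mul_le_of_le_one_right hθ0.le (pow_le_one₀ hρ0.le hρ1.le)))
      simp only [hT.smul]
      rfl
    · intro i _
      refine ⟨‖c i‖, fun g => ?_⟩
      rw [norm_mul]
      exact mul_le_of_le_one_right (norm_nonneg _) (norm_diracSeq_le _ _)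

end

noncomputable section

/-! ### The operators of the channels -/

/-- The point mass at `d`. -/
def pointLaw (d : ℕ) : ℕ → ℝ := fun j => if j = d then 1 else 0

/-- The law of the length of the output of a deletion channel on one bit. -/
def deletionLaw (q : ℝ) : ℕ → ℝ
  | 0 => q
  | 1 => 1 - q
  | _ + 2 => 0

/-- The geometric law. -/
def geomLaw (η : ℝ) : ℕ → ℝ := fun j => (1 - η) * η ^ j

/-- The law of the length of the output of an insertion channel on one bit. -/
def insertionLaw (η : ℝ) : ℕ → ℝ
  | 0 => 0
  | j + 1 => geomLaw η j

theorem lightTailed_of_finite {a : ℕ → ℝ} (hn : ∀ j, 0 ≤ a j) (h1 : HasSum a 1) {m : ℕ}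
    (hm : ∀ j, m ≤ j → a j = 0) : LightTailed a where
  nonneg := hn
  hasSum := h1
  tail := ⟨2, by norm_num, summable_of_ne_finset_zero (s := Finset.range m) fun j hj => by
    rw [hm j (by simpa using hj), zero_mul]⟩

theorem lightTailed_pointLaw (d : ℕ) : LightTailed (pointLaw d) := by
  refine lightTailed_of_finite (m := d + 1) (fun j => ?_) ?_ fun j hj => ?_
  · unfold pointLaw; split_ifs <;> norm_num
  · exact hasSum_ite_eq d 1
  · unfold pointLaw; rw [if_neg (by omega)]

theorem lightTailed_deletionLaw {q : ℝ} (h0 : 0 ≤ q) (h1 : q ≤ 1) :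
    LightTailed (deletionLaw q) := by
  refine lightTailed_of_finite (m := 2) (fun j => ?_) ?_ fun j hj => ?_
  · match j with
    | 0 => exact h0
    | 1 => exact sub_nonneg.2 h1
    | _ + 2 => exact le_rfl
  · have : HasSum (deletionLaw q) (∑ j ∈ Finset.range 2, deletionLaw q j) :=
      hasSum_sum_of_ne_finset_zero fun j hj => by
        match j with
        | 0 => simp at hj
        | 1 => simp at hj
        | _ + 2 => rfl
    simpa [Finset.sum_range_succ, deletionLaw] using this
  · match j with
    | 0 => omega
    | 1 => omega
    | _ + 2 => rfl

theorem hasSum_geomLaw {η : ℝ} (h0 : 0 ≤ η) (h1 : η < 1) : HasSum (geomLaw η) 1 := by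
  have h := (hasSum_geometric_of_lt_one h0 h1).mul_left (1 - η)
  rwa [mul_inv_cancel₀ (by linarith)] at h

theorem exists_one_lt_mul_lt_one {η : ℝ} (h1 : η < 1) :
    ∃ R > 1, η * R < 1 := by
  refine ⟨1 + (1 - η) / 2, by linarith, by nlinarith⟩

theorem summable_geomLaw {η R : ℝ} (h0 : 0 ≤ η) (hR : 0 ≤ R) (h1 : η * R < 1) :
    Summable fun j => geomLaw η j * R ^ j := by
  have := (summable_geometric_of_lt_one (mul_nonneg h0 hR) h1).mul_left (1 - η)
  refine this.congr fun j => ?_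
  rw [geomLaw, mul_pow]; ring

theorem lightTailed_geomLaw {η : ℝ} (h0 : 0 ≤ η) (h1 : η < 1) : LightTailed (geomLaw η) where
  nonneg j := mul_nonneg (by linarith) (pow_nonneg h0 j)
  hasSum := hasSum_geomLaw h0 h1
  tail := by
    obtain ⟨R, hR, hηR⟩ := exists_one_lt_mul_lt_one h1
    exact ⟨R, hR, summable_geomLaw h0 (by linarith) hηR⟩

theorem lightTailed_insertionLaw {η : ℝ} (h0 : 0 ≤ η) (h1 : η < 1) :
    LightTailed (insertionLaw η) where
  nonneg j := by
    cases j with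
    | zero => exact le_rfl
    | succ j => exact (lightTailed_geomLaw h0 h1).nonneg j
  hasSum := by
    have := (hasSum_nat_add_iff (f := insertionLaw η) (g := 1) 1).1 (hasSum_geomLaw h0 h1)
    simpa [insertionLaw] using this
  tail := by
    obtain ⟨R, hR, hs⟩ := (lightTailed_geomLaw h0 h1).tail
    refine ⟨R, hR, (summable_nat_add_iff 1).1 ?_⟩
    refine (hs.mul_left R).congr fun j => ?_
    simp only [insertionLaw, pow_succ]; ring

theorem avgSeq_pointLaw (d : ℕ) (h : ℕ → ℂ) (i : ℕ) : avgSeq (pointLaw d) h i = h (i + d) := by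
  unfold avgSeq
  rw [tsum_eq_single d]
  · simp [pointLaw]
  · intro j hj
    simp [pointLaw, hj]

theorem avgSeq_deletionLaw (q : ℝ) (h : ℕ → ℂ) (i : ℕ) :
    avgSeq (deletionLaw q) h i = q * h i + (1 - q) * h (i + 1) := by
  unfold avgSeq
  rw [tsum_eq_sum (s := Finset.range 2)]
  · simp [Finset.sum_range_succ, deletionLaw]
  · intro j hj
    match j with
    | 0 => simp at hj
    | 1 => simp at hj
    | _ + 2 => simp [deletionLaw]

theorem avgSeq_insertionLaw (η : ℝ) (h : ℕ → ℂ) (i : ℕ) :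
    avgSeq (insertionLaw η) h i = avgSeq (geomLaw η) (shiftSeq h) i := by
  unfold avgSeq
  rw [← Nat.succ_injective.tsum_eq]
  · rfl
  · intro j hj
    cases j with
    | zero => simp [insertionLaw] at hj
    | succ j => exact ⟨j, rfl⟩

/-- One more input bit in a gap means one more average over `a`. So a family in which this average
lowers the index and kills the member of index 0, and whose final averages over `b` are 1 at index 0
and 0 otherwise, is dual to evaluation at gap lengths. -/
theorem gapOp_eq_dirac {a b : ℕ → ℝ} {h : ℕ → ℕ → ℂ} (h1 : avgSeq b (h 0) 0 = 1)
    (h2 : avgSeq a (h 0) = fun _ => 0) (h3 : ∀ d, avgSeq b (h (d + 1)) 0 = 0)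
    (h4 : ∀ d, avgSeq a (h (d + 1)) = h d) (d : ℕ) : gapOp a b (h d) = diracSeq d := by
  have hz : gapOp a b (fun _ => 0) = fun _ => 0 := by
    simpa using gapOp_smul a b 0 (fun _ => 0)
  funext g
  induction d generalizing g with
  | zero =>
    cases g with
    | zero => rw [gapOp_zero, h1]; rfl
    | succ g => rw [gapOp_succ, h2, hz]; simp [diracSeq]
  | succ d ih =>
    cases g with
    | zero => rw [gapOp_zero, h3]; simp [diracSeq]
    | succ g => rw [gapOp_succ, h4, ih]; simp [diracSeq]

/-! #### Deletions -/

theorem deletionLaw_zero_lt {q : ℝ} (h1 : q < 1) : deletionLaw q 0 < 1 := h1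

/-- The inverse image of the indicator sequence of `d` under a deletion channel. -/
def deletionInv (q : ℂ) : ℕ → ℕ → ℂ
  | 0, j => (-q / (1 - q)) ^ j
  | _ + 1, 0 => 0
  | d + 1, j + 1 => (deletionInv q d j - q * deletionInv q (d + 1) j) / (1 - q)

/-- The sequence of ratio `-q / (1 - q)` is annihilated by the average over a block. It decays
exactly when `q < 1/2`; the further preimages follow by a linear recursion. -/
theorem approxInvertible_deletion_of_lt_half {q : ℝ} (h0 : 0 ≤ q) (h1 : q < 1 / 2) :
    ApproxInvertible (gapOp (deletionLaw q) (pointLaw 0)) := by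
  have hq : (1 - q : ℂ) ≠ 0 := by
    rw [← Complex.ofReal_one, ← Complex.ofReal_sub, Complex.ofReal_ne_zero]; linarith
  have hp : 0 < 1 - q := by linarith
  have hnp : ‖(1 - q : ℂ)‖ = 1 - q := by
    rw [← Complex.ofReal_one, ← Complex.ofReal_sub, Complex.norm_real,
      Real.norm_of_nonneg hp.le]
  -- The midpoint between the ratio and 1, which leaves slack `q < (1 - q) u` for the recursion.
  set u := (q / (1 - q) + 1) / 2 with hu
  have hqp : q / (1 - q) < 1 := (div_lt_one hp).2 (by linarith)
  have hqp0 : 0 ≤ q / (1 - q) := div_nonneg h0 hp.le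
  have hu0 : 0 < u := by linarith
  have hu1 : u < 1 := by linarith
  have hqu : q < (1 - q) * u := by
    have : (1 - q) * (q / (1 - q)) = q := mul_div_cancel₀ _ hp.ne'
    nlinarith
  -- Chosen so that `1 + A q ≤ A (1 - q) u`, the inequality that closes the induction on the growth
  -- bound.
  set A := max 1 (1 / ((1 - q) * u - q)) with hA
  have hA1 : 1 ≤ A := le_max_left _ _
  have hAq : 1 + A * q ≤ A * ((1 - q) * u) := by
    have : 1 / ((1 - q) * u - q) ≤ A := le_max_right _ _
    rw [div_le_iff₀ (by linarith)] at this
    linarith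
  refine approxInvertible_of_exact (regularOp_gapOp
    (lightTailed_deletionLaw h0 (by linarith)) (lightTailed_pointLaw 0)
    (deletionLaw_zero_lt (by linarith))) hA1 hu0 hu1 (h := deletionInv q)
    (gapOp_eq_dirac ?_ ?_ ?_ ?_) ?_
  · rw [avgSeq_pointLaw]; simp [deletionInv]
  · funext i
    rw [avgSeq_deletionLaw]
    simp only [deletionInv, pow_succ]
    field_simp
    ring
  · intro d
    rw [avgSeq_pointLaw]; simp [deletionInv]
  · intro d
    funext i
    rw [avgSeq_deletionLaw, deletionInv]
    field_simp
    ring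
  · intro d j
    induction d generalizing j with
    | zero =>
      simp only [deletionInv, norm_pow, norm_div, norm_neg, hnp, Complex.norm_real,
        Real.norm_of_nonneg h0, zero_add, pow_one]
      calc (q / (1 - q)) ^ j ≤ u ^ j := by gcongr; linarith
        _ ≤ A * u ^ j := le_mul_of_one_le_left (by positivity) hA1
    | succ d ih =>
      induction j with
      | zero => simp only [deletionInv, norm_zero]; positivity
      | succ j ihj =>
        rw [deletionInv, norm_div, hnp, div_le_iff₀ hp]
        calc ‖deletionInv q d j - q * deletionInv q (d + 1) j‖
            ≤ A ^ (d + 1) * u ^ j + q * (A ^ (d + 1 + 1) * u ^ j) := by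
              refine (norm_sub_le _ _).trans (add_le_add (ih j) ?_)
              rw [norm_mul, Complex.norm_real, Real.norm_of_nonneg h0]
              gcongr
          _ = A ^ (d + 1) * u ^ j * (1 + A * q) := by ring
          _ ≤ A ^ (d + 1) * u ^ j * (A * ((1 - q) * u)) := by gcongr
          _ = _ := by ring

/-- A bit survives two deletion channels with the product of the survival probabilities. -/
theorem gapOp_deletionLaw_comp {q₁ q₂ : ℝ} (h : ℕ → ℂ) :
    gapOp (deletionLaw q₁) (pointLaw 0) (gapOp (deletionLaw q₂) (pointLaw 0) h) =
      gapOp (deletionLaw (q₁ + (1 - q₁) * q₂)) (pointLaw 0) h := by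
  have hadd : ∀ (q : ℝ) (h h' : ℕ → ℂ) (c c' : ℂ),
      gapOp (deletionLaw q) (pointLaw 0) (fun g => c * h g + c' * h' g) =
      fun g => c * gapOp (deletionLaw q) (pointLaw 0) h g +
        c' * gapOp (deletionLaw q) (pointLaw 0) h' g := by
    intro q h h' c c'
    funext g
    induction g generalizing h h' with
    | zero => simp only [gapOp_zero, avgSeq_pointLaw]
    | succ g ih =>
      simp only [gapOp_succ]
      rw [← ih]
      congr 1
      funext i
      simp only [avgSeq_deletionLaw]
      ring
  funext g
  induction g generalizing h with
  | zero => simp only [gapOp_zero, avgSeq_pointLaw, add_zero]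
  | succ g ih =>
    rw [gapOp_succ, gapOp_succ]
    have h1 : avgSeq (deletionLaw q₁) (gapOp (deletionLaw q₂) (pointLaw 0) h) =
        gapOp (deletionLaw q₂) (pointLaw 0)
          (avgSeq (deletionLaw (q₁ + (1 - q₁) * q₂)) h) := by
      have h2 : avgSeq (deletionLaw (q₁ + (1 - q₁) * q₂)) h =
          fun i => (q₁ : ℂ) * h i + (1 - q₁ : ℂ) * avgSeq (deletionLaw q₂) h i := by
        funext i
        simp only [avgSeq_deletionLaw]
        push_cast
        ring
      rw [h2, hadd]
      funext i
      rw [avgSeq_deletionLaw, gapOp_succ]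
    rw [h1, ih]

/-- The channel is a composition of `s` equal deletion channels of survival probability `(1 - q) ^
(1 / s)`, which exceeds `1/2` for large `s`. -/
theorem approxInvertible_deletion {q : ℝ} (h0 : 0 ≤ q) (h1 : q < 1) :
    ApproxInvertible (gapOp (deletionLaw q) (pointLaw 0)) := by
  have key : ∀ (a : ℝ), 1 / 2 < a → a ≤ 1 → ∀ s : ℕ,
      ApproxInvertible (gapOp (deletionLaw (1 - a ^ s)) (pointLaw 0)) := by
    intro a ha ha1 s
    induction s with
    | zero =>
      simpa using approxInvertible_deletion_of_lt_half (q := 0) le_rfl (by norm_num)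
    | succ s ih =>
      have ha0 : 0 < a := by linarith
      have hs1 : a ^ s ≤ 1 := pow_le_one₀ ha0.le ha1
      have hs0 : 0 < a ^ s := pow_pos ha0 s
      have := ApproxInvertible.comp
        (regularOp_gapOp (lightTailed_deletionLaw (q := 1 - a ^ s) (by linarith) (by linarith))
          (lightTailed_pointLaw 0) (deletionLaw_zero_lt (by linarith)))
        (regularOp_gapOp (lightTailed_deletionLaw (q := 1 - a) (by linarith) (by linarith))
          (lightTailed_pointLaw 0) (deletionLaw_zero_lt (by linarith))) ih
        (approxInvertible_deletion_of_lt_half (q := 1 - a) (by linarith) (by linarith))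
      simp only [gapOp_deletionLaw_comp] at this
      convert this using 3
      ring
  have hp : 0 < 1 - q := by linarith
  obtain ⟨s, hs⟩ := exists_pow_lt_of_lt_one hp (y := 1 / 2) (by norm_num)
  have hs0 : s ≠ 0 := by
    rintro rfl
    simp at hs; linarith
  have hroot : ((1 - q) ^ ((s : ℝ)⁻¹)) ^ s = 1 - q := Real.rpow_inv_natCast_pow hp.le hs0
  have := key ((1 - q) ^ ((s : ℝ)⁻¹)) ?_ ?_ s
  · rwa [hroot, sub_sub_cancel] at this
  · refine lt_of_pow_lt_pow_left₀ s (Real.rpow_nonneg hp.le _) ?_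
    rwa [hroot]
  · exact Real.rpow_le_one hp.le (by linarith) (by positivity)

/-! #### Insertions -/

/-- The geometric weights turn these differences into a telescoping series; boundedness of `h` makes
the remainder vanish. -/
theorem avgSeq_geomLaw_sub {η : ℝ} (h0 : 0 ≤ η) (h1 : η < 1) {h : ℕ → ℂ} {B : ℝ}
    (hh : ∀ g, ‖h g‖ ≤ B) (i : ℕ) :
    avgSeq (geomLaw η) (fun j => (h j - η * h (j + 1)) / (1 - η)) i = h i := by
  have hη : (1 - η : ℂ) ≠ 0 := by
    rw [← Complex.ofReal_one, ← Complex.ofReal_sub, Complex.ofReal_ne_zero]; linarith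
  have hs : Summable fun j => (η : ℂ) ^ j * h (i + j) := by
    refine Summable.of_norm_bounded ((summable_geometric_of_lt_one h0 h1).mul_right B)
      fun j => ?_
    rw [norm_mul, norm_pow, Complex.norm_real, Real.norm_of_nonneg h0]
    gcongr
    exact hh _
  have hs' : Summable fun j => (η : ℂ) ^ (j + 1) * h (i + (j + 1)) :=
    (summable_nat_add_iff (f := fun j => (η : ℂ) ^ j * h (i + j)) 1).2 hs
  unfold avgSeq
  calc _ = ∑' j, ((η : ℂ) ^ j * h (i + j) - (η : ℂ) ^ (j + 1) * h (i + (j + 1))) := by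
        refine tsum_congr fun j => ?_
        simp only [geomLaw]
        push_cast
        rw [← add_assoc]
        field_simp
        ring
    _ = h i := by
        rw [hs.tsum_sub hs', hs.tsum_eq_zero_add]
        simp

theorem avgSeq_geomLaw_zero {η : ℝ} (h0 : 0 ≤ η) (h1 : η < 1) {h : ℕ → ℂ} {B : ℝ}
    (hh : ∀ g, ‖h g‖ ≤ B) :
    avgSeq (geomLaw η) h 0 = (1 - η) * h 0 + η * avgSeq (geomLaw η) (shiftSeq h) 0 := by
  have hl := lightTailed_geomLaw h0 h1
  have hs := summable_avgSeq hl.nonneg (hl.summable_of_le_one zero_le_one le_rfl)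
    (growthLe_of_norm_le le_rfl hh) 0
  unfold avgSeq
  rw [hs.tsum_eq_zero_add, ← tsum_mul_left]
  congr 1
  · simp [geomLaw]
  · refine tsum_congr fun j => ?_
    simp only [geomLaw, shiftSeq]
    push_cast
    rw [← add_assoc]
    ring

/-- The inverse image of the indicator sequence of `d` under an insertion channel. The parameter
`t` tells whether bits are inserted after the last bit of a gap. -/
def insertionInv (η t : ℂ) : ℕ → ℕ → ℂ
  | 0, 0 => 1 / (1 - t * η)
  | 0, _ + 1 => 0
  | d + 1, 0 => -(t * η) / (1 - η) * insertionInv η t d 0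
  | d + 1, j + 1 => (insertionInv η t d j - η * insertionInv η t d (j + 1)) / (1 - η)

/-- The recursion adds the entries at `j` and `j + 1` of the previous member; relative to `2 ^ -(j +
1)` these count `2` and `1`, whence the constant `3`. -/
theorem growthLe_insertionInv {η : ℝ} (h0 : 0 ≤ η) (h1 : η < 1) {t : ℝ} (ht0 : 0 ≤ t)
    (ht1 : t ≤ 1) (d : ℕ) :
    GrowthLe ((3 / (1 - η)) ^ (d + 1)) (1 / 2) (insertionInv η t d) := by
  have hp : 0 < 1 - η := by linarith
  have hnp : ‖(1 - η : ℂ)‖ = 1 - η := by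
    rw [← Complex.ofReal_one, ← Complex.ofReal_sub, Complex.norm_real,
      Real.norm_of_nonneg hp.le]
  have htη : t * η ≤ η := mul_le_of_le_one_left h0 ht1
  intro j
  induction d generalizing j with
  | zero =>
    cases j with
    | zero =>
      simp only [insertionInv]
      rw [← Complex.ofReal_one, ← Complex.ofReal_mul, ← Complex.ofReal_sub, ← Complex.ofReal_div,
        Complex.norm_real, Real.norm_of_nonneg (div_nonneg zero_le_one (by linarith))]
      simp only [zero_add, pow_one, pow_zero, mul_one]
      gcongr
      norm_num
    | succ j => simp only [insertionInv, norm_zero]; positivity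
  | succ d ih =>
    cases j with
    | zero =>
      have ht : ‖(t * η : ℂ)‖ = t * η := by
        rw [← Complex.ofReal_mul, Complex.norm_real, Real.norm_of_nonneg (mul_nonneg ht0 h0)]
      rw [insertionInv, norm_mul, norm_div, norm_neg, ht, hnp, pow_succ (3 / (1 - η)) (d + 1)]
      have := ih 0
      simp only [pow_zero, mul_one] at this ⊢
      rw [mul_comm]
      have h3 : t * η / (1 - η) ≤ 3 / (1 - η) := by gcongr; linarith
      gcongr
    | succ j =>
      rw [insertionInv, norm_div, hnp, div_le_iff₀ hp]
      calc _ ≤ (3 / (1 - η)) ^ (d + 1) * (1 / 2) ^ j +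
            1 * ((3 / (1 - η)) ^ (d + 1) * (1 / 2) ^ (j + 1)) := by
            refine (norm_sub_le _ _).trans (add_le_add (ih j) ?_)
            rw [norm_mul, Complex.norm_real, Real.norm_of_nonneg h0]
            exact mul_le_mul h1.le (ih (j + 1)) (norm_nonneg _) zero_le_one
        _ = _ := by rw [pow_succ (3 / (1 - η)) (d + 1)]; field_simp; ring

theorem norm_insertionInv_le {η : ℝ} (h0 : 0 ≤ η) (h1 : η < 1) {t : ℝ} (ht0 : 0 ≤ t)
    (ht1 : t ≤ 1) (d g : ℕ) : ‖insertionInv η t d g‖ ≤ (3 / (1 - η)) ^ (d + 1) := by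
  have : 0 ≤ 3 / (1 - η) := div_nonneg (by norm_num) (by linarith)
  exact (growthLe_insertionInv h0 h1 ht0 ht1 d g).trans
    (mul_le_of_le_one_right (by positivity) (pow_le_one₀ (by norm_num) (by norm_num)))

theorem avgSeq_insertionInv {η : ℝ} (h0 : 0 ≤ η) (h1 : η < 1) {t : ℝ} (ht0 : 0 ≤ t)
    (ht1 : t ≤ 1) (d i : ℕ) : avgSeq (geomLaw η) (shiftSeq (insertionInv η t (d + 1))) i =
      insertionInv η t d i :=
  avgSeq_geomLaw_sub h0 h1 (norm_insertionInv_le h0 h1 ht0 ht1 d) i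

theorem approxInvertible_insertion {η : ℝ} (h0 : 0 ≤ η) (h1 : η < 1) :
    ApproxInvertible (gapOp (insertionLaw η) (geomLaw η)) := by
  have hη : (1 - η : ℂ) ≠ 0 := by
    rw [← Complex.ofReal_one, ← Complex.ofReal_sub, Complex.ofReal_ne_zero]; linarith
  have h3 : 1 ≤ 3 / (1 - η) := by rw [le_div_iff₀ (by linarith)]; linarith
  have hb := norm_insertionInv_le h0 h1 zero_le_one le_rfl
  have hz : shiftSeq (insertionInv η (1 : ℝ) 0) = fun _ => 0 := rfl
  have ha : ∀ i, avgSeq (geomLaw η) (fun _ => 0) i = 0 := fun i => by simp [avgSeq]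
  refine approxInvertible_of_exact (regularOp_gapOp (lightTailed_insertionLaw h0 h1)
    (lightTailed_geomLaw h0 h1) zero_lt_one) h3 (by norm_num) (by norm_num)
    (gapOp_eq_dirac ?_ ?_ ?_ ?_) (growthLe_insertionInv h0 h1 zero_le_one le_rfl)
  · rw [avgSeq_geomLaw_zero h0 h1 (hb 0), hz, ha]
    simp only [insertionInv]
    push_cast
    field_simp
    ring
  · funext i
    rw [avgSeq_insertionLaw, hz, ha]
  · intro d
    rw [avgSeq_geomLaw_zero h0 h1 (hb (d + 1)), avgSeq_insertionInv h0 h1 zero_le_one le_rfl]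
    simp only [insertionInv]
    push_cast
    field_simp
    ring
  · intro d
    funext i
    rw [avgSeq_insertionLaw, avgSeq_insertionInv h0 h1 zero_le_one le_rfl]

/-- Insertions precede bits, so nothing is inserted behind the last bit of the string; this is the
case `t = 0` of the inverse. -/
theorem approxInvertible_insertion_last {η : ℝ} (h0 : 0 ≤ η) (h1 : η < 1) :
    ApproxInvertible (gapOp (insertionLaw η) (pointLaw 0)) := by
  have h3 : 1 ≤ 3 / (1 - η) := by rw [le_div_iff₀ (by linarith)]; linarith
  refine approxInvertible_of_exact (regularOp_gapOp (lightTailed_insertionLaw h0 h1)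
    (lightTailed_pointLaw 0) zero_lt_one) h3 (by norm_num) (by norm_num)
    (gapOp_eq_dirac ?_ ?_ ?_ ?_) (growthLe_insertionInv h0 h1 le_rfl zero_le_one)
  · rw [avgSeq_pointLaw]
    simp [insertionInv]
  · funext i
    rw [avgSeq_insertionLaw]
    simp [avgSeq, shiftSeq, insertionInv]
  · intro d
    rw [avgSeq_pointLaw]
    simp [insertionInv]
  · intro d
    funext i
    rw [avgSeq_insertionLaw, avgSeq_insertionInv h0 h1 le_rfl zero_le_one]

/-! #### All channels -/

/-- The law of the length of the output of a channel on one bit. -/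
def SyncChannel.blockLaw : SyncChannel → ℕ → ℝ
  | .deletion δ _ _ => deletionLaw δ
  | .insertion η _ _ => insertionLaw η
  | .symmetry _ _ _ _ => pointLaw 1

/-- The law of the number of bits that a channel inserts before a bit. -/
def SyncChannel.headLaw : SyncChannel → ℕ → ℝ
  | .deletion _ _ _ => pointLaw 0
  | .insertion η _ _ => geomLaw η
  | .symmetry _ _ _ _ => pointLaw 0

/-- The factor by which a channel contracts the sign of a bit. -/
def SyncChannel.factor : SyncChannel → ℂ
  | .deletion δ _ _ => 1 - δ
  | .insertion _ _ _ => 1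
  | .symmetry σ _ _ _ => 1 - 2 * σ

/-- The action of a channel on the functions of the gaps before a marked bit. -/
def SyncChannel.innerOp (c : SyncChannel) (h : ℕ → ℂ) : ℕ → ℂ :=
  fun g => c.factor * gapOp c.blockLaw c.headLaw h g

/-- The action of a channel on the functions of the gap after the last marked bit. -/
def SyncChannel.lastOp (c : SyncChannel) : (ℕ → ℂ) → ℕ → ℂ := gapOp c.blockLaw (pointLaw 0)

theorem SyncChannel.lightTailed_blockLaw (c : SyncChannel) : LightTailed c.blockLaw := by
  cases c with
  | deletion δ h0 h1 => exact lightTailed_deletionLaw h0 h1.le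
  | insertion η h0 h1 => exact lightTailed_insertionLaw h0 h1
  | symmetry => exact lightTailed_pointLaw 1

theorem SyncChannel.lightTailed_headLaw (c : SyncChannel) : LightTailed c.headLaw := by
  cases c with
  | deletion => exact lightTailed_pointLaw 0
  | insertion η h0 h1 => exact lightTailed_geomLaw h0 h1
  | symmetry => exact lightTailed_pointLaw 0

theorem SyncChannel.blockLaw_zero_lt (c : SyncChannel) : c.blockLaw 0 < 1 := by
  cases c with
  | deletion δ h0 h1 => exact h1
  | insertion η h0 h1 => exact zero_lt_one
  | symmetry => simp [SyncChannel.blockLaw, pointLaw]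

theorem SyncChannel.factor_ne_zero (c : SyncChannel) : c.factor ≠ 0 := by
  cases c with
  | deletion δ h0 h1 =>
    simp only [factor]
    rw [← Complex.ofReal_one, ← Complex.ofReal_sub, Complex.ofReal_ne_zero]; linarith
  | insertion η h0 h1 => exact one_ne_zero
  | symmetry σ h0 h1 h2 =>
    simp only [factor]
    intro h
    apply h2
    have : ((1 - 2 * σ : ℝ) : ℂ) = 0 := by push_cast; exact h
    rw [Complex.ofReal_eq_zero] at this
    linarith

theorem SyncChannel.norm_factor_le (c : SyncChannel) : ‖c.factor‖ ≤ 1 := by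
  cases c with
  | deletion δ h0 h1 =>
    simp only [factor]
    rw [← Complex.ofReal_one, ← Complex.ofReal_sub, Complex.norm_real, Real.norm_eq_abs, abs_le]
    constructor <;> linarith
  | insertion η h0 h1 => simp [factor]
  | symmetry σ h0 h1 h2 =>
    have : factor (.symmetry σ h0 h1 h2) = ((1 - 2 * σ : ℝ) : ℂ) := by
      simp [factor]
    rw [this, Complex.norm_real, Real.norm_eq_abs, abs_le]
    constructor <;> linarith

theorem gapOp_pointLaw_one : gapOp (pointLaw 1) (pointLaw 0) = fun h => h := by
  funext h g
  induction g generalizing h with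
  | zero => rw [gapOp_zero, avgSeq_pointLaw]
  | succ g ih => rw [gapOp_succ, ih, avgSeq_pointLaw]

theorem SyncChannel.regularOp_innerOp (c : SyncChannel) : RegularOp c.innerOp :=
  (regularOp_gapOp c.lightTailed_blockLaw c.lightTailed_headLaw c.blockLaw_zero_lt).const_mul
    c.norm_factor_le

theorem SyncChannel.regularOp_lastOp (c : SyncChannel) : RegularOp c.lastOp :=
  regularOp_gapOp c.lightTailed_blockLaw (lightTailed_pointLaw 0) c.blockLaw_zero_lt

theorem SyncChannel.approxInvertible_innerOp (c : SyncChannel) :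
    ApproxInvertible c.innerOp := by
  refine ApproxInvertible.const_mul ?_ c.factor_ne_zero
  cases c with
  | deletion δ h0 h1 => exact approxInvertible_deletion h0 h1
  | insertion η h0 h1 => exact approxInvertible_insertion h0 h1
  | symmetry =>
    simp only [blockLaw, headLaw, gapOp_pointLaw_one]
    exact approxInvertible_id

theorem SyncChannel.approxInvertible_lastOp (c : SyncChannel) :
    ApproxInvertible c.lastOp := by
  unfold lastOp
  cases c with
  | deletion δ h0 h1 => exact approxInvertible_deletion h0 h1
  | insertion η h0 h1 => exact approxInvertible_insertion_last h0 h1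
  | symmetry =>
    simp only [blockLaw, gapOp_pointLaw_one]
    exact approxInvertible_id

/-- The composition of the operators of the gaps before marked bits. -/
def innerOps : List SyncChannel → (ℕ → ℂ) → ℕ → ℂ
  | [], h => h
  | c :: cs, h => innerOps cs (c.innerOp h)

/-- The composition of the operators of the gap after the last marked bit. -/
def lastOps : List SyncChannel → (ℕ → ℂ) → ℕ → ℂ
  | [], h => h
  | c :: cs, h => lastOps cs (c.lastOp h)

theorem regularOp_innerOps : ∀ cs, RegularOp (innerOps cs)
  | [] => regularOp_id
  | c :: cs => (regularOp_innerOps cs).comp c.regularOp_innerOp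

theorem regularOp_lastOps : ∀ cs, RegularOp (lastOps cs)
  | [] => regularOp_id
  | c :: cs => (regularOp_lastOps cs).comp c.regularOp_lastOp

theorem approxInvertible_innerOps : ∀ cs, ApproxInvertible (innerOps cs)
  | [] => approxInvertible_id
  | c :: cs => ApproxInvertible.comp (T := innerOps cs) (regularOp_innerOps cs) c.regularOp_innerOp
      (approxInvertible_innerOps cs) c.approxInvertible_innerOp

theorem approxInvertible_lastOps : ∀ cs, ApproxInvertible (lastOps cs)
  | [] => approxInvertible_id
  | c :: cs => ApproxInvertible.comp (T := lastOps cs) (regularOp_lastOps cs) c.regularOp_lastOp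
      (approxInvertible_lastOps cs) c.approxInvertible_lastOp

end

noncomputable section

open scoped ENNReal

/-! ### Expected position sums of traces -/

theorem posExpectation_ne_top_of_fintype {β : Type*} [Fintype β] (p : PMF β) (f : β → ℂ) :
    posExpectation p (fun a => ‖f a‖ₑ) ≠ ∞ := by
  rw [posExpectation_fintype]
  exact ENNReal.sum_ne_top.2 fun a _ => ENNReal.mul_ne_top (p.apply_ne_top a) (by simp)

theorem expectation_coin_map {p : ℝ} (h0 : 0 ≤ p) (h1 : p ≤ 1) {β : Type*} (φ : Bool → β)
    (f : β → ℂ) :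
    expectation ((coin p h0 h1).map φ) f = p * f (φ true) + (1 - p) * f (φ false) := by
  rw [expectation_map _ _ _ (posExpectation_ne_top_of_fintype _ fun a => f (φ a)),
    expectation_fintype, Fintype.sum_bool]
  simp [coin, ENNReal.toReal_ofReal h0, ENNReal.toReal_ofReal (sub_nonneg.2 h1)]

theorem posExpectation_coin_map {p : ℝ} (h0 : 0 ≤ p) (h1 : p ≤ 1) {β : Type*} (φ : Bool → β)
    (f : β → ℝ≥0∞) :
    posExpectation ((coin p h0 h1).map φ) f =
      ENNReal.ofReal p * f (φ true) + ENNReal.ofReal (1 - p) * f (φ false) := by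
  rw [posExpectation_map, posExpectation_fintype, Fintype.sum_bool]
  simp [coin]

theorem expectation_uniformBits (j : ℕ) (f : List Bool → ℂ) :
    expectation (uniformBits j) f = (∑ v : Fin j → Bool, f (List.ofFn v)) / 2 ^ j := by
  unfold uniformBits
  rw [expectation_map _ _ _ (posExpectation_ne_top_of_fintype _ fun a => f (List.ofFn a)),
    expectation_fintype, Finset.sum_div]
  refine Finset.sum_congr rfl fun v _ => ?_
  simp [PMF.uniformOfFintype_apply, div_eq_inv_mul]

theorem posExpectation_uniformBits_length (j : ℕ) (f : ℕ → ℝ≥0∞) :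
    posExpectation (uniformBits j) (fun u => f u.length) = f j := by
  unfold uniformBits
  rw [posExpectation_map]
  simp [posExpectation_const]

theorem posExpectation_uniformBits_ne_top (j : ℕ) (f : List Bool → ℂ) :
    posExpectation (uniformBits j) (fun u => ‖f u‖ₑ) ≠ ∞ := by
  unfold uniformBits
  rw [posExpectation_map]
  exact posExpectation_ne_top_of_fintype _ fun a => f (List.ofFn a)

theorem sum_bitSign : bitSign true + bitSign false = 0 := by simp [bitSign]

theorem norm_bitSign (b : Bool) : ‖bitSign b‖ ≤ 1 := by cases b <;> simp [bitSign]

/-- A set of positions that meets the uniform prefix cancels, because flipping a marked uniform bit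
changes the sign. What remains is a first gap that is longer by `j`. -/
theorem sum_walshSum_ofFn_append (j : ℕ) (h : ℕ → ℂ) (hs : List (ℕ → ℂ)) (y : List Bool) :
    ∑ v : Fin j → Bool, walshSum bitSign (prodFun (h :: hs)) (List.ofFn v ++ y) =
      2 ^ j * walshSum bitSign (prodFun ((fun g => h (g + j)) :: hs)) y := by
  induction j generalizing h with
  | zero => simp
  | succ j ih =>
    rw [← (Fin.consEquiv fun _ => Bool).sum_comp, Fintype.sum_prod_type, Fintype.sum_bool]
    simp only [Fin.consEquiv_apply, List.ofFn_succ, Fin.cons_zero, Fin.cons_succ,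
      List.cons_append, walshSum_prodFun_cons, Finset.sum_add_distrib, ih, ← Finset.mul_sum]
    have h1 : (fun g => shiftSeq h (g + j)) = fun g => h (g + (j + 1)) := rfl
    rw [h1]
    linear_combination (h 0 * ∑ v : Fin j → Bool, walshSum bitSign (prodFun hs)
      (List.ofFn v ++ y)) * sum_bitSign

theorem geom_apply_toReal {η : ℝ} (h0 : 0 ≤ η) (h1 : η < 1) (j : ℕ) :
    (geom η h0 h1 j).toReal = geomLaw η j :=
  ENNReal.toReal_ofReal (mul_nonneg (by linarith) (pow_nonneg h0 j))

/-- The effect of the output of a channel on one bit at the beginning of a string. -/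
theorem SyncChannel.expectation_block (c : SyncChannel) (b : Bool) {h : ℕ → ℂ} {B R : ℝ}
    (hh : GrowthLe B R h) (hR : Summable fun j => c.headLaw j * R ^ j)
    (hs : List (ℕ → ℂ)) (y : List Bool)
    (hfin : posExpectation (c.block b)
      (fun u => ‖walshSum bitSign (prodFun (h :: hs)) (u ++ y)‖ₑ) ≠ ∞) :
    expectation (c.block b) (fun u => walshSum bitSign (prodFun (h :: hs)) (u ++ y)) =
      walshSum bitSign (prodFun (avgSeq c.blockLaw h :: hs)) y +
        c.factor * avgSeq c.headLaw h 0 * bitSign b * walshSum bitSign (prodFun hs) y := by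
  cases c with
  | deletion δ h0 h1 =>
    have h2 : avgSeq (deletionLaw δ) h =
        fun i => (fun i => (δ : ℂ) * h i) i + (fun i => (1 - δ : ℂ) * shiftSeq h i) i :=
      funext fun i => avgSeq_deletionLaw δ h i
    simp only [block, blockLaw, headLaw, factor]
    rw [expectation_coin_map, h2, walshSum_prodFun_add, walshSum_prodFun_smul,
      walshSum_prodFun_smul, avgSeq_pointLaw]
    simp only [if_true, Bool.false_eq_true, if_false, List.nil_append, List.cons_append,
      walshSum_prodFun_cons]
    ring
  | symmetry σ h0 h1 h2 =>
    have h3 : avgSeq (pointLaw 1) h = shiftSeq h := funext fun i => avgSeq_pointLaw 1 h i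
    simp only [block, blockLaw, headLaw, factor]
    rw [expectation_coin_map, h3, avgSeq_pointLaw]
    simp only [List.nil_append, List.cons_append, walshSum_prodFun_cons]
    cases b <;> simp [bitSign] <;> ring
  | insertion η h0 h1 =>
    simp only [block, blockLaw, headLaw, factor, one_mul] at hfin hR ⊢
    rw [expectation_bind _ _ _ hfin]
    -- With `j` inserted bits, an unmarked `b` adds `j + 1` to the first gap, and a marked `b` ends
    -- a first gap of length `j`.
    have hin : ∀ j, expectation ((uniformBits j).map fun u => u ++ [b])
        (fun u => walshSum bitSign (prodFun (h :: hs)) (u ++ y)) =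
        walshSum bitSign (prodFun ((fun g => h (g + 1 + j)) :: hs)) y +
          h j * (bitSign b * walshSum bitSign (prodFun hs) y) := by
      intro j
      rw [expectation_map _ _ (fun u => walshSum bitSign (prodFun (h :: hs)) (u ++ y))
        (posExpectation_uniformBits_ne_top j _), expectation_uniformBits]
      simp only [List.append_assoc, sum_walshSum_ofFn_append, List.cons_append, List.nil_append]
      rw [mul_div_cancel_left₀ _ (pow_ne_zero _ two_ne_zero), walshSum_prodFun_cons]
      simp only [zero_add, mul_assoc]
      rfl
    unfold expectation
    simp only [geom_apply_toReal] at *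
    have hn := (lightTailed_geomLaw h0 h1).nonneg
    have hsum := summable_avgSeq hn hR hh
    have e1 : HasSum (fun j => (geomLaw η j : ℂ) *
        walshSum bitSign (prodFun ((fun g => h (g + 1 + j)) :: hs)) y)
        (walshSum bitSign (prodFun (avgSeq (insertionLaw η) h :: hs)) y) := by
      refine hasSum_walshSum_prodFun (f := fun j g => h (g + 1 + j)) (fun g => ?_) hs y
      rw [avgSeq_insertionLaw]
      convert (hsum (g + 1)).hasSum using 1
      refine tsum_congr fun j => ?_
      rw [shiftSeq]
      congr 2
      omega
    have e2 : HasSum (fun j => (geomLaw η j : ℂ) *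
        (h j * (bitSign b * walshSum bitSign (prodFun hs) y)))
        (avgSeq (geomLaw η) h 0 * (bitSign b * walshSum bitSign (prodFun hs) y)) := by
      have := (hsum 0).hasSum.mul_right (bitSign b * walshSum bitSign (prodFun hs) y)
      simpa only [avgSeq, zero_add, mul_assoc] using this
    have e3 := (e1.add e2).tsum_eq
    rw [mul_assoc, ← e3]
    refine tsum_congr fun j => ?_
    rw [← mul_add, ← hin j]
    rfl

/-! #### Exponential moments of the length of a trace -/

theorem SyncChannel.posExpectation_block_le (c : SyncChannel) :
    ∃ C ≥ 0, ∃ R₀ > 1, ∀ R, 1 ≤ R → R ≤ R₀ → ∀ b,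
      posExpectation (c.block b) (fun u => ENNReal.ofReal (R ^ u.length)) ≤
        ENNReal.ofReal (1 + C * (R - 1)) := by
  obtain ⟨C, hC, R₀, hR₀, h⟩ := c.lightTailed_blockLaw.exists_tsum_le
  refine ⟨C, hC, R₀, hR₀, fun R h1 h2 b => ?_⟩
  obtain ⟨hs, hle⟩ := h R h1 h2
  refine le_trans (le_of_eq ?_) (ENNReal.ofReal_le_ofReal hle)
  have hR0 : 0 ≤ R := by linarith
  rw [ENNReal.ofReal_tsum_of_nonneg
    (fun j => mul_nonneg (c.lightTailed_blockLaw.nonneg j) (pow_nonneg hR0 j)) hs]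
  cases c with
  | deletion δ h0 h1 =>
    simp only [block, posExpectation_coin_map, blockLaw]
    rw [tsum_eq_sum (s := Finset.range 2)]
    · simp only [if_true, Bool.false_eq_true, if_false, Finset.sum_range_succ,
        Finset.sum_range_zero, deletionLaw, zero_add, List.length_nil, List.length_singleton]
      rw [ENNReal.ofReal_mul h0, ENNReal.ofReal_mul (sub_nonneg.2 h1.le)]
    · intro j hj
      match j with
      | 0 => simp at hj
      | 1 => simp at hj
      | _ + 2 => simp [deletionLaw]
  | symmetry σ h0 h1 h2 =>
    simp only [block, posExpectation_coin_map, blockLaw, List.length_singleton]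
    rw [← add_mul, ← ENNReal.ofReal_add h0 (sub_nonneg.2 h1), tsum_eq_single 1]
    · simp [pointLaw]
    · intro j hj
      simp [pointLaw, hj]
  | insertion η h0 h1 =>
    simp only [block, blockLaw]
    rw [posExpectation_bind, tsum_eq_zero_add' ENNReal.summable]
    simp only [posExpectation_map, List.length_append, List.length_singleton]
    rw [show ENNReal.ofReal (insertionLaw η 0 * R ^ 0) = 0 by simp [insertionLaw], zero_add]
    refine tsum_congr fun j => ?_
    beta_reduce
    rw [posExpectation_uniformBits_length j fun l => ENNReal.ofReal (R ^ (l + 1)),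
      insertionLaw, ENNReal.ofReal_mul ((lightTailed_geomLaw h0 h1).nonneg j)]
    rfl

/-- The blocks are independent, so the rest of the trace may be drawn first; inductions then average
over the first block with the suffix fixed. -/
theorem SyncChannel.trace_cons (c : SyncChannel) (b : Bool) (x : List Bool) :
    c.trace (b :: x) = (c.trace x).bind fun v => (c.block b).map fun u => u ++ v := by
  rw [SyncChannel.trace]
  unfold PMF.map
  exact PMF.bind_comm _ _ _

theorem SyncChannel.posExpectation_trace_le (c : SyncChannel) {r R : ℝ} (hR : 0 ≤ R) (hr : 0 ≤ r)
    (h : ∀ b, posExpectation (c.block b) (fun u => ENNReal.ofReal (R ^ u.length)) ≤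
        ENNReal.ofReal r) (x : List Bool) :
    posExpectation (c.trace x) (fun u => ENNReal.ofReal (R ^ u.length)) ≤
      ENNReal.ofReal (r ^ x.length) := by
  induction x with
  | nil => simp [SyncChannel.trace, posExpectation_pure]
  | cons b x ih =>
    rw [c.trace_cons, posExpectation_bind]
    calc _ ≤ posExpectation (c.trace x) fun v =>
          ENNReal.ofReal r * ENNReal.ofReal (R ^ v.length) := by
          refine posExpectation_mono _ fun v => ?_
          rw [posExpectation_map]
          have : (fun u : List Bool => ENNReal.ofReal (R ^ (u ++ v).length)) =
              fun u => ENNReal.ofReal (R ^ v.length) * ENNReal.ofReal (R ^ u.length) := by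
            funext u
            rw [List.length_append, add_comm, pow_add, ENNReal.ofReal_mul (pow_nonneg hR _)]
          rw [this, posExpectation_const_mul, mul_comm]
          exact mul_le_mul_left (h b) _
      _ ≤ _ := by
          rw [posExpectation_const_mul, List.length_cons, pow_succ',
            ENNReal.ofReal_mul hr]
          exact mul_le_mul_right ih _

/-- The moment of one channel at `R` is a moment of its input at `1 + C' (R - 1)`, so the bound
stays linear in `R - 1` along the composition and the constants multiply. -/
theorem posExpectation_compositeTrace_le (cs : List SyncChannel) :
    ∃ C ≥ 0, ∃ R₀ > 1, ∀ R, 1 ≤ R → R ≤ R₀ → ∀ x,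
      posExpectation (compositeTrace cs x) (fun u => ENNReal.ofReal (R ^ u.length)) ≤
        ENNReal.ofReal ((1 + C * (R - 1)) ^ x.length) := by
  induction cs with
  | nil =>
    refine ⟨1, zero_le_one, 2, by norm_num, fun R _ _ x => ?_⟩
    simp [compositeTrace, posExpectation_pure]
  | cons c cs ih =>
    obtain ⟨C, hC, R₀, hR₀, h⟩ := ih
    obtain ⟨C', hC', R₁, hR₁, h'⟩ := c.posExpectation_block_le
    -- The range of `R` is shrunk so that `1 + C' (R - 1)` stays below `R₀`, where the moment bound
    -- for the earlier channels applies.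
    refine ⟨C * C', mul_nonneg hC hC', min R₁ (1 + (R₀ - 1) / (C' + 1)),
      lt_min hR₁ ?_, fun R h1 h2 x => ?_⟩
    · have : 0 < (R₀ - 1) / (C' + 1) := div_pos (by linarith) (by linarith)
      linarith
    have hr1 : 1 ≤ 1 + C' * (R - 1) := by nlinarith
    have hr2 : 1 + C' * (R - 1) ≤ R₀ := by
      have : R ≤ 1 + (R₀ - 1) / (C' + 1) := h2.trans (min_le_right _ _)
      have h3 : (R - 1) * (C' + 1) ≤ R₀ - 1 := by
        rw [← le_div_iff₀ (by linarith)]; linarith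
      nlinarith
    rw [compositeTrace, posExpectation_bind]
    calc _ ≤ posExpectation (compositeTrace cs x)
          (fun u => ENNReal.ofReal ((1 + C' * (R - 1)) ^ u.length)) :=
          posExpectation_mono _ fun y => c.posExpectation_trace_le (by linarith) (by linarith)
            (h' R h1 (h2.trans (min_le_left _ _))) y
      _ ≤ _ := by
          refine (h _ hr1 hr2 x).trans (le_of_eq ?_)
          congr 2
          ring

end

/-! ### Growth of position sums and their means under one and several channels. -/

noncomputable section

open scoped ENNReal

theorem GrowthLe.shiftSeq {B R : ℝ} {h : ℕ → ℂ} (hh : GrowthLe B R h) :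
    GrowthLe (B * R) R (shiftSeq h) := fun g => by
  refine (hh (g + 1)).trans (le_of_eq ?_)
  rw [pow_succ]; ring

/-- A crude bound that serves only integrability: each further marked position costs one power of
the length. The summand 1 in `K + 1` covers the empty string. -/
theorem norm_walshSum_cons_le {s : Bool → ℂ} (hs : ∀ b, ‖s b‖ ≤ 1) {R K : ℝ} {m : ℕ} (hR : 1 ≤ R)
    (hK : 0 ≤ K) {k : List (ℕ → ℂ)}
    (hk : ∀ y, ‖walshSum s (prodFun k) y‖ ≤ K * (y.length + 1) ^ m * R ^ y.length)
    (x : List Bool) {B : ℝ} {h : ℕ → ℂ} (hh : GrowthLe B R h) :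
    ‖walshSum s (prodFun (h :: k)) x‖ ≤
      (K + 1) * B * (x.length + 1) ^ (m + 1) * R ^ x.length := by
  induction x generalizing B h with
  | nil =>
    have h0 := hh 0
    have hB := hh.nonneg
    have h1 : ‖prodFun k []‖ ≤ 1 := by cases k <;> simp [prodFun]
    simp only [walshSum, prodFun_cons_cons, norm_mul, List.length_nil, Nat.cast_zero, zero_add,
      one_pow, pow_zero, mul_one] at h0 ⊢
    nlinarith [norm_nonneg (h 0), norm_nonneg (prodFun k [])]
  | cons b x ih =>
    rw [walshSum_prodFun_cons]
    have hB := hh.nonneg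
    have h1 := ih hh.shiftSeq
    have h2 : ‖h 0 * s b * walshSum s (prodFun k) x‖ ≤
        B * (K * (x.length + 1) ^ m * R ^ x.length) := by
      rw [norm_mul, norm_mul]
      have h0 : ‖h 0‖ ≤ B := by simpa using hh 0
      have h3 : ‖h 0‖ * ‖s b‖ ≤ B * 1 := mul_le_mul h0 (hs b) (norm_nonneg _) hB
      rw [mul_one] at h3
      exact mul_le_mul h3 (hk x) (norm_nonneg _) hB
    refine (norm_add_le _ _).trans ((add_le_add h1 h2).trans ?_)
    set L : ℝ := (x.length : ℝ) with hL
    have hL0 : 0 ≤ L := Nat.cast_nonneg _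
    have e1 : (L + 1) ^ (m + 1) + (L + 1) ^ m ≤ (L + 1 + 1) ^ (m + 1) := by
      have : (L + 1) ^ m ≤ (L + 1 + 1) ^ m := by gcongr; linarith
      calc (L + 1) ^ (m + 1) + (L + 1) ^ m = (L + 1) ^ m * (L + 1 + 1) := by ring
        _ ≤ (L + 1 + 1) ^ m * (L + 1 + 1) := by gcongr
        _ = _ := by ring
    have e2 : K * (L + 1) ^ m * R ^ x.length ≤ (K + 1) * (L + 1) ^ m * R ^ (x.length + 1) := by
      have : R ^ x.length ≤ R ^ (x.length + 1) := pow_le_pow_right₀ hR (by omega)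
      gcongr
      linarith
    have hc : ((b :: x).length : ℝ) = L + 1 := by simp [hL]
    rw [hc, List.length_cons]
    calc _ ≤ (K + 1) * (B * R) * (L + 1) ^ (m + 1) * R ^ x.length +
          B * ((K + 1) * (L + 1) ^ m * R ^ (x.length + 1)) := by gcongr
      _ = (K + 1) * B * R ^ (x.length + 1) * ((L + 1) ^ (m + 1) + (L + 1) ^ m) := by ring
      _ ≤ (K + 1) * B * R ^ (x.length + 1) * (L + 1 + 1) ^ (m + 1) := by gcongr
      _ = _ := by ring

theorem exists_norm_walshSum_le_poly {s : Bool → ℂ} (hs : ∀ b, ‖s b‖ ≤ 1) {R : ℝ} (hR : 1 ≤ R)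
    {k : List (ℕ → ℂ)} (hk : ∀ h ∈ k, ∃ B, GrowthLe B R h) :
    ∃ K ≥ 0, ∃ m : ℕ, ∀ y,
      ‖walshSum s (prodFun k) y‖ ≤ K * ((y.length : ℝ) + 1) ^ m * R ^ y.length := by
  induction k with
  | nil => exact ⟨0, le_rfl, 0, fun y => by simp [walshSum_prodFun_nil]⟩
  | cons h k ih =>
    obtain ⟨K, hK, m, hm⟩ := ih fun h' hh' => hk h' (by simp [hh'])
    obtain ⟨B, hB⟩ := hk h (by simp)
    exact ⟨(K + 1) * B, mul_nonneg (by linarith) hB.nonneg, m + 1,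
      fun y => norm_walshSum_cons_le hs hR hK hm y hB⟩

/-- The power of the length is absorbed by a slight increase of the exponential rate. -/
theorem exists_norm_walshSum_le {s : Bool → ℂ} (hs : ∀ b, ‖s b‖ ≤ 1) {R R' : ℝ} (hR : 1 ≤ R)
    (hR' : R < R') {k : List (ℕ → ℂ)} (hk : ∀ h ∈ k, ∃ B, GrowthLe B R h) :
    ∃ K ≥ 0, ∀ y, ‖walshSum s (prodFun k) y‖ ≤ K * R' ^ y.length := by
  obtain ⟨K, hK, m, hm⟩ := exists_norm_walshSum_le_poly hs hR hk
  have hq : 1 < R' / R := (one_lt_div (by linarith)).2 hR'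
  have ht := (tendsto_pow_const_div_const_pow_of_one_lt m hq).comp (Filter.tendsto_add_atTop_nat 1)
  obtain ⟨M, hM⟩ := ht.bddAbove_range
  have hM' : ∀ n : ℕ, ((n : ℝ) + 1) ^ m ≤ M * (R' / R) ^ (n + 1) := by
    intro n
    have := hM ⟨n, rfl⟩
    simp only [Function.comp_apply, Nat.cast_add, Nat.cast_one] at this
    rwa [div_le_iff₀ (pow_pos (by linarith) _)] at this
  have hM0 : 0 ≤ M := by
    have := hM' 0
    simp only [Nat.cast_zero, zero_add, one_pow, pow_one] at this
    by_contra hcon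
    nlinarith
  refine ⟨K * (M * (R' / R)), mul_nonneg hK (mul_nonneg hM0 (by linarith)), fun y => ?_⟩
  calc _ ≤ K * ((y.length : ℝ) + 1) ^ m * R ^ y.length := hm y
    _ ≤ K * (M * (R' / R) ^ (y.length + 1)) * R ^ y.length := by gcongr; exact hM' _
    _ = K * (M * (R' / R)) * ((R' / R) * R) ^ y.length := by rw [mul_pow]; ring
    _ = _ := by rw [div_mul_cancel₀ _ (by linarith)]

/-- The action of an operator on all functions of a list but the last, and of another operator on
the last function. -/
def mapOps (T U : (ℕ → ℂ) → ℕ → ℂ) : List (ℕ → ℂ) → List (ℕ → ℂ)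
  | [] => []
  | [h] => [U h]
  | h :: h' :: hs => T h :: mapOps T U (h' :: hs)

theorem mapOps_cons {T U : (ℕ → ℂ) → ℕ → ℂ} (h : ℕ → ℂ) {hs : List (ℕ → ℂ)} (hn : hs ≠ []) :
    mapOps T U (h :: hs) = T h :: mapOps T U hs := by
  obtain ⟨a, k, rfl⟩ := List.exists_cons_of_ne_nil hn
  rfl

theorem mapOps_append_singleton (T U : (ℕ → ℂ) → ℕ → ℂ) (hs : List (ℕ → ℂ)) (h : ℕ → ℂ) :
    mapOps T U (hs ++ [h]) = hs.map T ++ [U h] := by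
  induction hs with
  | nil => rfl
  | cons a hs ih => rw [List.cons_append, mapOps_cons _ (by simp), ih]; rfl

theorem mapOps_mapOps (T U T' U' : (ℕ → ℂ) → ℕ → ℂ) (hs : List (ℕ → ℂ)) :
    mapOps T U (mapOps T' U' hs) = mapOps (fun h => T (T' h)) (fun h => U (U' h)) hs := by
  induction hs using List.reverseRecOn with
  | nil => rfl
  | append_singleton hs h => simp [mapOps_append_singleton]

theorem mapOps_id (hs : List (ℕ → ℂ)) : mapOps (fun h => h) (fun h => h) hs = hs := by
  induction hs using List.reverseRecOn with
  | nil => rfl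
  | append_singleton hs h => simp [mapOps_append_singleton]

theorem posExpectation_walshSum_ne_top {p : PMF (List Bool)} {R K : ℝ} {f : List Bool → ℂ}
    (hf : ∀ y, ‖f y‖ ≤ K * R ^ y.length)
    (hp : posExpectation p (fun u => ENNReal.ofReal (R ^ u.length)) ≠ ∞) :
    posExpectation p (fun u => ‖f u‖ₑ) ≠ ∞ := by
  have hK : 0 ≤ K := by simpa using (norm_nonneg _).trans (hf [])
  refine ne_top_of_le_ne_top (b := ENNReal.ofReal K * posExpectation p
    fun u => ENNReal.ofReal (R ^ u.length)) (ENNReal.mul_ne_top ENNReal.ofReal_ne_top hp) ?_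
  rw [← posExpectation_const_mul]
  refine posExpectation_mono _ fun u => ?_
  rw [← ENNReal.ofReal_mul hK, ← ofReal_norm]
  exact ENNReal.ofReal_le_ofReal (hf u)

/-- Averaging over the block of the first bit gives, by `expectation_block`, the two terms of the
position-sum recursion: an unmarked bit replaces the first function by its block average, a marked
one contributes the sign factor times the head average. The gap operators satisfy the same
recursion, since shifting `gapOp a b h` amounts to averaging `h` over `a`. -/
theorem SyncChannel.expectation_trace_walshSum (c : SyncChannel) {R R₁ : ℝ} (hR : 1 ≤ R)
    (hRR₁ : R < R₁) (hhead : Summable fun j => c.headLaw j * R ^ j)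
    (hblock : Summable fun j => c.blockLaw j * R ^ j)
    (hfin : ∀ b, posExpectation (c.block b) (fun u => ENNReal.ofReal (R₁ ^ u.length)) ≠ ∞)
    (hfin' : ∀ x, posExpectation (c.trace x) (fun u => ENNReal.ofReal (R₁ ^ u.length)) ≠ ∞)
    (x : List Bool) {hs : List (ℕ → ℂ)} (hhs : ∀ h ∈ hs, ∃ B, GrowthLe B R h) :
    expectation (c.trace x) (walshSum bitSign (prodFun hs)) =
      walshSum bitSign (prodFun (mapOps c.innerOp c.lastOp hs)) x := by
  induction x generalizing hs with
  | nil =>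
    rw [SyncChannel.trace, expectation_pure]
    match hs with
    | [] => rfl
    | [h] =>
      simp only [mapOps, walshSum, prodFun_cons_cons, SyncChannel.lastOp, gapOp_zero,
        avgSeq_pointLaw]
    | h :: h' :: hs =>
      have hm : mapOps c.innerOp c.lastOp (h' :: hs) ≠ [] := by cases hs <;> simp [mapOps]
      obtain ⟨a, k, hak⟩ := List.exists_cons_of_ne_nil hm
      simp [mapOps, walshSum, prodFun_cons_cons, prodFun_cons_nil, hak]
  | cons b x ih =>
    match hs with
    | [] =>
      simp only [mapOps, walshSum_prodFun_nil]
      have : (walshSum bitSign (prodFun [])) = fun _ => 0 :=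
        funext fun x => walshSum_prodFun_nil bitSign x
      rw [this]
      simp [expectation]
    | h :: hs =>
      obtain ⟨K, hK, hbd⟩ := exists_norm_walshSum_le norm_bitSign hR hRR₁ hhs
      obtain ⟨B, hB⟩ := hhs h (by simp)
      have hhs' : ∀ h ∈ hs, ∃ B, GrowthLe B R h := fun h' hh' => hhs h' (by simp [hh'])
      have hhs'' : ∀ h' ∈ avgSeq c.blockLaw h :: hs, ∃ B, GrowthLe B R h' := by
        intro h' hh'
        rcases List.mem_cons.1 hh' with rfl | hh'
        · exact ⟨_, hB.avgSeq c.lightTailed_blockLaw.nonneg hblock⟩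
        · exact hhs' h' hh'
      obtain ⟨K₂, hK₂, hbd₂⟩ := exists_norm_walshSum_le norm_bitSign hR hRR₁ hhs''
      obtain ⟨K₃, hK₃, hbd₃⟩ := exists_norm_walshSum_le norm_bitSign hR hRR₁ hhs'
      have hf := posExpectation_walshSum_ne_top hbd (hfin' (b :: x))
      rw [c.trace_cons] at hf ⊢
      rw [expectation_bind _ _ _ hf]
      have hin : ∀ v, expectation ((c.block b).map fun u => u ++ v)
          (walshSum bitSign (prodFun (h :: hs))) =
          walshSum bitSign (prodFun (avgSeq c.blockLaw h :: hs)) v +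
            c.factor * avgSeq c.headLaw h 0 * bitSign b * walshSum bitSign (prodFun hs) v := by
        intro v
        have hf2 : posExpectation (c.block b)
            (fun u => ‖walshSum bitSign (prodFun (h :: hs)) (u ++ v)‖ₑ) ≠ ∞ := by
          refine posExpectation_walshSum_ne_top (K := K * R₁ ^ v.length) (fun y => ?_) (hfin b)
          refine (hbd _).trans (le_of_eq ?_)
          rw [List.length_append, pow_add]; ring
        rw [expectation_map _ _ _ hf2]
        exact c.expectation_block b hB hhead hs v hf2
      simp only [hin]
      rw [expectation_add (posExpectation_walshSum_ne_top hbd₂ (hfin' x)), expectation_const_mul,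
        ih hhs'', ih hhs']
      · match hs with
        | [] =>
          simp only [mapOps, walshSum_prodFun_nil, mul_zero, add_zero, walshSum_prodFun_singleton]
          rfl
        | h' :: hs =>
          simp only [mapOps]
          rw [walshSum_prodFun_cons]
          rfl
      · refine posExpectation_walshSum_ne_top (R := R₁)
          (K := ‖c.factor * avgSeq c.headLaw h 0 * bitSign b‖ * K₃) (fun y => ?_) (hfin' x)
        rw [norm_mul, mul_assoc _ K₃]
        exact mul_le_mul_of_nonneg_left (hbd₃ y) (norm_nonneg _)

theorem SyncChannel.exists_expectation_trace (c : SyncChannel) {R' : ℝ} (hR' : 1 < R') :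
    ∃ R > 1, ∀ hs : List (ℕ → ℂ), (∀ h ∈ hs, ∃ B, GrowthLe B R h) →
      (∀ h ∈ mapOps c.innerOp c.lastOp hs, ∃ B, GrowthLe B R' h) ∧
      ∀ x, expectation (c.trace x) (walshSum bitSign (prodFun hs)) =
        walshSum bitSign (prodFun (mapOps c.innerOp c.lastOp hs)) x := by
  obtain ⟨Ra, hRa, ha, -⟩ := c.regularOp_innerOp.growth R' hR'
  obtain ⟨Rb, hRb, hb, -⟩ := c.regularOp_lastOp.growth R' hR'
  obtain ⟨C₁, hC₁, R₁, hR₁, h₁⟩ := c.posExpectation_block_le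
  obtain ⟨_, _, R₂, hR₂, h₂⟩ := c.lightTailed_headLaw.exists_tsum_le
  obtain ⟨_, _, R₃, hR₃, h₃⟩ := c.lightTailed_blockLaw.exists_tsum_le
  -- The rate must keep the images under both operators within growth `R'`, make the head and block
  -- laws summable, and lie strictly below a rate `R₁` at which traces have finite moments.
  set R := min (min Ra Rb) (min ((1 + R₁) / 2) (min R₂ R₃)) with hR
  have hR1 : 1 < R := lt_min (lt_min hRa hRb) (lt_min (by linarith) (lt_min hR₂ hR₃))
  have l1 : R ≤ Ra := (min_le_left _ _).trans (min_le_left _ _)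
  have l2 : R ≤ Rb := (min_le_left _ _).trans (min_le_right _ _)
  have l3 : R ≤ (1 + R₁) / 2 := (min_le_right _ _).trans (min_le_left _ _)
  have l4 : R ≤ R₂ := (min_le_right _ _).trans ((min_le_right _ _).trans (min_le_left _ _))
  have l5 : R ≤ R₃ := (min_le_right _ _).trans ((min_le_right _ _).trans (min_le_right _ _))
  refine ⟨R, hR1, fun hs hhs => ⟨?_, fun x => ?_⟩⟩
  · induction hs using List.reverseRecOn with
    | nil => simp [mapOps]
    | append_singleton hs h _ =>
      rw [mapOps_append_singleton]
      intro h' hh'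
      rw [List.mem_append, List.mem_map, List.mem_singleton] at hh'
      rcases hh' with ⟨k, hk, rfl⟩ | rfl
      · obtain ⟨B, hB⟩ := hhs k (by simp [hk])
        exact ha B k (hB.mono le_rfl (by linarith) l1)
      · obtain ⟨B, hB⟩ := hhs h (by simp)
        exact hb B h (hB.mono le_rfl (by linarith) l2)
  · have hle := h₁ R₁ hR₁.le le_rfl
    refine c.expectation_trace_walshSum hR1.le (R₁ := R₁) (by linarith) (h₂ R hR1.le l4).1
      (h₃ R hR1.le l5).1 (fun b => ne_top_of_le_ne_top ENNReal.ofReal_ne_top (hle b))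
      (fun x => ne_top_of_le_ne_top ENNReal.ofReal_ne_top
        (c.posExpectation_trace_le (by linarith) ?_ hle x)) x hhs
    nlinarith

theorem exists_posExpectation_compositeTrace_ne_top (cs : List SyncChannel) :
    ∃ R > 1, ∀ hs : List (ℕ → ℂ), (∀ h ∈ hs, ∃ B, GrowthLe B R h) → ∀ x,
      posExpectation (compositeTrace cs x)
        (fun y => ‖walshSum bitSign (prodFun hs) y‖ₑ) ≠ ∞ := by
  obtain ⟨C, hC, R₀, hR₀, h⟩ := posExpectation_compositeTrace_le cs
  refine ⟨(1 + R₀) / 2, by linarith, fun hs hhs x => ?_⟩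
  obtain ⟨K, hK, hbd⟩ := exists_norm_walshSum_le norm_bitSign (R' := R₀)
    (by linarith) (by linarith) hhs
  exact posExpectation_walshSum_ne_top hbd
    (ne_top_of_le_ne_top ENNReal.ofReal_ne_top (h R₀ hR₀.le le_rfl x))

/-- The expected position sum of a trace of a composite channel. -/
theorem exists_expectation_compositeTrace (cs : List SyncChannel) :
    ∃ R > 1, ∀ hs : List (ℕ → ℂ), (∀ h ∈ hs, ∃ B, GrowthLe B R h) → ∀ x,
      posExpectation (compositeTrace cs x) (fun y => ‖walshSum bitSign (prodFun hs) y‖ₑ) ≠ ∞ ∧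
      expectation (compositeTrace cs x) (walshSum bitSign (prodFun hs)) =
        walshSum bitSign (prodFun (mapOps (innerOps cs) (lastOps cs) hs)) x := by
  induction cs with
  | nil =>
    obtain ⟨R, hR, h⟩ := exists_posExpectation_compositeTrace_ne_top _
    refine ⟨R, hR, fun hs hhs x => ⟨h hs hhs x, ?_⟩⟩
    rw [compositeTrace, expectation_pure]
    exact (congrArg (fun k => walshSum bitSign (prodFun k) x) (mapOps_id hs)).symm
  | cons c cs ih =>
    obtain ⟨R, hR, h⟩ := exists_posExpectation_compositeTrace_ne_top _
    obtain ⟨R', hR', h'⟩ := ih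
    obtain ⟨R'', hR'', h''⟩ := c.exists_expectation_trace hR'
    refine ⟨min R R'', lt_min hR hR'', fun hs hhs x => ?_⟩
    have g1 : ∀ h ∈ hs, ∃ B, GrowthLe B R h := fun k hk => by
      obtain ⟨B, hB⟩ := hhs k hk
      exact ⟨B, hB.mono le_rfl (le_min (by linarith) (by linarith)) (min_le_left _ _)⟩
    have g2 : ∀ h ∈ hs, ∃ B, GrowthLe B R'' h := fun k hk => by
      obtain ⟨B, hB⟩ := hhs k hk
      exact ⟨B, hB.mono le_rfl (le_min (by linarith) (by linarith)) (min_le_right _ _)⟩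
    refine ⟨h hs g1 x, ?_⟩
    obtain ⟨g3, e3⟩ := h'' hs g2
    have hf := h hs g1 x
    rw [compositeTrace] at hf ⊢
    -- The channel that acts last on strings is averaged over first, so its operators are the first
    -- to act on the gap functions.
    rw [expectation_bind _ _ _ hf]
    simp only [e3]
    rw [(h' _ g3 x).2, mapOps_mapOps]
    rfl

end

noncomputable section

/-! ### Approximate inverse images for the first and the last gap -/

/-- Each of at most `N` indicators is approximated to accuracy `θ / (N + 1)`. Both the number of
terms and the loss `(N + 1) ^ A` are paid by powers of `2 ^ (N + 1)`, which is why `Q = 2 A 2 ^ A`.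
-/
theorem ApproxInvertible.exists_approx_sum {T : (ℕ → ℂ) → ℕ → ℂ} (hT : RegularOp T)
    (hTi : ApproxInvertible T) : ∃ Q : ℕ, 1 ≤ Q ∧ ∀ (N : ℕ) (s : Finset ℕ), s ⊆ Finset.range N →
      ∀ (c : ℕ → ℂ), (∀ j, ‖c j‖ ≤ 1) → ∀ θ : ℝ, 0 < θ → θ ≤ 1 →
      ∃ h : ℕ → ℂ, (∀ g, ‖h g‖ ≤ (Q : ℝ) ^ (N + 1) * (1 / θ) ^ Q) ∧
        ∀ g, ‖T h g - ∑ j ∈ s, c j * diracSeq j g‖ ≤ θ := by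
  obtain ⟨A, hA, h⟩ := hTi.exists_approx hT
  have hA' : (1 : ℝ) ≤ A := by exact_mod_cast hA
  refine ⟨2 * A * 2 ^ A, ?_, fun N s hs c hc θ hθ0 hθ1 => ?_⟩
  · exact Nat.one_le_iff_ne_zero.2 (by positivity)
  have hN0 : (0 : ℝ) < N + 1 := by positivity
  have hθ' : 0 < θ / (N + 1) := div_pos hθ0 hN0
  have hθ'1 : θ / (N + 1) ≤ 1 := by
    rw [div_le_one hN0]
    have : (0 : ℝ) ≤ N := Nat.cast_nonneg N
    linarith
  choose f hf1 hf2 using fun d => h d (θ / (N + 1)) hθ' hθ'1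
  have hcard : (s.card : ℝ) ≤ N := by
    have := Finset.card_le_card hs
    rw [Finset.card_range] at this
    exact_mod_cast this
  have hN2 : (N : ℝ) + 1 ≤ 2 ^ (N + 1) := by
    have : N + 1 < 2 ^ (N + 1) := Nat.lt_two_pow_self
    exact_mod_cast this.le
  have hiθ : 1 ≤ 1 / θ := by rw [le_div_iff₀ hθ0]; linarith
  refine ⟨fun g => ∑ j ∈ s, c j * f j g, fun g => ?_, fun g => ?_⟩
  · have hterm : ∀ j ∈ s, ‖c j * f j g‖ ≤ (A : ℝ) ^ (N + 1) * (1 / (θ / (N + 1))) ^ A := by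
      intro j hj
      rw [norm_mul]
      have hjN : j < N := Finset.mem_range.1 (hs hj)
      calc ‖c j‖ * ‖f j g‖ ≤ 1 * ((A : ℝ) ^ (j + 2) * (1 / (θ / (N + 1))) ^ A) :=
            mul_le_mul (hc j) (hf1 j g) (norm_nonneg _) zero_le_one
        _ ≤ _ := by
            rw [one_mul]
            exact mul_le_mul_of_nonneg_right (pow_le_pow_right₀ hA' (by omega)) (by positivity)
    have e1 : 1 / (θ / (N + 1)) = (N + 1) * (1 / θ) := by field_simp
    calc _ ≤ ∑ j ∈ s, (A : ℝ) ^ (N + 1) * (1 / (θ / (N + 1))) ^ A :=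
          (norm_sum_le _ _).trans (Finset.sum_le_sum hterm)
      _ ≤ 2 ^ (N + 1) * ((A : ℝ) ^ (N + 1) * (1 / (θ / (N + 1))) ^ A) := by
          rw [Finset.sum_const, nsmul_eq_mul]
          gcongr
          linarith
      _ ≤ 2 ^ (N + 1) * ((A : ℝ) ^ (N + 1) * (2 ^ (N + 1) * (1 / θ)) ^ A) := by
          rw [e1]
          gcongr
      _ = ((2 * A * 2 ^ A : ℕ) : ℝ) ^ (N + 1) * (1 / θ) ^ A := by
          push_cast
          rw [mul_pow, mul_pow, mul_pow, ← pow_mul, ← pow_mul, mul_comm (N + 1) A]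
          ring
      _ ≤ _ := by
          refine mul_le_mul_of_nonneg_left (pow_le_pow_right₀ hiθ ?_) (by positivity)
          calc A = 1 * A * 1 := by ring
            _ ≤ 2 * A * 2 ^ A := by gcongr <;> [norm_num; exact Nat.one_le_two_pow]
  · rw [hT.sum_of_bdd s (h := fun j g => c j * f j g)]
    · simp only [hT.smul, ← Finset.sum_sub_distrib, ← mul_sub]
      calc _ ≤ ∑ j ∈ s, θ / (N + 1) := by
            refine (norm_sum_le _ _).trans (Finset.sum_le_sum fun j _ => ?_)
            rw [norm_mul]
            exact (mul_le_mul (hc j) (hf2 j g) (norm_nonneg _) zero_le_one).trans_eq (one_mul _)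
        _ ≤ θ := by
            rw [Finset.sum_const, nsmul_eq_mul, mul_div_assoc', div_le_iff₀ hN0]
            nlinarith
    · intro j _
      refine ⟨‖c j‖ * ((A : ℝ) ^ (j + 2) * (1 / (θ / (N + 1))) ^ A), fun g => ?_⟩
      rw [norm_mul]
      exact mul_le_mul_of_nonneg_left (hf1 j g) (norm_nonneg _)

/-! #### Exponential sequences -/

/-- Powers of `z` are eigenvectors of averaging over translates, so `g` blocks contribute `φ ^ g`
and the inserted head contributes `ψ`. -/
theorem gapOp_pow {a b : ℕ → ℝ} {z φ ψ : ℂ} (ha : ∀ i, avgSeq a (fun g => z ^ g) i = φ * z ^ i)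
    (hb : avgSeq b (fun g => z ^ g) 0 = ψ) (g : ℕ) :
    gapOp a b (fun g => z ^ g) g = ψ * φ ^ g := by
  have : (avgSeq a)^[g] (fun g => z ^ g) = fun i => φ ^ g * z ^ i := by
    induction g with
    | zero => simp
    | succ g ih =>
      rw [Function.iterate_succ_apply', ih, avgSeq_smul]
      funext i
      rw [ha, pow_succ]; ring
  rw [gapOp, this, avgSeq_smul b (φ ^ g) fun i => z ^ i]
  beta_reduce
  rw [hb, mul_comm]

theorem avgSeq_geomLaw_pow {η : ℝ} {z : ℂ} (hz : ‖η * z‖ < 1) (i : ℕ) :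
    avgSeq (geomLaw η) (fun g => z ^ g) i = (1 - η) / (1 - η * z) * z ^ i := by
  unfold avgSeq
  have h1 := tsum_geometric_of_norm_lt_one hz
  calc _ = ∑' j, ((1 - η) * z ^ i) * (η * z) ^ j := by
        refine tsum_congr fun j => ?_
        simp only [geomLaw]
        push_cast
        rw [mul_pow, pow_add]; ring
    _ = _ := by rw [tsum_mul_left, h1, div_eq_mul_inv]; ring

theorem avgSeq_insertionLaw_pow {η : ℝ} {z : ℂ} (hz : ‖η * z‖ < 1) (i : ℕ) :
    avgSeq (insertionLaw η) (fun g => z ^ g) i = (1 - η) * z / (1 - η * z) * z ^ i := by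
  have : shiftSeq (fun g => z ^ g) = fun g => z * z ^ g := funext fun g => pow_succ' z g
  rw [avgSeq_insertionLaw, this, avgSeq_smul (geomLaw η) z fun g => z ^ g]
  beta_reduce
  rw [avgSeq_geomLaw_pow hz]
  ring

/-- The ratio `z` solves a Möbius equation: `z = (z' - q) / (1 - q)` for deletions and `z = z' / (1
+ η (z' - 1))` for insertions. Both fix 1, and exact identities for the squared moduli show that
`|z|² - 1` is bounded by multiples of `t²` if `|z'|² - 1` is, although `z - 1` is only of order `t`.
The factor `γ` cancels the sign contraction and the contribution of the head. The bounds are of the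
same type as the hypotheses, so the lemma iterates over a composition. -/
theorem SyncChannel.exists_pow_preimage (c : SyncChannel) {a : ℝ} (ha : 1 ≤ a) :
    ∃ a' ≥ 1, ∃ t₀ > 0, ∀ t, 0 ≤ t → t ≤ t₀ → ∀ z' : ℂ, ‖z' - 1‖ ≤ a * t →
      ‖z'‖ ^ 2 ≤ 1 + a * t ^ 2 → ∃ z γ : ℂ, ‖z - 1‖ ≤ a' * t ∧ ‖z‖ ^ 2 ≤ 1 + a' * t ^ 2 ∧
        ‖γ‖ ≤ a' ∧ c.innerOp (fun g => γ * z ^ g) = fun g => z' ^ g := by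
  cases c with
  | deletion q h0 h1 =>
    have hp : 0 < 1 - q := by linarith
    have hp' : (1 - q : ℂ) ≠ 0 := by
      rw [← Complex.ofReal_one, ← Complex.ofReal_sub, Complex.ofReal_ne_zero]; exact hp.ne'
    have hnp : ‖(1 - q : ℂ)‖ = 1 - q := by
      rw [← Complex.ofReal_one, ← Complex.ofReal_sub, Complex.norm_real,
        Real.norm_of_nonneg hp.le]
    have hip : 1 ≤ 1 / (1 - q) := by rw [le_div_iff₀ hp]; linarith
    refine ⟨(a + a ^ 2) * (1 / (1 - q)) ^ 2, ?_, 1, one_pos, fun t ht0 _ z' hz1 hz2 =>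
      ⟨(z' - q) / (1 - q), 1 / (1 - q), ?_, ?_, ?_, ?_⟩⟩
    · have : 1 ≤ (1 / (1 - q)) ^ 2 := one_le_pow₀ hip
      nlinarith
    · have : (z' - q) / (1 - q) - 1 = (z' - 1) / (1 - q) := by field_simp; ring
      rw [this, norm_div, hnp, div_eq_mul_one_div]
      have : 1 / (1 - q) ≤ (1 / (1 - q)) ^ 2 := by nlinarith
      calc ‖z' - 1‖ * (1 / (1 - q)) ≤ a * t * (1 / (1 - q)) ^ 2 := by gcongr
        _ ≤ (a + a ^ 2) * t * (1 / (1 - q)) ^ 2 := by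
            gcongr
            nlinarith
        _ = _ := by ring
    -- The right-hand side has no term linear in `z' - 1` apart from `‖z'‖ ^ 2 - 1`, so the excess
    -- is of second order.
    · have e : ‖z' - q‖ ^ 2 = (1 - q) * (‖z'‖ ^ 2 - q) + q * ‖z' - 1‖ ^ 2 := by
        simp only [Complex.sq_norm, Complex.normSq_apply, Complex.sub_re, Complex.sub_im,
          Complex.ofReal_re, Complex.ofReal_im, Complex.one_re, Complex.one_im]
        ring
      have e2 : ‖z' - 1‖ ^ 2 ≤ (a * t) ^ 2 := by gcongr
      rw [norm_div, hnp, div_pow, e, div_le_iff₀ (by positivity)]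
      have e3 : (1 + (a + a ^ 2) * (1 / (1 - q)) ^ 2 * t ^ 2) * (1 - q) ^ 2 =
          (1 - q) ^ 2 + (a + a ^ 2) * t ^ 2 := by field_simp
      rw [e3]
      have e4 : (1 - q) * (‖z'‖ ^ 2 - q) ≤ (1 - q) * (1 + a * t ^ 2 - q) := by gcongr
      have e5 : q * ‖z' - 1‖ ^ 2 ≤ 1 * (a * t) ^ 2 :=
        mul_le_mul h1.le e2 (by positivity) zero_le_one
      have e6 : (1 - q) * (a * t ^ 2) ≤ 1 * (a * t ^ 2) := by
        gcongr
        linarith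
      nlinarith
    · rw [norm_div, norm_one, hnp]
      have : 1 / (1 - q) ≤ (1 / (1 - q)) ^ 2 := by nlinarith
      nlinarith
    · have hq : ∀ i, avgSeq (deletionLaw q) (fun g => ((z' - q) / (1 - q) : ℂ) ^ g) i =
          z' * ((z' - q) / (1 - q)) ^ i := by
        intro i
        rw [avgSeq_deletionLaw, pow_succ]
        field_simp
        ring
      funext g
      simp only [innerOp, factor, blockLaw, headLaw]
      rw [gapOp_smul _ _ _ fun g => ((z' - q) / (1 - q) : ℂ) ^ g]
      beta_reduce
      rw [gapOp_pow hq (avgSeq_pointLaw 0 _ 0)]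
      field_simp
      simp
  | symmetry σ h0 h1 h2 =>
    have hκ := (SyncChannel.symmetry σ h0 h1 h2).factor_ne_zero
    set κ := (SyncChannel.symmetry σ h0 h1 h2).factor with hκd
    refine ⟨a + ‖κ⁻¹‖, by linarith [norm_nonneg κ⁻¹], 1, one_pos, fun t ht0 _ z' hz1 hz2 =>
      ⟨z', κ⁻¹, ?_, ?_, by linarith, ?_⟩⟩
    · nlinarith [norm_nonneg κ⁻¹]
    · nlinarith [norm_nonneg κ⁻¹, sq_nonneg t]
    · funext g
      simp only [innerOp, blockLaw, headLaw, gapOp_pointLaw_one, ← hκd]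
      rw [← mul_assoc, mul_inv_cancel₀ hκ, one_mul]
  | insertion η h0 h1 =>
    have hp : 0 < 1 - η := by linarith
    have hp' : (1 - η : ℂ) ≠ 0 := by
      rw [← Complex.ofReal_one, ← Complex.ofReal_sub, Complex.ofReal_ne_zero]; exact hp.ne'
    have hnp : ‖(1 - η : ℂ)‖ = 1 - η := by
      rw [← Complex.ofReal_one, ← Complex.ofReal_sub, Complex.norm_real,
        Real.norm_of_nonneg hp.le]
    have hip : 1 ≤ 1 / (1 - η) := by rw [le_div_iff₀ hp]; linarith
    set a' := 4 * (a + a ^ 2) * (1 / (1 - η)) with ha'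
    have ha'8 : 4 * (a + a ^ 2) ≤ a' := le_mul_of_one_le_right (by positivity) hip
    have ha'1 : 1 ≤ a' := by nlinarith
    -- The first bound keeps the denominator `w` away from 0, `‖w‖ ≥ 1/2`; the second gives `‖η z‖ <
    -- 1`, so that the geometric series at `z` converges.
    refine ⟨a', ha'1, min (1 / (2 * a)) ((1 - η) / (2 * a')), lt_min (by positivity)
      (by positivity), fun t ht0 htt z' hz1 hz2 => ?_⟩
    have ht1 : a * t ≤ 1 / 2 := by
      have : t ≤ 1 / (2 * a) := htt.trans (min_le_left _ _)
      rw [le_div_iff₀ (by positivity)] at this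
      linarith
    have ht2 : a' * t ≤ (1 - η) / 2 := by
      have : t ≤ (1 - η) / (2 * a') := htt.trans (min_le_right _ _)
      rw [le_div_iff₀ (by positivity)] at this
      linarith
    set w : ℂ := 1 + η * (z' - 1) with hw
    have hwn : 1 / 2 ≤ ‖w‖ := by
      have e1 : ‖(η : ℂ) * (z' - 1)‖ ≤ 1 / 2 := by
        rw [norm_mul, Complex.norm_real, Real.norm_of_nonneg h0]
        nlinarith [norm_nonneg (z' - 1)]
      have e2 : ‖(1 : ℂ)‖ ≤ ‖w‖ + ‖(η : ℂ) * (z' - 1)‖ := by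
        have := norm_sub_le w ((η : ℂ) * (z' - 1))
        rwa [hw, add_sub_cancel_right, ← hw] at this
      rw [norm_one] at e2
      linarith
    have hw0 : w ≠ 0 := by
      intro h
      rw [h, norm_zero] at hwn
      linarith
    have hz1' : ‖z' / w - 1‖ ≤ a' * t := by
      have : z' / w - 1 = (1 - η) * (z' - 1) / w := by
        field_simp
        rw [hw]; ring
      rw [this, norm_div, norm_mul, hnp, div_le_iff₀ (by linarith)]
      have e1 : (1 - η) * ‖z' - 1‖ ≤ 1 * (a * t) :=
        mul_le_mul (by linarith) hz1 (norm_nonneg _) zero_le_one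
      have e2 : a' * t * (1 / 2) ≤ a' * t * ‖w‖ := by gcongr
      nlinarith
    have hηz : ‖(η : ℂ) * (z' / w)‖ < 1 := by
      rw [norm_mul, Complex.norm_real, Real.norm_of_nonneg h0]
      have e1 : ‖z' / w‖ ≤ 1 + (1 - η) / 2 := by
        calc ‖z' / w‖ = ‖1 + (z' / w - 1)‖ := by rw [add_sub_cancel]
          _ ≤ ‖(1 : ℂ)‖ + ‖z' / w - 1‖ := norm_add_le _ _
          _ ≤ _ := by rw [norm_one]; linarith
      nlinarith [norm_nonneg (z' / w)]
    have hden : 1 - η * (z' / w) = (1 - η) / w := by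
      field_simp
      rw [hw]; ring
    refine ⟨z' / w, 1 / w, hz1', ?_, ?_, ?_⟩
    -- The squared modulus of the convex combination `w` of `1` and `z'`; again only second-order
    -- terms enter `‖z'‖ ^ 2 - ‖w‖ ^ 2`.
    · have e1 : ‖w‖ ^ 2 = 1 + η * (‖z'‖ ^ 2 - 1) - η * (1 - η) * ‖z' - 1‖ ^ 2 := by
        rw [hw]
        simp only [Complex.sq_norm, Complex.normSq_apply, Complex.sub_re, Complex.sub_im,
          Complex.add_re, Complex.add_im, Complex.mul_re, Complex.mul_im,
          Complex.ofReal_re, Complex.ofReal_im, Complex.one_re, Complex.one_im]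
        ring
      have e2 : ‖z' - 1‖ ^ 2 ≤ (a * t) ^ 2 := by gcongr
      have e3 : (1 / 2) ^ 2 ≤ ‖w‖ ^ 2 := by gcongr
      rw [norm_div, div_pow, div_le_iff₀ (by nlinarith)]
      have e4 : (1 - η) * (‖z'‖ ^ 2 - 1) ≤ 1 * (a * t ^ 2) := by
        calc (1 - η) * (‖z'‖ ^ 2 - 1) ≤ (1 - η) * (a * t ^ 2) := by gcongr; linarith
          _ ≤ _ := by gcongr; linarith
      have e5 : η * (1 - η) * ‖z' - 1‖ ^ 2 ≤ 1 * (a * t) ^ 2 := by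
        refine mul_le_mul (by nlinarith) e2 (by positivity) zero_le_one
      have e6 : a' * t ^ 2 * (1 / 2) ^ 2 ≤ a' * t ^ 2 * ‖w‖ ^ 2 := by gcongr
      have e7 : 4 * (a + a ^ 2) * t ^ 2 ≤ a' * t ^ 2 := by gcongr
      nlinarith
    · rw [norm_div, norm_one, div_le_iff₀ (by linarith)]
      nlinarith
    · have hφ : (1 - η) * (z' / w) / (1 - η * (z' / w)) = z' := by
        rw [hden]; field_simp
      funext g
      simp only [innerOp, factor, blockLaw, headLaw, one_mul]
      rw [gapOp_smul _ _ _ fun g => (z' / w) ^ g]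
      beta_reduce
      rw [gapOp_pow (avgSeq_insertionLaw_pow hηz) (avgSeq_geomLaw_pow hηz 0), hφ, hden]
      field_simp

theorem exists_pow_preimage (cs : List SyncChannel) :
    ∃ a ≥ 1, ∃ t₀ > 0, ∀ t, 0 ≤ t → t ≤ t₀ → ∀ ζ : ℂ, ‖ζ - 1‖ ≤ t → ‖ζ‖ = 1 →
      ∃ z γ : ℂ, ‖z - 1‖ ≤ a * t ∧ ‖z‖ ^ 2 ≤ 1 + a * t ^ 2 ∧
        ‖γ‖ ≤ a ∧ innerOps cs (fun g => γ * z ^ g) = fun g => ζ ^ g := by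
  induction cs with
  | nil =>
    refine ⟨1, le_rfl, 1, one_pos, fun t ht0 _ ζ h1 h2 => ⟨ζ, 1, by linarith, ?_, by simp, ?_⟩⟩
    · rw [h2]; nlinarith [sq_nonneg t]
    · simp [innerOps]
  | cons c cs ih =>
    obtain ⟨a, ha, t₀, ht₀, h⟩ := ih
    obtain ⟨a', ha', t₁, ht₁, h'⟩ := c.exists_pow_preimage ha
    have haa : a' ≤ a * a' := le_mul_of_one_le_left (by linarith) ha
    refine ⟨a * a', by linarith, min t₀ t₁, lt_min ht₀ ht₁, fun t ht0 ht ζ h1 h2 => ?_⟩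
    obtain ⟨z, γ, hz1, hz2, hγ, he⟩ := h t ht0 (ht.trans (min_le_left _ _)) ζ h1 h2
    obtain ⟨z', γ', hz1', hz2', hγ', he'⟩ := h' t ht0 (ht.trans (min_le_right _ _)) z hz1 hz2
    refine ⟨z', γ * γ', hz1'.trans (by gcongr), hz2'.trans (by gcongr), ?_, ?_⟩
    · rw [norm_mul]
      exact mul_le_mul hγ hγ' (norm_nonneg _) (by linarith)
    · rw [← he, innerOps]
      congr 1
      have : (fun g => γ * γ' * z' ^ g) = fun g => γ * (γ' * z' ^ g) :=
        funext fun g => mul_assoc _ _ _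
      rw [this, c.regularOp_innerOp.smul, he']

end

/-! ### Gap functions of the estimators and stability of position sums. -/

noncomputable section

open scoped ENNReal

/-- The powers of `ζ`, delayed by `e` steps. -/
def tailPow (ζ : ℂ) (e : ℕ) : ℕ → ℂ := fun g => if e ≤ g then ζ ^ (g - e) else 0

theorem norm_tailPow_le {ζ : ℂ} (hζ : ‖ζ‖ ≤ 1) (e g : ℕ) : ‖tailPow ζ e g‖ ≤ 1 := by
  unfold tailPow
  split_ifs
  · rw [norm_pow]; exact pow_le_one₀ (norm_nonneg _) hζ
  · simp

theorem sum_mul_diracSeq (c : ℕ → ℂ) (N g : ℕ) :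
    ∑ j ∈ Finset.range N, c j * diracSeq j g = if g < N then c g else 0 := by
  simp [diracSeq]

theorem SyncChannel.lastOp_one (c : SyncChannel) : c.lastOp (fun _ => 1) = fun _ => 1 := by
  have h1 : ∀ {a : ℕ → ℝ}, LightTailed a → ∀ i, avgSeq a (fun g => (1 : ℂ) ^ g) i = 1 * 1 ^ i := by
    intro a ha i
    simp only [avgSeq, one_pow, mul_one]
    rw [← Complex.ofReal_tsum, ha.hasSum.tsum_eq, Complex.ofReal_one]
  funext g
  have := gapOp_pow (h1 c.lightTailed_blockLaw) (h1 (lightTailed_pointLaw 0) 0) g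
  simp only [one_pow, mul_one] at this
  exact this

theorem lastOps_one (cs : List SyncChannel) : lastOps cs (fun _ => 1) = fun _ => 1 := by
  induction cs with
  | nil => rfl
  | cons c cs ih => rw [lastOps, c.lastOp_one, ih]

/-- The indicator of "at least `e`" is 1 minus the indicators of the `e` smaller values. The
constant 1 is its own preimage, so the cost depends on `e` and not on `n`. -/
theorem exists_last_approx (cs : List SyncChannel) :
    ∃ Q : ℕ, 1 ≤ Q ∧ ∀ (e : ℕ) (θ : ℝ), 0 < θ → θ ≤ 1 → ∃ h : ℕ → ℂ,
      (∀ g, ‖h g‖ ≤ (Q : ℝ) ^ (e + 1) * (1 / θ) ^ Q) ∧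
        ∀ g, ‖lastOps cs h g - tailPow 1 e g‖ ≤ θ := by
  have hT := regularOp_lastOps cs
  obtain ⟨Q, hQ, h⟩ := (approxInvertible_lastOps cs).exists_approx_sum hT
  have hQ' : (1 : ℝ) ≤ Q := by exact_mod_cast hQ
  refine ⟨Q + 1, by omega, fun e θ hθ0 hθ1 => ?_⟩
  obtain ⟨f, hf1, hf2⟩ := h e (Finset.range e) subset_rfl (fun _ => -1) (by simp) θ hθ0 hθ1
  have hiθ : 1 ≤ 1 / θ := by rw [le_div_iff₀ hθ0]; linarith
  refine ⟨fun g => 1 + f g, fun g => ?_, fun g => ?_⟩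
  · calc ‖1 + f g‖ ≤ 1 + (Q : ℝ) ^ (e + 1) * (1 / θ) ^ Q := by
          refine (norm_add_le _ _).trans (add_le_add (by simp) (hf1 g))
      _ ≤ 1 * (1 / θ) ^ Q + (Q : ℝ) ^ (e + 1) * (1 / θ) ^ Q := by
          gcongr
          rw [one_mul]
          exact one_le_pow₀ hiθ
      _ = (1 ^ (e + 1) + (Q : ℝ) ^ (e + 1)) * (1 / θ) ^ Q := by rw [one_pow]; ring
      _ ≤ ((1 + Q : ℝ) ^ (e + 1)) * (1 / θ) ^ (Q + 1) := by
          gcongr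
          · exact pow_add_pow_le (by norm_num) (by positivity) (by omega)
          · omega
      _ = _ := by push_cast; ring
  · rw [hT.add_of_bdd (h := fun _ => 1) (h' := f) (B := 1) (by simp) hf1, lastOps_one]
    refine le_trans (le_of_eq ?_) (hf2 g)
    rw [sum_mul_diracSeq]
    congr 1
    unfold tailPow
    split_ifs
    · omega
    · simp
    · simp; ring
    · omega

/-- For small `α`, the delayed power is `ζ⁻ᵉ ζ^g` minus `e` correction terms at `g < e`; the power
has an exact geometric preimage of ratio at most `1 + a α²`. For larger `α`, all values at `g < n`
are inverted one by one: the cost `Q ^ n` is allowed because `Q ≤ 1 + C α²`, and then `r = 1`. -/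
theorem exists_first_approx (cs : List SyncChannel) {c : ℝ} (hc : 0 < c) :
    ∃ C : ℕ, 1 ≤ C ∧ ∀ α : ℝ, ∃ r : ℝ, 1 ≤ r ∧ r ≤ 1 + c ∧ r ≤ 1 + C * α ^ 2 ∧
      ∀ (n e : ℕ) (θ : ℝ), 0 < θ → θ ≤ 1 → ∃ v : ℕ → ℂ,
        GrowthLe ((C : ℝ) ^ (e + 1) * (1 + C * α ^ 2) ^ n * (1 / θ) ^ C) r v ∧
        ∀ g < n, ‖innerOps cs v g - tailPow (Complex.exp (Complex.I * α)) e g‖ ≤ θ := by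
  have hT := regularOp_innerOps cs
  obtain ⟨Q, hQ, h⟩ := (approxInvertible_innerOps cs).exists_approx_sum hT
  have hQ' : (1 : ℝ) ≤ Q := by exact_mod_cast hQ
  obtain ⟨a, ha, t₀, ht₀, hpre⟩ := exists_pow_preimage cs
  obtain ⟨R, hR, -, hadd⟩ := hT.growth 2 (by norm_num)
  set c' := min c (R - 1) with hc'
  have hc'0 : 0 < c' := lt_min hc (by linarith)
  -- Besides admitting the geometric preimage, `|α| ≤ t₁` forces `a α² ≤ c'`, so the ratio stays
  -- below both `1 + c` and the rate `R` at which the operator is additive.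
  set t₁ := min t₀ (min 1 (c' / a)) with ht₁
  have ht₁0 : 0 < t₁ := lt_min ht₀ (lt_min one_pos (div_pos hc'0 (by linarith)))
  -- The last summand serves frequencies beyond `t₁`: there `C α² ≥ C t₁² ≥ Q`.
  obtain ⟨C, hC⟩ := exists_nat_ge (a + Q + Q / t₁ ^ 2)
  have hQt : 0 ≤ Q / t₁ ^ 2 := by positivity
  have hCa : a ≤ C := by linarith
  have hCaQ : a + Q ≤ C := by linarith
  have hCQ : (Q : ℝ) ≤ C := by linarith
  have hCt : Q / t₁ ^ 2 ≤ C := by linarith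
  have hC1 : (1 : ℝ) ≤ C := by linarith
  have hCQ' : Q ≤ C := by exact_mod_cast hCQ
  refine ⟨C, by exact_mod_cast hC1, fun α => ?_⟩
  set ζ := Complex.exp (Complex.I * α) with hζ
  have hζ1 : ‖ζ‖ = 1 := by rw [hζ, mul_comm, Complex.norm_exp_ofReal_mul_I]
  have hζ0 : ζ ≠ 0 := Complex.exp_ne_zero _
  by_cases hα : |α| ≤ t₁
  · have hζd : ‖ζ - 1‖ ≤ |α| := by
      simpa [hζ] using Real.norm_exp_I_mul_ofReal_sub_one_le (x := α)
    obtain ⟨z, γ, -, hz2, hγ, he⟩ :=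
      hpre |α| (abs_nonneg _) (hα.trans (min_le_left _ _)) ζ hζd hζ1
    rw [sq_abs] at hz2
    have haα : a * α ^ 2 ≤ c' := by
      have h1 : |α| ≤ 1 := hα.trans ((min_le_right _ _).trans (min_le_left _ _))
      have h2 : |α| ≤ c' / a := hα.trans ((min_le_right _ _).trans (min_le_right _ _))
      rw [le_div_iff₀ (by linarith)] at h2
      rw [← sq_abs]
      nlinarith [abs_nonneg α]
    set r := 1 + a * α ^ 2 with hr
    have haα0 : 0 ≤ a * α ^ 2 := by positivity
    have hzr : ‖z‖ ≤ r := by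
      refine le_of_sq_le_sq ?_ (by linarith)
      nlinarith
    have hcc : c' ≤ c := min_le_left _ _
    have hcR : c' ≤ R - 1 := min_le_right _ _
    refine ⟨r, by linarith, by linarith, ?_, fun n e θ hθ0 hθ1 => ?_⟩
    · rw [hr]; gcongr
    obtain ⟨f, hf1, hf2⟩ := h e (Finset.range e) subset_rfl (fun j => -(ζ⁻¹ ^ e * ζ ^ j))
      (by simp [hζ1]) θ hθ0 hθ1
    have hiθ : 1 ≤ 1 / θ := by rw [le_div_iff₀ hθ0]; linarith
    have hgp : GrowthLe a r fun g => ζ⁻¹ ^ e * (γ * z ^ g) := by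
      intro g
      rw [norm_mul, norm_mul, norm_pow, norm_pow, norm_inv, hζ1]
      simp only [inv_one, one_pow, one_mul]
      gcongr
    have hgf : GrowthLe ((Q : ℝ) ^ (e + 1) * (1 / θ) ^ Q) r f :=
      growthLe_of_norm_le (by linarith) hf1
    refine ⟨fun g => ζ⁻¹ ^ e * (γ * z ^ g) + f g, ?_, fun g _ => ?_⟩
    · refine (hgp.add hgf).mono ?_ (by linarith) le_rfl
      have h1 : 1 ≤ (1 + (C : ℝ) * α ^ 2) ^ n :=
        one_le_pow₀ (le_add_of_nonneg_right (by positivity))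
      calc a + (Q : ℝ) ^ (e + 1) * (1 / θ) ^ Q
          ≤ a ^ (e + 1) * (1 / θ) ^ C + (Q : ℝ) ^ (e + 1) * (1 / θ) ^ C := by
            gcongr
            · exact (le_self_pow₀ ha (by omega)).trans
                (le_mul_of_one_le_right (by positivity) (one_le_pow₀ hiθ))
        _ = (a ^ (e + 1) + (Q : ℝ) ^ (e + 1)) * (1 / θ) ^ C := by ring
        _ ≤ (a + Q) ^ (e + 1) * (1 / θ) ^ C := by
            gcongr
            exact pow_add_pow_le (by linarith) (by positivity) (by omega)
        _ ≤ (C : ℝ) ^ (e + 1) * (1 + C * α ^ 2) ^ n * (1 / θ) ^ C := by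
            gcongr
            calc (a + Q) ^ (e + 1) ≤ (C : ℝ) ^ (e + 1) * 1 := by rw [mul_one]; gcongr
              _ ≤ _ := by gcongr
    · have hsplit := hadd _ _ _ _ (hgp.mono le_rfl (by linarith) (by linarith : r ≤ R))
        (hgf.mono le_rfl (by linarith) (by linarith : r ≤ R))
      rw [hsplit]
      have hsm := congrFun (hT.smul (ζ⁻¹ ^ e) fun g => γ * z ^ g) g
      beta_reduce at hsm ⊢
      rw [hsm, he]
      beta_reduce
      refine le_trans (le_of_eq ?_) (hf2 g)
      rw [sum_mul_diracSeq]
      congr 1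
      unfold tailPow
      split_ifs
      · omega
      · have hpw : ζ ^ g = ζ ^ e * ζ ^ (g - e) := by rw [← pow_add]; congr 1; omega
        rw [hpw, ← mul_assoc, ← mul_pow, inv_mul_cancel₀ hζ0]
        ring
      · ring
      · omega
  · have hα' : t₁ < |α| := not_le.1 hα
    refine ⟨1, le_rfl, by linarith, by nlinarith [sq_nonneg α], fun n e θ hθ0 hθ1 => ?_⟩
    obtain ⟨f, hf1, hf2⟩ := h n (Finset.range n) subset_rfl (tailPow ζ e)
      (norm_tailPow_le hζ1.le e) θ hθ0 hθ1
    have hiθ : 1 ≤ 1 / θ := by rw [le_div_iff₀ hθ0]; linarith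
    refine ⟨f, growthLe_of_norm_le le_rfl fun g => (hf1 g).trans ?_, fun g hg => ?_⟩
    · have hQα : (Q : ℝ) ≤ 1 + C * α ^ 2 := by
        rw [div_le_iff₀ (by positivity)] at hCt
        have : t₁ ^ 2 ≤ α ^ 2 := by
          rw [← sq_abs α]; gcongr
        nlinarith
      calc (Q : ℝ) ^ (n + 1) * (1 / θ) ^ Q ≤ (1 + C * α ^ 2) ^ n * C * (1 / θ) ^ C := by
            rw [pow_succ]
            exact mul_le_mul (mul_le_mul (pow_le_pow_left₀ (by positivity) hQα n) hCQ
              (by positivity) (by positivity)) (pow_le_pow_right₀ hiθ hCQ') (by positivity)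
              (by positivity)
        _ ≤ (1 + C * α ^ 2) ^ n * (C : ℝ) ^ (e + 1) * (1 / θ) ^ C := by
            gcongr
            exact le_self_pow₀ hC1 (by omega)
        _ = _ := by ring
    · have := hf2 g
      rwa [sum_mul_diracSeq, if_pos hg] at this

/-- Each function before the last one is summable with sum at most `q`, so summing over its gap
costs `q` whatever the length of the string. -/
theorem norm_walshSum_append_le {s : Bool → ℂ} (hs : ∀ b, ‖s b‖ ≤ 1) {q B : ℝ} (hB : 0 ≤ B)
    (hq : 0 ≤ q) {k : List (ℕ → ℂ)} {l : ℕ → ℂ} (hl : ∀ g, ‖l g‖ ≤ B)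
    (hk : ∀ h ∈ k, ∀ N, ∑ g ∈ Finset.range N, ‖h g‖ ≤ q) (x : List Bool) :
    ‖walshSum s (prodFun (k ++ [l])) x‖ ≤ q ^ k.length * B := by
  induction k generalizing x with
  | nil => simpa [walshSum_prodFun_singleton] using hl _
  | cons h k ih =>
    refine (norm_walshSum_prodFun_cons_le hs h (by simp)
      (ih fun h' hh' => hk h' (by simp [hh'])) x).trans ?_
    rw [List.length_cons, pow_succ, mul_right_comm]
    exact mul_le_mul_of_nonneg_right
      (mul_le_mul_of_nonneg_left (hk h (by simp) _) (by positivity)) hB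

theorem prodFun_replicate_pow (ρ : ℂ) : ∀ (m : ℕ) (g : List ℕ),
    prodFun (List.replicate m fun i => ρ ^ i) g = if g.length = m then ρ ^ g.sum else 0
  | 0, [] => by simp [prodFun]
  | 0, _ :: _ => by simp [prodFun]
  | m + 1, [] => by simp [List.replicate_succ, prodFun]
  | m + 1, a :: g => by
    rw [List.replicate_succ, prodFun_cons_cons, prodFun_replicate_pow ρ m g]
    simp only [List.length_cons, Nat.add_right_cancel_iff, List.sum_cons]
    split_ifs
    · rw [pow_add]
    · rw [mul_zero]

/-- Stability of position sums under perturbations of the weights. -/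
theorem norm_sum_walshSum_sub_le {ι : Type} [Fintype ι] {s : Bool → ℂ} (hs : ∀ b, ‖s b‖ ≤ 1)
    {c : ι → ℂ} {k : ι → List (ℕ → ℂ)} {m : List ℕ} {v v' l l' : ℕ → ℂ} {θ ρ : ℝ} {n K : ℕ}
    (hθ0 : 0 ≤ θ) (hθ1 : θ ≤ 1) (hρ0 : 0 < ρ) (hρ1 : ρ < 1)
    (hk : ∀ i, (k i).length = m.length) (hm : m.sum + m.length ≤ K)
    (hv : ∀ g, ‖v g‖ ≤ 1) (hv' : ∀ g < n, ‖v' g - v g‖ ≤ θ)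
    (hl : ∀ g, ‖l g‖ ≤ 1) (hl' : ∀ g, ‖l' g - l g‖ ≤ θ)
    (hc : ∀ g, ‖∑ i, c i * prodFun (k i) g - (if g = m then 1 else 0)‖ ≤ θ * ρ ^ g.sum)
    {x : List Bool} (hx : x.length = n) :
    ‖∑ i, c i * walshSum s (prodFun (v' :: (k i ++ [l']))) x -
      walshSum s (prodFun (v :: (m.map diracSeq ++ [l]))) x‖ ≤
        7 * θ * n * (1 / (ρ * (1 - ρ))) ^ K := by
  -- The first gap is shorter than the string, so the uncontrolled values of `v'` at `g ≥ n` may be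
  -- replaced.
  set v'' : ℕ → ℂ := fun g => if g < n then v' g else v g with hv''
  have hvv : ∀ i, walshSum s (prodFun (v' :: (k i ++ [l']))) x =
      walshSum s (prodFun (v'' :: (k i ++ [l']))) x := fun i =>
    walshSum_prodFun_congr (by simp) fun g hg => by simp [hv'', hx ▸ hg]
  have hvd : ∀ g, ‖v'' g - v g‖ ≤ θ := by
    intro g
    simp only [hv'']
    split_ifs with h
    · exact hv' g h
    · simpa using hθ0
  simp only [hvv]
  set H : List ℕ → ℂ := fun g => ∑ i, c i * prodFun (v'' :: (k i ++ [l'])) g +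
    (-1) * prodFun (v :: (m.map diracSeq ++ [l])) g with hH
  have hHs : ∑ i, c i * walshSum s (prodFun (v'' :: (k i ++ [l']))) x -
      walshSum s (prodFun (v :: (m.map diracSeq ++ [l]))) x = walshSum s H x := by
    rw [hH, walshSum_add, walshSum_finset_sum, walshSum_const_mul]
    simp only [walshSum_const_mul]
    ring
  rw [hHs]
  -- The error is dominated by a product that decays in the middle gaps. The factor `(1 / ρ) ^ K`
  -- lets `ρ ^ sum` dominate the indicator of the list `m` as well; `7 = 4 + 2 + 1` comes from the
  -- three differences below.
  set D : ℝ := 7 * θ * (1 / ρ) ^ K with hD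
  have hD0 : 0 ≤ D := by positivity
  set b : List (ℕ → ℂ) :=
    (fun _ => (D : ℂ)) :: (List.replicate m.length (fun i => (ρ : ℂ) ^ i) ++ [fun _ => 1]) with hb
  have hle : ∀ g, ‖H g‖ ≤ (prodFun b g).re := by
    intro g
    by_cases hg : g.length = m.length + 2
    swap
    · have h1 : ∀ i, prodFun (v'' :: (k i ++ [l'])) g = 0 := fun i =>
        prodFun_eq_zero _ _ (by simp [hk]; omega)
      have h2 : prodFun (v :: (m.map diracSeq ++ [l])) g = 0 :=
        prodFun_eq_zero _ _ (by simp; omega)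
      have h3 : prodFun b g = 0 := prodFun_eq_zero _ _ (by simp [hb]; omega)
      simp [hH, h1, h2, h3]
    · obtain ⟨g0, g1, rfl⟩ := List.exists_cons_of_ne_nil
        (List.ne_nil_of_length_pos (l := g) (by omega))
      have hg1 : g1 ≠ [] := List.ne_nil_of_length_pos (by simp at hg; omega)
      obtain ⟨g2, gl, rfl⟩ : ∃ g2 gl, g1 = g2 ++ [gl] :=
        ⟨g1.dropLast, g1.getLast hg1, (List.dropLast_append_getLast hg1).symm⟩
      have hg2 : g2.length = m.length := by simp at hg; omega
      simp only [hH, hb, prodFun_cons_cons, prodFun_append_singleton, prodFun_map_dirac,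
        prodFun_replicate_pow, hg2, if_true, mul_one]
      set M := ∑ i, c i * prodFun (k i) g2 with hM
      set d : ℂ := if g2 = m then 1 else 0 with hd
      have hMd : ‖M - d‖ ≤ θ * ρ ^ g2.sum := hc g2
      set P := (1 / ρ) ^ K * ρ ^ g2.sum with hP
      have hiρ : 1 ≤ (1 / ρ) ^ K := one_le_pow₀ (one_le_one_div hρ0 hρ1.le)
      have hρP : ρ ^ g2.sum ≤ P := le_mul_of_one_le_left (by positivity) hiρ
      have hP0 : 0 ≤ P := by positivity
      have hdP : ‖d‖ ≤ P := by
        rw [hd]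
        split_ifs with h
        · rw [norm_one, hP, h, one_div, inv_pow, ← div_eq_inv_mul,
            le_div_iff₀ (by positivity), one_mul]
          exact pow_le_pow_of_le_one hρ0.le hρ1.le (by omega)
        · simpa using hP0
      have hMP : ‖M‖ ≤ 2 * P := by
        calc ‖M‖ = ‖(M - d) + d‖ := by rw [sub_add_cancel]
          _ ≤ ‖M - d‖ + ‖d‖ := norm_add_le _ _
          _ ≤ 1 * P + P := by
            gcongr
            exact hMd.trans (mul_le_mul hθ1 hρP (by positivity) zero_le_one)
          _ = 2 * P := by ring
      have hl2 : ‖l' gl‖ ≤ 2 := by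
        calc ‖l' gl‖ = ‖(l' gl - l gl) + l gl‖ := by rw [sub_add_cancel]
          _ ≤ θ + 1 := (norm_add_le _ _).trans (add_le_add (hl' gl) (hl gl))
          _ ≤ 2 := by linarith
      have hsum : ∑ i, c i * (v'' g0 * (prodFun (k i) g2 * l' gl)) = v'' g0 * M * l' gl := by
        rw [hM, Finset.mul_sum, Finset.sum_mul]
        exact Finset.sum_congr rfl fun i _ => by ring
      rw [hsum]
      have hre : ((D : ℂ) * (ρ : ℂ) ^ g2.sum).re = 7 * θ * P := by
        rw [← Complex.ofReal_pow, ← Complex.ofReal_mul, Complex.ofReal_re, hD, hP]; ring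
      rw [hre]
      calc ‖v'' g0 * M * l' gl + -1 * (v g0 * (d * l gl))‖
          -- The first, middle and last factors are exchanged one at a time.
          = ‖(v'' g0 - v g0) * M * l' gl + v g0 * (M - d) * l' gl +
              v g0 * d * (l' gl - l gl)‖ := by congr 1; ring
        _ ≤ θ * (2 * P) * 2 + 1 * (θ * P) * 2 + 1 * P * θ := by
          refine (norm_add₃_le).trans ?_
          simp only [norm_mul]
          have h1 := hvd g0
          have h2 := hv g0
          have h3 := hl' gl
          have h4 : ‖M - d‖ ≤ θ * P := hMd.trans (by gcongr)
          gcongr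
        _ = 7 * θ * P := by ring
  refine (norm_walshSum_le hs hle x).trans ((Complex.re_le_norm _).trans ?_)
  have hq : 0 ≤ 1 / (1 - ρ) := one_div_nonneg.2 (by linarith)
  have hmid := norm_walshSum_append_le (s := fun _ => 1) (by simp) (q := 1 / (1 - ρ)) (B := 1)
    zero_le_one hq (k := List.replicate m.length (fun i => (ρ : ℂ) ^ i)) (l := fun _ => 1)
    (by simp) (by
      intro h hh N
      rw [List.eq_of_mem_replicate hh]
      simp only [norm_pow, Complex.norm_real, Real.norm_of_nonneg hρ0.le]
      rw [one_div, ← tsum_geometric_of_lt_one hρ0.le hρ1]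
      exact (summable_geometric_of_lt_one hρ0.le hρ1).sum_le_tsum _ fun i _ =>
        pow_nonneg hρ0.le i)
  refine (norm_walshSum_prodFun_cons_le (by simp) _ (by simp) hmid x).trans ?_
  simp only [List.length_replicate, mul_one, Complex.norm_real, Real.norm_of_nonneg hD0,
    Finset.sum_const, Finset.card_range, nsmul_eq_mul, hx]
  have h1 : (1 / (1 - ρ)) ^ m.length ≤ (1 / (1 - ρ)) ^ K :=
    pow_le_pow_right₀ (one_le_one_div (by linarith) (by linarith)) (by omega)
  calc (1 / (1 - ρ)) ^ m.length * (n * D) ≤ (1 / (1 - ρ)) ^ K * (n * D) := by gcongr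
    _ = 7 * θ * n * ((1 / ρ) ^ K * (1 / (1 - ρ)) ^ K) := by rw [hD]; ring
    _ = _ := by rw [← mul_pow, one_div_mul_one_div]

end

noncomputable section

open scoped ENNReal

/-! ### Estimators of position sums -/

/-- The list of the functions of the gaps of a pattern of positions that starts at the beginning
of a string and fits into it. -/
def patternFuns : List ℕ → List (ℕ → ℂ)
  | [] => []
  | [e] => [tailPow 1 e]
  | e :: e' :: l => diracSeq e :: patternFuns (e' :: l)

theorem patternFuns_cons (e : ℕ) {l : List ℕ} (hl : l ≠ []) :
    patternFuns (e :: l) = diracSeq e :: patternFuns l := by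
  obtain ⟨a, k, rfl⟩ := List.exists_cons_of_ne_nil hl
  rfl

theorem patternFuns_append_singleton (l : List ℕ) (e : ℕ) :
    patternFuns (l ++ [e]) = l.map diracSeq ++ [tailPow 1 e] := by
  induction l with
  | nil => rfl
  | cons a l ih => rw [List.cons_append, patternFuns_cons _ (by simp), ih]; rfl

theorem patternFuns_ne_nil {l : List ℕ} (hl : l ≠ []) : patternFuns l ≠ [] := by
  match l with
  | [] => exact absurd rfl hl
  | [e] => simp [patternFuns]
  | e :: e' :: l => simp [patternFuns]

/-- The bound for the estimators of position sums. -/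
def estimatorBound (C n k : ℕ) (α ε : ℝ) : ℝ :=
  (C : ℝ) ^ (k + 1) * (n + 1) ^ C * (1 + C * α ^ 2) ^ n * (1 / ε) ^ C

/-- The estimator is a position sum of the trace, with the approximate preimages at the first,
middle and last gaps. The middle functions used are point indicators, so only the growth of the
first one depends on the trace length; hence the geometric sum in the bound. The bias comes from the
stability estimate. -/
theorem exists_pattern_estimator (cs : List SyncChannel) {c : ℝ} (hc : 0 < c) :
    ∃ C : ℕ, 1 ≤ C ∧ ∀ α : ℝ, ∃ r : ℝ, 1 ≤ r ∧ r ≤ 1 + c ∧ r ≤ 1 + C * α ^ 2 ∧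
      ∀ (n k : ℕ) (ε : ℝ), 0 < ε → ε ≤ 1 → ∀ (e : ℕ) (l : List ℕ), l ≠ [] →
        e + l.sum + l.length ≤ k → ∃ f : List Bool → ℂ,
          (∀ y, ‖f y‖ ≤ estimatorBound C n k α ε * ∑ i ∈ Finset.range y.length, r ^ i) ∧
          ∀ x : List Bool, x.length = n →
            posExpectation (compositeTrace cs x) (fun y => ‖f y‖ₑ) ≠ ∞ ∧
            ‖expectation (compositeTrace cs x) f - walshSum bitSign
              (prodFun (tailPow (Complex.exp (Complex.I * α)) e :: patternFuns l)) x‖ ≤ ε := by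
  obtain ⟨R, hR, hE⟩ := exists_expectation_compositeTrace cs
  obtain ⟨C₁, hC₁, hfirst⟩ := exists_first_approx cs (c := min c (R - 1))
    (lt_min hc (by linarith))
  obtain ⟨Q, hQ, hlast⟩ := exists_last_approx cs
  obtain ⟨A, ρ, hA, hρ0, hρ1, hmid⟩ := approxInvertible_innerOps cs 1 le_rfl
  have hρ' : 0 < ρ * (1 - ρ) := mul_pos hρ0 (by linarith)
  obtain ⟨M, hM⟩ := exists_nat_ge (1 / (ρ * (1 - ρ)))
  have hM1 : (1 : ℝ) ≤ M := by
    refine le_trans ?_ hM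
    rw [le_div_iff₀ hρ']
    nlinarith
  have hA' : (1 : ℝ) ≤ A := by exact_mod_cast hA
  have hQ' : (1 : ℝ) ≤ Q := by exact_mod_cast hQ
  have hC₁' : (1 : ℝ) ≤ C₁ := by exact_mod_cast hC₁
  set S := A + Q + C₁ with hS
  set C := A * Q * C₁ * 8 ^ S * M ^ S + S + C₁ with hC
  have hC₁C : C₁ ≤ C := by omega
  have hSC : S ≤ C := by omega
  have hC₁C' : (C₁ : ℝ) ≤ C := by exact_mod_cast hC₁C
  refine ⟨C, by omega, fun α => ?_⟩
  obtain ⟨r, hr1, hrc, hrα, hv⟩ := hfirst α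
  refine ⟨r, hr1, hrc.trans (by gcongr; exact min_le_left _ _), hrα.trans (by gcongr),
    fun n k ε hε0 hε1 e l hl hk => ?_⟩
  have hrR : r ≤ R := by
    have : min c (R - 1) ≤ R - 1 := min_le_right _ _
    linarith
  obtain ⟨m, em, rfl⟩ : ∃ m em, l = m ++ [em] :=
    ⟨l.dropLast, l.getLast hl, (List.dropLast_append_getLast hl).symm⟩
  simp only [List.sum_append, List.length_append, List.sum_singleton, List.length_singleton] at hk
  rw [patternFuns_append_singleton]
  -- Makes the stability error `7 θ n (1 / (ρ (1 - ρ))) ^ k` smaller than `ε`; since `1 / θ` enters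
  -- polynomially, this costs only `e^{O(k)} poly(n)`.
  set θ : ℝ := ε / (8 * (n + 1) * (1 / (ρ * (1 - ρ))) ^ k) with hθ
  have hden : 1 ≤ 8 * ((n : ℝ) + 1) * (1 / (ρ * (1 - ρ))) ^ k := by
    have h1 : 1 ≤ (1 / (ρ * (1 - ρ))) ^ k := by
      refine one_le_pow₀ ?_
      rw [le_div_iff₀ hρ']
      nlinarith
    have h2 : (0 : ℝ) ≤ n := Nat.cast_nonneg n
    nlinarith
  have hθ0 : 0 < θ := div_pos hε0 (by linarith)
  have hθ1 : θ ≤ 1 := (div_le_one (by linarith)).2 (by linarith)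
  have hiθ : 1 ≤ 1 / θ := by rw [le_div_iff₀ hθ0]; linarith
  obtain ⟨v, hvg, hva⟩ := hv n e θ hθ0 hθ1
  obtain ⟨h, hhb, hha⟩ := hlast em θ hθ0 hθ1
  obtain ⟨ι, _, d, j, hj, hdn, hda⟩ := hmid m θ hθ0 hθ1
  set Bv := (C₁ : ℝ) ^ (e + 1) * (1 + C₁ * α ^ 2) ^ n * (1 / θ) ^ C₁ with hBv
  set Bl := (Q : ℝ) ^ (em + 1) * (1 / θ) ^ Q with hBl
  have hBl0 : 0 ≤ Bl := by positivity
  have hBv0 : 0 ≤ Bv := by positivity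
  set hs : ι → List (ℕ → ℂ) := fun i => v :: ((j i).map diracSeq ++ [h]) with hhs
  refine ⟨fun y => ∑ i, d i * walshSum bitSign (prodFun (hs i)) y, fun y => ?_, fun x hx => ?_⟩
  · have hterm : ∀ i, ‖d i * walshSum bitSign (prodFun (hs i)) y‖ ≤
        1 ^ (j i).sum * ‖d i‖ * (Bl * (Bv * ∑ i ∈ Finset.range y.length, r ^ i)) := by
      intro i
      rw [norm_mul, one_pow, one_mul]
      refine mul_le_mul_of_nonneg_left ?_ (norm_nonneg _)
      have h1 := norm_walshSum_append_le norm_bitSign (q := 1) hBl0 zero_le_one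
        (k := (j i).map diracSeq) hhb (by
          intro h' hh' N
          obtain ⟨a, -, rfl⟩ := List.mem_map.1 hh'
          have : ∀ g, ‖diracSeq a g‖ = if g = a then 1 else 0 := by
            intro g
            unfold diracSeq
            split_ifs <;> simp
          simp only [this, Finset.sum_ite_eq']
          split_ifs <;> norm_num)
      rw [one_pow, one_mul] at h1
      refine (norm_walshSum_prodFun_cons_le norm_bitSign v (by simp) h1 y).trans ?_
      rw [Finset.mul_sum _ _ Bv]
      gcongr with g
      exact hvg g
    refine (norm_sum_le _ _).trans ((Finset.sum_le_sum fun i _ => hterm i).trans ?_)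
    rw [← Finset.sum_mul, ← mul_assoc, ← mul_assoc]
    have hS0 : 0 ≤ ∑ i ∈ Finset.range y.length, r ^ i :=
      Finset.sum_nonneg fun i _ => pow_nonneg (by linarith) i
    refine mul_le_mul_of_nonneg_right ?_ hS0
    have e1 : 1 / θ ≤ 8 * (n + 1) * (1 / ε) * M ^ (k + 1) := by
      have : 1 / θ = 8 * (n + 1) * (1 / ε) * (1 / (ρ * (1 - ρ))) ^ k := by
        rw [hθ]; field_simp
      rw [this]
      gcongr
      calc (1 / (ρ * (1 - ρ))) ^ k ≤ (M : ℝ) ^ k := by gcongr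
        _ ≤ _ := pow_le_pow_right₀ hM1 (by omega)
    have e2 : (A : ℝ) ^ (m.sum + m.length + 1) ≤ (A : ℝ) ^ (k + 1) :=
      pow_le_pow_right₀ hA' (by omega)
    have e3 : (Q : ℝ) ^ (em + 1) ≤ (Q : ℝ) ^ (k + 1) := pow_le_pow_right₀ hQ' (by omega)
    have e4 : (C₁ : ℝ) ^ (e + 1) ≤ (C₁ : ℝ) ^ (k + 1) := pow_le_pow_right₀ hC₁' (by omega)
    have hiε : 1 ≤ 1 / ε := by rw [le_div_iff₀ hε0]; linarith
    have e5 : (8 : ℝ) ^ S ≤ (8 ^ S) ^ (k + 1) := le_self_pow₀ (one_le_pow₀ (by norm_num)) (by omega)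
    have e6 : (8 * (n + 1) * (1 / ε) * (M : ℝ) ^ (k + 1)) ^ S =
        8 ^ S * (n + 1) ^ S * (1 / ε) ^ S * (M ^ S) ^ (k + 1) := by
      rw [mul_pow, mul_pow, mul_pow, ← pow_mul, ← pow_mul, mul_comm (k + 1) S]
    have hn1 : (1 : ℝ) ≤ n + 1 := by
      have : (0 : ℝ) ≤ n := Nat.cast_nonneg n
      linarith
    calc (∑ i, 1 ^ (j i).sum * ‖d i‖) * Bl * Bv
        ≤ ((A : ℝ) ^ (m.sum + m.length + 1) * (1 / θ) ^ A) * Bl * Bv := by gcongr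
      _ ≤ ((A : ℝ) ^ (k + 1) * (1 / θ) ^ A) * ((Q : ℝ) ^ (k + 1) * (1 / θ) ^ Q) *
          ((C₁ : ℝ) ^ (k + 1) * (1 + C₁ * α ^ 2) ^ n * (1 / θ) ^ C₁) := by
          rw [hBl, hBv]
          gcongr
      _ = (A * Q * C₁ : ℝ) ^ (k + 1) * (1 + C₁ * α ^ 2) ^ n * (1 / θ) ^ S := by
          rw [hS, pow_add, pow_add, mul_pow, mul_pow]; ring
      _ ≤ (A * Q * C₁ : ℝ) ^ (k + 1) * (1 + C₁ * α ^ 2) ^ n *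
          (8 * (n + 1) * (1 / ε) * M ^ (k + 1)) ^ S := by gcongr
      _ = (A * Q * C₁ : ℝ) ^ (k + 1) * (1 + C₁ * α ^ 2) ^ n *
          (8 ^ S * (n + 1) ^ S * (1 / ε) ^ S * (M ^ S) ^ (k + 1)) := by
          rw [e6]
      _ ≤ (A * Q * C₁ : ℝ) ^ (k + 1) * (1 + C * α ^ 2) ^ n *
          ((8 ^ S) ^ (k + 1) * (n + 1) ^ C * (1 / ε) ^ C * (M ^ S) ^ (k + 1)) := by
          gcongr
      _ = (A * Q * C₁ * 8 ^ S * M ^ S : ℝ) ^ (k + 1) * (n + 1) ^ C * (1 + C * α ^ 2) ^ n *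
          (1 / ε) ^ C := by
          rw [mul_pow _ ((M : ℝ) ^ S), mul_pow _ ((8 : ℝ) ^ S)]; ring
      _ ≤ estimatorBound C n k α ε := by
          unfold estimatorBound
          gcongr
          rw [hC]
          push_cast
          have : (0 : ℝ) ≤ (A : ℝ) + Q + C₁ + C₁ := by positivity
          linarith
  · have hgrow : ∀ i, ∀ h' ∈ hs i, ∃ B, GrowthLe B R h' := by
      intro i h' hh'
      simp only [hhs, List.mem_cons, List.mem_append, List.mem_map, List.not_mem_nil,
        or_false] at hh'
      rcases hh' with rfl | ⟨a, -, rfl⟩ | rfl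
      · exact ⟨_, hvg.mono le_rfl (by linarith) hrR⟩
      · exact ⟨_, growthLe_of_norm_le hR.le (norm_diracSeq_le a)⟩
      · exact ⟨_, growthLe_of_norm_le hR.le hhb⟩
    have hfin : ∀ i, posExpectation (compositeTrace cs x)
        (fun y => ‖d i * walshSum bitSign (prodFun (hs i)) y‖ₑ) ≠ ∞ := by
      intro i
      simp only [enorm_mul]
      rw [posExpectation_const_mul]
      exact ENNReal.mul_ne_top enorm_ne_top (hE (hs i) (hgrow i) x).1
    constructor
    · refine ne_top_of_le_ne_top (b := ∑ i, posExpectation (compositeTrace cs x)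
        (fun y => ‖d i * walshSum bitSign (prodFun (hs i)) y‖ₑ))
        (ENNReal.sum_ne_top.2 fun i _ => hfin i) ?_
      unfold posExpectation
      rw [← Summable.tsum_finsetSum fun _ _ => ENNReal.summable]
      refine ENNReal.tsum_le_tsum fun y => ?_
      rw [← Finset.mul_sum]
      exact mul_le_mul_right (enorm_sum_le _ _) _
    · rw [expectation_finset_sum _ fun i _ => hfin i]
      simp only [expectation_const_mul]
      have hval : ∀ i, expectation (compositeTrace cs x) (walshSum bitSign (prodFun (hs i))) =
          walshSum bitSign (prodFun (innerOps cs v ::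
            ((j i).map (fun d => innerOps cs (diracSeq d)) ++ [lastOps cs h]))) x := by
        intro i
        rw [(hE (hs i) (hgrow i) x).2, hhs, mapOps_cons _ (by simp), mapOps_append_singleton,
          List.map_map]
        rfl
      have hexp : ∀ i, expectation (compositeTrace cs x)
          (fun y => walshSum bitSign (prodFun (hs i)) y) = _ := hval
      simp only [hexp]
      have hζ1 : ‖Complex.exp (Complex.I * α)‖ ≤ 1 := by
        rw [mul_comm, Complex.norm_exp_ofReal_mul_I]
      refine (norm_sum_walshSum_sub_le norm_bitSign hθ0.le hθ1 hρ0 hρ1 (n := n) (K := k)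
        (fun i => by rw [List.length_map, hj]) (by omega) (norm_tailPow_le hζ1 e) hva
        (norm_tailPow_le (by simp) em) hha hda hx).trans ?_
      have : 7 * θ * n * (1 / (ρ * (1 - ρ))) ^ k = ε * (7 * n / (8 * (n + 1))) := by
        rw [hθ]
        field_simp
      rw [this]
      refine mul_le_of_le_one_right hε0.le ?_
      rw [div_le_one (by positivity)]
      have : (0 : ℝ) ≤ n := Nat.cast_nonneg n
      linarith

/-! ### Occurrences of a marker -/

theorem walshSum_patternFuns_bump (e : ℕ) (l : List ℕ) (b : Bool) (x : List Bool) :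
    walshSum bitSign (prodFun (patternFuns ((e + 1) :: l))) (b :: x) =
      walshSum bitSign (prodFun (patternFuns (e :: l))) x := by
  cases l with
  | nil =>
    simp [patternFuns, walshSum_prodFun_singleton, tailPow]
  | cons a l =>
    rw [patternFuns_cons (e + 1) (List.cons_ne_nil a l),
      patternFuns_cons e (List.cons_ne_nil a l), walshSum_prodFun_cons]
    have h1 : shiftSeq (diracSeq (e + 1)) = diracSeq e := by
      funext g; simp [shiftSeq, diracSeq]
    rw [h1]
    simp [diracSeq]

theorem walshSum_patternFuns_bump_nil (e : ℕ) (l : List ℕ) :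
    walshSum bitSign (prodFun (patternFuns ((e + 1) :: l))) [] = 0 := by
  cases l with
  | nil => simp [patternFuns, walshSum_prodFun_singleton, tailPow]
  | cons a l =>
    rw [patternFuns_cons _ (by simp)]
    simp [walshSum, prodFun_cons_cons, diracSeq]

theorem walshSum_patternFuns_zero {l : List ℕ} (hl : l ≠ []) (b : Bool) (x : List Bool) :
    walshSum bitSign (prodFun (patternFuns (0 :: l))) (b :: x) =
      bitSign b * walshSum bitSign (prodFun (patternFuns l)) x := by
  rw [patternFuns_cons _ hl, walshSum_prodFun_cons]
  have h1 : shiftSeq (diracSeq 0) = fun g => 0 * diracSeq 0 g := by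
    funext g; simp [shiftSeq, diracSeq]
  rw [h1, walshSum_prodFun_smul]
  simp [diracSeq]

theorem walshSum_patternFuns_zero_nil {l : List ℕ} (hl : l ≠ []) :
    walshSum bitSign (prodFun (patternFuns (0 :: l))) [] = 0 := by
  rw [patternFuns_cons _ hl]
  obtain ⟨a, k, hak⟩ := List.exists_cons_of_ne_nil (patternFuns_ne_nil hl)
  rw [hak]
  simp [walshSum, prodFun_cons_cons, prodFun_cons_nil]

/-- The indicator of a prefix is a combination of position sums. -/
theorem exists_prefix_expansion (w : List Bool) :
    ∃ (ι : Type) (_ : Fintype ι) (c : ι → ℂ) (e : ι → ℕ) (l : ι → List ℕ),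
      ∑ i, ‖c i‖ ≤ 1 ∧ (∀ i, e i + (l i).sum + (l i).length ≤ w.length) ∧
      ∀ x : List Bool, (if x.take w.length = w then (1 : ℂ) else 0) =
        ∑ i, c i * walshSum bitSign (prodFun (patternFuns (e i :: l i))) x := by
  induction w with
  | nil =>
    refine ⟨Unit, inferInstance, fun _ => 1, fun _ => 0, fun _ => [], by simp, by simp,
      fun x => ?_⟩
    simp [patternFuns, walshSum_prodFun_singleton, tailPow]
  | cons a w ih =>
    obtain ⟨ι, _, c, e, l, hc, hl, hx⟩ := ih
    -- The indicator of `b = a` is `(1 + bitSign a * bitSign b) / 2`. The term 1 leaves the bit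
    -- unmarked and lengthens the first gap; the other term marks it. Two halves keep the total
    -- weight at most 1.
    refine ⟨ι ⊕ ι, inferInstance, Sum.elim (fun i => c i / 2) fun i => bitSign a * c i / 2,
      Sum.elim (fun i => e i + 1) fun _ => 0, Sum.elim l fun i => e i :: l i, ?_, ?_, fun x => ?_⟩
    · have h1 : ‖bitSign a‖ = 1 := by cases a <;> simp [bitSign]
      simp only [Fintype.sum_sum_type, Sum.elim_inl, Sum.elim_inr, norm_div, norm_mul, h1, one_mul,
        ← Finset.sum_div]
      simp only [RCLike.norm_ofNat]
      linarith
    · rintro (i | i)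
      · have := hl i
        simp only [Sum.elim_inl, List.length_cons]
        omega
      · have := hl i
        simp only [Sum.elim_inr, List.length_cons, List.sum_cons]
        omega
    · rw [Fintype.sum_sum_type]
      simp only [Sum.elim_inl, Sum.elim_inr]
      cases x with
      | nil =>
        simp only [walshSum_patternFuns_bump_nil,
          walshSum_patternFuns_zero_nil (List.cons_ne_nil _ _), mul_zero, Finset.sum_const_zero,
          add_zero]
        simp
      | cons b x =>
        simp only [walshSum_patternFuns_bump, walshSum_patternFuns_zero (List.cons_ne_nil _ _)]
        have e1 : ∑ i, c i / 2 * walshSum bitSign (prodFun (patternFuns (e i :: l i))) x =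
            1 / 2 * if x.take w.length = w then (1 : ℂ) else 0 := by
          rw [hx, Finset.mul_sum]
          exact Finset.sum_congr rfl fun i _ => by ring
        have e2 : ∑ i, bitSign a * c i / 2 *
            (bitSign b * walshSum bitSign (prodFun (patternFuns (e i :: l i))) x) =
            bitSign a * bitSign b / 2 * if x.take w.length = w then (1 : ℂ) else 0 := by
          rw [hx, Finset.mul_sum]
          exact Finset.sum_congr rfl fun i _ => by ring
        rw [e1, e2]
        by_cases hxw : x.take w.length = w <;> cases a <;> cases b <;>
          simp [bitSign, hxw] <;> norm_num

/-- A first marked position at distance `g` from the start of `x` lies at distance `e` from the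
start of exactly one suffix, the one at `i = g - e`, provided `e ≤ g`. -/
theorem sum_pow_mul_walshSum_drop (ζ : ℂ) (e : ℕ) {hs : List (ℕ → ℂ)} (hn : hs ≠ [])
    (x : List Bool) :
    ∑ i ∈ Finset.range x.length, ζ ^ i * walshSum bitSign (prodFun (diracSeq e :: hs)) (x.drop i) =
      walshSum bitSign (prodFun (tailPow ζ e :: hs)) x := by
  induction x with
  | nil =>
    obtain ⟨a, k, rfl⟩ := List.exists_cons_of_ne_nil hn
    simp [walshSum, prodFun]
  | cons b x ih =>
    rw [List.length_cons, Finset.sum_range_succ']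
    simp only [List.drop_succ_cons, pow_succ', mul_assoc, List.drop_zero, pow_zero, one_mul]
    rw [← Finset.mul_sum, ih, walshSum_prodFun_cons, walshSum_prodFun_cons]
    have h1 : shiftSeq (tailPow ζ e) =
        fun g => (fun g => ζ * tailPow ζ e g) g + shiftSeq (diracSeq e) g := by
      funext g
      simp only [shiftSeq, tailPow, diracSeq]
      rcases lt_trichotomy (g + 1) e with h | h | h
      · rw [if_neg (by omega), if_neg (by omega), if_neg (by omega)]; simp
      · rw [if_pos (by omega), if_neg (by omega), if_pos h, h]; simp
      · rw [if_pos (by omega), if_pos (by omega), if_neg (by omega),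
          show g + 1 - e = (g - e) + 1 by omega, pow_succ']
        ring
    have h2 : tailPow ζ e 0 = diracSeq e 0 := by
      simp only [tailPow, diracSeq, Nat.le_zero, eq_comm]
      by_cases h : e = 0 <;> simp [h]
    rw [h1, walshSum_prodFun_add, walshSum_prodFun_smul, h2]
    ring

end

noncomputable section

open scoped ENNReal

/-! ### Estimators of marker sums with bounded second moments -/

theorem posExpectation_sum_ne_top {β ι : Type*} {p : PMF β} (s : Finset ι) {f : ι → β → ℂ}
    (hf : ∀ i ∈ s, posExpectation p (fun y => ‖f i y‖ₑ) ≠ ∞) :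
    posExpectation p (fun y => ‖∑ i ∈ s, f i y‖ₑ) ≠ ∞ := by
  refine ne_top_of_le_ne_top (b := ∑ i ∈ s, posExpectation p (fun y => ‖f i y‖ₑ))
    (ENNReal.sum_ne_top.2 hf) ?_
  unfold posExpectation
  rw [← Summable.tsum_finsetSum fun _ _ => ENNReal.summable]
  refine ENNReal.tsum_le_tsum fun y => ?_
  rw [← Finset.mul_sum]
  exact mul_le_mul_right (enorm_sum_le _ _) _

theorem expectation_const {β : Type*} (p : PMF β) (c : ℂ) : expectation p (fun _ => c) = c := by
  unfold expectation
  rw [tsum_mul_right]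
  have h : ∑' a, ((p a).toReal : ℂ) = 1 := by
    rw [← Complex.ofReal_tsum, ← ENNReal.tsum_toReal_eq fun a => p.apply_ne_top a, p.tsum_coe]
    simp
  rw [h, one_mul]

theorem le_estimatorBound {C : ℕ} (hC : 1 ≤ C) (n k : ℕ) (α : ℝ) {ε : ℝ} (h0 : 0 < ε)
    (h1 : ε ≤ 1) : (n : ℝ) + 1 ≤ estimatorBound C n k α ε := by
  have hC' : (1 : ℝ) ≤ C := by exact_mod_cast hC
  have hn : (1 : ℝ) ≤ (n : ℝ) + 1 := by
    have : (0 : ℝ) ≤ n := Nat.cast_nonneg n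
    linarith
  have hε : 1 ≤ 1 / ε := by rw [le_div_iff₀ h0]; linarith
  have hα : 1 ≤ 1 + (C : ℝ) * α ^ 2 := by
    have : 0 ≤ (C : ℝ) * α ^ 2 := by positivity
    linarith
  calc (n : ℝ) + 1 = 1 * (n + 1) * 1 * 1 := by ring
    _ ≤ estimatorBound C n k α ε := by
      unfold estimatorBound
      gcongr
      · exact one_le_pow₀ hC'
      · exact le_self_pow₀ hn (by omega)
      · exact one_le_pow₀ hα
      · exact one_le_pow₀ hε

theorem kmerValue_eq_sum (x w : List Bool) (α : ℝ) :
    kmerValue x w α = ∑ l ∈ Finset.range x.length, Complex.exp (Complex.I * α) ^ l *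
      if (x.drop l).take w.length = w then (1 : ℂ) else 0 := by
  unfold kmerValue
  refine Finset.sum_congr rfl fun l _ => ?_
  rw [← Complex.exp_nat_mul]
  split_ifs
  · rw [mul_one]; congr 1; ring
  · simp

theorem exists_kmer_estimator (cs : List SyncChannel) {c : ℝ} (hc : 0 < c) :
    ∃ C : ℕ, 1 ≤ C ∧ ∀ α : ℝ, ∃ r : ℝ, 1 ≤ r ∧ r ≤ 1 + c ∧ r ≤ 1 + C * α ^ 2 ∧
      ∀ (n : ℕ) (ε : ℝ), 0 < ε → ε ≤ 1 → ∀ w : List Bool, ∃ f : List Bool → ℂ,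
          (∀ y, ‖f y‖ ≤ estimatorBound C n w.length α ε *
            (1 + ∑ i ∈ Finset.range y.length, r ^ i)) ∧
          ∀ x : List Bool, x.length = n →
            posExpectation (compositeTrace cs x) (fun y => ‖f y‖ₑ) ≠ ∞ ∧
            ‖expectation (compositeTrace cs x) f - kmerValue x w α‖ ≤ ε := by
  obtain ⟨C, hC, H⟩ := exists_pattern_estimator cs hc
  refine ⟨C, hC, fun α => ?_⟩
  obtain ⟨r, hr1, hrc, hrα, H⟩ := H α
  refine ⟨r, hr1, hrc, hrα, fun n ε hε0 hε1 w => ?_⟩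
  set ζ := Complex.exp (Complex.I * α) with hζ
  have hζ1 : ‖ζ‖ = 1 := by
    rw [hζ, mul_comm, Complex.norm_exp_ofReal_mul_I]
  obtain ⟨ι, _, d, e, l, hd, hel, hx⟩ := exists_prefix_expansion w
  have hS0 : ∀ y : List Bool, 0 ≤ ∑ i ∈ Finset.range y.length, r ^ i := fun y =>
    Finset.sum_nonneg fun i _ => pow_nonneg (by linarith) i
  have hB := le_estimatorBound hC n w.length α hε0 hε1
  have hn0 : (0 : ℝ) ≤ n := Nat.cast_nonneg n
  have key : ∀ i, ∃ f : List Bool → ℂ,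
      (∀ y, ‖f y‖ ≤ estimatorBound C n w.length α ε *
        (1 + ∑ i ∈ Finset.range y.length, r ^ i)) ∧
      ∀ x : List Bool, x.length = n →
        posExpectation (compositeTrace cs x) (fun y => ‖f y‖ₑ) ≠ ∞ ∧
        ‖expectation (compositeTrace cs x) f - ∑ m ∈ Finset.range x.length, ζ ^ m *
          walshSum bitSign (prodFun (patternFuns (e i :: l i))) (x.drop m)‖ ≤ ε := by
    intro i
    -- Without marked positions the term depends only on the known length `n`, so it is a constant
    -- and needs no traces. This is the reason for the summand 1 in the bound.
    by_cases hl : l i = []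
    · refine ⟨fun _ => ∑ m ∈ Finset.range n, ζ ^ m * tailPow 1 (e i) (n - m), fun y => ?_,
        fun x hxn => ⟨?_, ?_⟩⟩
      · have h1 : ‖∑ m ∈ Finset.range n, ζ ^ m * tailPow 1 (e i) (n - m)‖ ≤ n := by
          refine (norm_sum_le _ _).trans
            ((Finset.sum_le_sum (g := fun _ => (1 : ℝ)) fun m _ => ?_).trans (by simp))
          rw [norm_mul, norm_pow, hζ1, one_pow, one_mul]
          exact norm_tailPow_le (by simp) _ _
        nlinarith [hS0 y]
      · rw [posExpectation_const]
        exact enorm_ne_top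
      · rw [expectation_const, hl, hxn]
        have : ∀ m, walshSum bitSign (prodFun (patternFuns [e i])) (x.drop m) =
            tailPow 1 (e i) (n - m) := by
          intro m
          rw [patternFuns, walshSum_prodFun_singleton, List.length_drop, hxn]
        simp only [this, sub_self, norm_zero]
        exact hε0.le
    · obtain ⟨f, hf, hfx⟩ := H n w.length ε hε0 hε1 (e i) (l i) hl (hel i)
      refine ⟨f, fun y => (hf y).trans ?_, fun x hxn => ⟨(hfx x hxn).1, ?_⟩⟩
      · nlinarith [hS0 y]
      · rw [patternFuns_cons _ hl, sum_pow_mul_walshSum_drop ζ (e i) (patternFuns_ne_nil hl)]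
        exact (hfx x hxn).2
  choose f hfb hfx using key
  refine ⟨fun y => ∑ i, d i * f i y, fun y => ?_, fun x hxn => ?_⟩
  · have hB0 : 0 ≤ estimatorBound C n w.length α ε *
        (1 + ∑ i ∈ Finset.range y.length, r ^ i) :=
      mul_nonneg (by linarith) (by linarith [hS0 y])
    calc ‖∑ i, d i * f i y‖ ≤ ∑ i, ‖d i‖ * (estimatorBound C n w.length α ε *
        (1 + ∑ i ∈ Finset.range y.length, r ^ i)) := by
          refine norm_sum_le_of_le _ fun i _ => ?_
          rw [norm_mul]
          exact mul_le_mul_of_nonneg_left (hfb i y) (norm_nonneg _)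
      _ ≤ _ := by
          rw [← Finset.sum_mul]
          exact mul_le_of_le_one_left hB0 hd
  · have hfin : ∀ i ∈ Finset.univ, posExpectation (compositeTrace cs x)
        (fun y => ‖d i * f i y‖ₑ) ≠ ∞ := by
      intro i _
      simp only [enorm_mul]
      rw [posExpectation_const_mul]
      exact ENNReal.mul_ne_top enorm_ne_top (hfx i x hxn).1
    refine ⟨posExpectation_sum_ne_top _ hfin, ?_⟩
    rw [expectation_finset_sum _ hfin]
    simp only [expectation_const_mul]
    have hk : kmerValue x w α = ∑ i, d i * ∑ m ∈ Finset.range x.length, ζ ^ m *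
        walshSum bitSign (prodFun (patternFuns (e i :: l i))) (x.drop m) := by
      rw [kmerValue_eq_sum]
      simp only [hx, Finset.mul_sum]
      rw [Finset.sum_comm]
      exact Finset.sum_congr rfl fun i _ => Finset.sum_congr rfl fun m _ => by ring
    rw [hk, ← Finset.sum_sub_distrib]
    calc _ ≤ ∑ i, ‖d i‖ * ε := by
          refine norm_sum_le_of_le _ fun i _ => ?_
          rw [← mul_sub, norm_mul]
          exact mul_le_mul_of_nonneg_left (hfx i x hxn).2 (norm_nonneg _)
      _ ≤ ε := by
          rw [← Finset.sum_mul]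
          exact mul_le_of_le_one_left hε0.le hd

/-- The rate `r` may equal 1; a slightly larger `R` gives a clean exponential bound. -/
theorem one_add_sum_pow_le {r R : ℝ} (hr : 0 ≤ r) (hrR : r ≤ R) (h1 : 1 < R) (h2 : R ≤ 2)
    (N : ℕ) : 1 + ∑ i ∈ Finset.range N, r ^ i ≤ R ^ N / (R - 1) := by
  rw [le_div_iff₀ (by linarith), add_mul]
  have h3 : (∑ i ∈ Finset.range N, r ^ i) * (R - 1) ≤ R ^ N - 1 := by
    rw [← geom_sum_mul]
    refine mul_le_mul_of_nonneg_right ?_ (by linarith)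
    gcongr
  linarith

theorem one_add_div_pow_le_exp {a : ℝ} (ha : 0 ≤ a) (n : ℕ) :
    (1 + a / (n + 1)) ^ n ≤ Real.exp a := by
  have hn : (0 : ℝ) ≤ n := Nat.cast_nonneg n
  calc (1 + a / (n + 1)) ^ n ≤ Real.exp (a / (n + 1)) ^ n := by
        gcongr
        rw [add_comm]
        exact Real.add_one_le_exp _
    _ = Real.exp (n * (a / (n + 1))) := by rw [← Real.exp_nat_mul]
    _ ≤ Real.exp a := by
        refine Real.exp_le_exp.2 ?_
        rw [← mul_div_assoc, div_le_iff₀ (by linarith)]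
        nlinarith

theorem estimatorBound_sq_mul_le {C D : ℕ} {G c α ε b : ℝ} (hC : 1 ≤ C) (hG : 0 ≤ G) (hc : 0 < c)
    (hc1 : c ≤ 1) (hα : α ^ 2 ≤ 16) (hε0 : 0 < ε) (hε1 : ε ≤ 1) {n : ℕ} (hb0 : 0 ≤ b)
    (hb : b ≤ (1 + 4 * G * C * α ^ 2) * (1 + 4 * G * c / (n + 1)))
    (hDa : C ^ 2 * ((1 / c) ^ 2 * Real.exp (4 * G * c)) ≤ D) (hDb : 2 * C + 2 ≤ D)
    (hDc : (2 * C + 16 * C ^ 2) + 4 * G * C + 16 * (2 * C + 16 * C ^ 2) * (4 * G * C) ≤ (D : ℝ))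
    (k : ℕ) :
    (estimatorBound C n k α ε * ((n + 1) * (1 / c))) ^ 2 * b ^ n ≤
      estimatorBound D n k α ε := by
  set E := 2 * (C : ℝ) + 16 * C ^ 2 with hE
  have hE0 : 0 ≤ E := by positivity
  set F := 4 * G * C with hF
  have hF0 : 0 ≤ F := by positivity
  have hn0 : (0 : ℝ) ≤ n := Nat.cast_nonneg n
  set B := estimatorBound C n k α ε with hB
  have hε' : 1 ≤ 1 / ε := by rw [le_div_iff₀ hε0]; linarith
  -- As `α ^ 2 ≤ 16`, products of such factors are again of the form `1 + O(α²)`.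
  have hα2 : (1 + C * α ^ 2) ^ 2 * (1 + F * α ^ 2) ≤ 1 + D * α ^ 2 := by
    have hα0 : 0 ≤ α ^ 2 := sq_nonneg α
    have h1 : (1 + C * α ^ 2) ^ 2 ≤ 1 + E * α ^ 2 := by
      have : (C : ℝ) ^ 2 * (α ^ 2 * α ^ 2) ≤ C ^ 2 * (16 * α ^ 2) := by gcongr
      rw [hE]; nlinarith
    calc (1 + C * α ^ 2) ^ 2 * (1 + F * α ^ 2) ≤ (1 + E * α ^ 2) * (1 + F * α ^ 2) := by
          gcongr
      _ = 1 + (E + F) * α ^ 2 + E * F * (α ^ 2 * α ^ 2) := by ring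
      _ ≤ 1 + (E + F) * α ^ 2 + E * F * (16 * α ^ 2) := by gcongr
      _ = 1 + (E + F + 16 * E * F) * α ^ 2 := by ring
      _ ≤ 1 + D * α ^ 2 := by gcongr
  calc (B * ((n + 1) * (1 / c))) ^ 2 * b ^ n
      ≤ (B * ((n + 1) * (1 / c))) ^ 2 *
        ((1 + F * α ^ 2) * (1 + 4 * G * c / (n + 1))) ^ n := by gcongr
    _ = (B * ((n + 1) * (1 / c))) ^ 2 *
        ((1 + F * α ^ 2) ^ n * (1 + 4 * G * c / (n + 1)) ^ n) := by rw [mul_pow _ _ n]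
    _ ≤ (B * ((n + 1) * (1 / c))) ^ 2 * ((1 + F * α ^ 2) ^ n * Real.exp (4 * G * c)) := by
        gcongr
        exact one_add_div_pow_le_exp (by positivity) n
    _ = ((C : ℝ) ^ 2) ^ (k + 1) * ((1 / c) ^ 2 * Real.exp (4 * G * c)) *
        (n + 1) ^ (2 * C + 2) *
        ((1 + C * α ^ 2) ^ 2 * (1 + F * α ^ 2)) ^ n * (1 / ε) ^ (2 * C) := by
        rw [hB, estimatorBound, mul_pow _ (1 + F * α ^ 2) n]
        generalize 1 + (C : ℝ) * α ^ 2 = a, (n : ℝ) + 1 = m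
        ring
    _ ≤ (D : ℝ) ^ (k + 1) * (n + 1) ^ D * (1 + D * α ^ 2) ^ n * (1 / ε) ^ D := by
        have hcE : 1 ≤ (1 / c) ^ 2 * Real.exp (4 * G * c) := by
          have h1 : 1 ≤ 1 / c := by rw [le_div_iff₀ hc]; linarith
          exact one_le_mul_of_one_le_of_one_le (one_le_pow₀ h1)
            (Real.one_le_exp (by positivity))
        gcongr
        · calc ((C : ℝ) ^ 2) ^ (k + 1) * ((1 / c) ^ 2 * Real.exp (4 * G * c))
              ≤ ((C : ℝ) ^ 2) ^ (k + 1) *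
                ((1 / c) ^ 2 * Real.exp (4 * G * c)) ^ (k + 1) := by
                gcongr
                exact le_self_pow₀ hcE (by omega)
            _ = (C ^ 2 * ((1 / c) ^ 2 * Real.exp (4 * G * c))) ^ (k + 1) := by
                exact (mul_pow _ _ _).symm
            _ ≤ _ := by gcongr
        · linarith
        · omega

/-- The pointwise bound gives `‖f y‖² ≤ B² poly(n) R ^ (2 |y|)`, and the exponential moment of the
length at `R²` is at most `(1 + G (R² - 1)) ^ n`, where `R² - 1 = O(α² + 1/n)`. -/
theorem exists_kmer_estimator_second_moment (cs : List SyncChannel) :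
    ∃ D : ℕ, 1 ≤ D ∧ ∀ (α : ℝ), α ^ 2 ≤ 16 → ∀ (n : ℕ) (ε : ℝ), 0 < ε → ε ≤ 1 →
      ∀ w : List Bool, ∃ f : List Bool → ℂ, ∀ x : List Bool, x.length = n →
        posExpectation (compositeTrace cs x) (fun y => ‖f y‖ₑ) ≠ ∞ ∧
        ‖expectation (compositeTrace cs x) f - kmerValue x w α‖ ≤ ε ∧
        posExpectation (compositeTrace cs x) (fun y => ‖f y‖ₑ ^ 2) ≤
          ENNReal.ofReal (estimatorBound D n w.length α ε) := by
  obtain ⟨G, hG, R₀, hR₀, hmom⟩ := posExpectation_compositeTrace_le cs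
  -- Ensures `R² ≤ (1 + 2 c)² ≤ R₀`, so that the moment bound applies at `R²`.
  set c := min (1 / 2) ((R₀ - 1) / 8) with hcdef
  have hc : 0 < c := lt_min (by norm_num) (by linarith)
  have hc1 : c ≤ 1 / 2 := min_le_left _ _
  have hc2 : c ≤ (R₀ - 1) / 8 := min_le_right _ _
  obtain ⟨C, hC, H⟩ := exists_kmer_estimator cs hc
  set E := 2 * (C : ℝ) + 16 * C ^ 2 with hE
  have hE0 : 0 ≤ E := by positivity
  set F := 4 * G * C with hF
  have hF0 : 0 ≤ F := by positivity
  obtain ⟨D, hD⟩ := exists_nat_ge (C ^ 2 * ((1 / c) ^ 2 * Real.exp (4 * G * c)) +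
    (2 * C + 2) + (E + F + 16 * E * F))
  have hp1 : 0 ≤ C ^ 2 * ((1 / c) ^ 2 * Real.exp (4 * G * c)) := by positivity
  have hp2 : 0 ≤ E + F + 16 * E * F := by positivity
  have hC' : (1 : ℝ) ≤ C := by exact_mod_cast hC
  have hDa : C ^ 2 * ((1 / c) ^ 2 * Real.exp (4 * G * c)) ≤ D := by linarith
  have hDb : 2 * C + 2 ≤ D := by
    have : ((2 * C + 2 : ℕ) : ℝ) ≤ D := by push_cast; linarith
    exact_mod_cast this
  have hDc : E + F + 16 * E * F ≤ D := by linarith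
  refine ⟨D, by omega, fun α hα n ε hε0 hε1 w => ?_⟩
  obtain ⟨r, hr1, hrc, hrα, H⟩ := H α
  obtain ⟨f, hfb, hfx⟩ := H n ε hε0 hε1 w
  refine ⟨f, fun x hxn => ⟨(hfx x hxn).1, (hfx x hxn).2, ?_⟩⟩
  set k := w.length
  set B := estimatorBound C n k α ε with hB
  have hn0 : (0 : ℝ) ≤ n := Nat.cast_nonneg n
  have hB1 := le_estimatorBound hC n k α hε0 hε1
  have hcn : 0 < c / (n + 1) := by positivity
  have hcn' : c / (n + 1) ≤ c := div_le_self hc.le (by linarith)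
  -- The increment keeps `1 / (R - 1)` polynomial in `n`, while its effect on an `n`-th power is a
  -- bounded factor.
  set R := r + c / (n + 1) with hR
  have hR1 : 1 < R := by linarith
  have hR2 : R ≤ 1 + 2 * c := by linarith
  have hRR : R ^ 2 ≤ R₀ := by
    have h1 : R ^ 2 ≤ (1 + 2 * c) ^ 2 := by gcongr
    have h2 : c * c ≤ 1 / 2 * c := mul_le_mul_of_nonneg_right hc1 hc.le
    have h3 : (1 + 2 * c) ^ 2 = 1 + 4 * c + 4 * (c * c) := by ring
    linarith
  have hRinv : 1 / (R - 1) ≤ (n + 1) * (1 / c) := by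
    have h := one_div_le_one_div_of_le hcn (show c / (n + 1) ≤ R - 1 by linarith)
    rwa [one_div_div, div_eq_mul_one_div _ c] at h
  have hsq : ∀ y, ‖f y‖ ^ 2 ≤ (B * ((n + 1) * (1 / c))) ^ 2 * (R ^ 2) ^ y.length := by
    intro y
    have h1 : ‖f y‖ ≤ B * ((n + 1) * (1 / c)) * R ^ y.length := by
      refine (hfb y).trans ?_
      rw [mul_assoc]
      refine mul_le_mul_of_nonneg_left ?_ (by linarith)
      refine (one_add_sum_pow_le (by linarith) (by linarith) hR1 (by linarith) _).trans ?_
      rw [div_eq_mul_one_div, mul_comm]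
      gcongr
    calc ‖f y‖ ^ 2 ≤ (B * ((n + 1) * (1 / c)) * R ^ y.length) ^ 2 := by gcongr
      _ = _ := by rw [mul_pow _ (R ^ y.length), ← pow_mul, ← pow_mul, mul_comm 2]
  have hbase : 1 + G * (R ^ 2 - 1) ≤ (1 + F * α ^ 2) * (1 + 4 * G * c / (n + 1)) := by
    have h1 : R ^ 2 - 1 ≤ 4 * (C * α ^ 2 + c / (n + 1)) := by
      have h6 : (R - 1) * (R + 1) ≤ (R - 1) * 4 :=
        mul_le_mul_of_nonneg_left (by linarith) (by linarith)
      have h7 : R ^ 2 - 1 = (R - 1) * (R + 1) := by ring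
      linarith
    have h2 : G * (R ^ 2 - 1) ≤ G * (4 * (C * α ^ 2 + c / (n + 1))) :=
      mul_le_mul_of_nonneg_left h1 hG
    have h3 : 0 ≤ F * α ^ 2 * (4 * G * c / (n + 1)) := by positivity
    have h4 : 4 * G * c / (n + 1) = 4 * G * (c / (n + 1)) := by ring
    have h5 : F * α ^ 2 = 4 * G * (C * α ^ 2) := by rw [hF]; ring
    rw [h4] at h3 ⊢
    have h6 : (1 + F * α ^ 2) * (1 + 4 * G * (c / (n + 1))) = 1 + F * α ^ 2 +
        4 * G * (c / (n + 1)) + F * α ^ 2 * (4 * G * (c / (n + 1))) := by ring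
    rw [h6]
    linarith
  have hbase0 : 0 ≤ 1 + G * (R ^ 2 - 1) := by
    have : 0 ≤ R ^ 2 - 1 := sub_nonneg.2 (one_le_pow₀ hR1.le)
    positivity
  calc posExpectation (compositeTrace cs x) (fun y => ‖f y‖ₑ ^ 2)
      ≤ posExpectation (compositeTrace cs x) (fun y =>
        ENNReal.ofReal ((B * ((n + 1) * (1 / c))) ^ 2) *
          ENNReal.ofReal ((R ^ 2) ^ y.length)) := by
        refine posExpectation_mono _ fun y => ?_
        rw [← ENNReal.ofReal_mul (by positivity), ← ofReal_norm, ← ENNReal.ofReal_pow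
          (norm_nonneg _)]
        exact ENNReal.ofReal_le_ofReal (hsq y)
    _ ≤ ENNReal.ofReal ((B * ((n + 1) * (1 / c))) ^ 2) *
        ENNReal.ofReal ((1 + G * (R ^ 2 - 1)) ^ x.length) := by
        rw [posExpectation_const_mul]
        gcongr
        exact hmom (R ^ 2) (one_le_pow₀ hR1.le) hRR x
    _ ≤ ENNReal.ofReal (estimatorBound D n k α ε) := by
        rw [← ENNReal.ofReal_mul (by positivity), hxn]
        refine ENNReal.ofReal_le_ofReal ?_
        exact estimatorBound_sq_mul_le hC hG hc (by linarith) hα hε0 hε1 hbase0 hbase hDa hDb hDc k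

end

noncomputable section

open scoped ENNReal

/-! ### Sample means and their concentration -/

section SampleMeans

variable {Ω : Type*} [MeasurableSpace Ω] {μ : Measure Ω} [IsProbabilityMeasure μ]

theorem measureReal_le_abs_sampleMean_sub_le {X : Ω → ℝ} (hX : MemLp X 2 μ) {V : ℝ}
    (hV : ∫ ω, X ω ^ 2 ∂μ ≤ V) {N : ℕ} (hN : 0 < N) {η : ℝ} (hη : 0 < η) :
    (Measure.pi fun _ : Fin N => μ).real {t | η ≤ |(∑ i, X (t i)) / N - ∫ ω, X ω ∂μ|} ≤
      V / (N * η ^ 2) := by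
  have hN' : (0 : ℝ) < N := by exact_mod_cast hN
  set ν := Measure.pi fun _ : Fin N => μ
  set S : (Fin N → Ω) → ℝ := ∑ i, fun t => X (t i) with hS
  have hXi : ∀ i : Fin N, MemLp (fun t : Fin N → Ω => X (t i)) 2 ν := fun i =>
    hX.comp_measurePreserving (measurePreserving_eval _ i)
  have hSm : MemLp S 2 ν := memLp_finsetSum' _ fun i _ => hXi i
  have hSE : ∫ t, S t ∂ν = N * ∫ ω, X ω ∂μ := by
    have h1 : ∀ i : Fin N, ∫ t, X (t i) ∂ν = ∫ ω, X ω ∂μ := fun i =>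
      integral_comp_eval (μ := fun _ : Fin N => μ) (i := i) hX.1
    simp only [hS, Finset.sum_apply]
    rw [integral_finsetSum _ fun i _ => (hXi i).integrable (by norm_num)]
    simp [h1]
  have hVar : ProbabilityTheory.variance S ν ≤ N * V := by
    rw [hS, ProbabilityTheory.variance_sum_pi fun _ => hX]
    simp only [Finset.sum_const, Finset.card_univ, Fintype.card_fin, nsmul_eq_mul]
    gcongr
    exact (ProbabilityTheory.variance_le_expectation_sq hX.1).trans hV
  have hcheb := ProbabilityTheory.meas_ge_le_variance_div_sq hSm (mul_pos hN' hη)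
  have hset : {t : Fin N → Ω | η ≤ |(∑ i, X (t i)) / N - ∫ ω, X ω ∂μ|} =
      {t | N * η ≤ |S t - ∫ t, S t ∂ν|} := by
    ext t
    simp only [Set.mem_ofPred_eq]
    have h2 : S t - ∫ t, S t ∂ν = N * ((∑ i, X (t i)) / N - ∫ ω, X ω ∂μ) := by
      rw [hSE, hS, Finset.sum_apply]
      field_simp
    rw [h2, abs_mul, abs_of_pos hN']
    exact (mul_le_mul_iff_right₀ hN').symm
  rw [hset, Measure.real]
  refine (ENNReal.toReal_mono ENNReal.ofReal_ne_top hcheb).trans ?_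
  rw [ENNReal.toReal_ofReal (div_nonneg (ProbabilityTheory.variance_nonneg _ _) (sq_nonneg _)),
    div_le_div_iff₀ (by positivity) (by positivity)]
  calc ProbabilityTheory.variance S ν * (N * η ^ 2) ≤ N * V * (N * η ^ 2) := by gcongr
    _ = V * (N * η) ^ 2 := by ring

/-- A deviation `η` forces one of `η / 2` in the real or the imaginary part; two Chebyshev bounds at
`η / 2` give `8 = 2 · 4`. -/
theorem measureReal_le_norm_sampleMean_sub_le {f : Ω → ℂ} (hf : MemLp f 2 μ) {V : ℝ}
    (hV : ∫ ω, ‖f ω‖ ^ 2 ∂μ ≤ V) {N : ℕ} (hN : 0 < N) {η : ℝ} (hη : 0 < η) :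
    (Measure.pi fun _ : Fin N => μ).real {t | η ≤ ‖(∑ i, f (t i)) / N - ∫ ω, f ω ∂μ‖} ≤
      8 * V / (N * η ^ 2) := by
  have hint : Integrable f μ := hf.integrable (by norm_num)
  have hint2 : Integrable (fun ω => ‖f ω‖ ^ 2) μ := hf.norm.integrable_sq
  have hre : ∫ ω, (f ω).re ^ 2 ∂μ ≤ V := by
    refine (integral_mono hf.re.integrable_sq hint2 fun ω => ?_).trans hV
    exact sq_le_sq' (abs_le.1 (Complex.abs_re_le_norm (f ω))).1
      (abs_le.1 (Complex.abs_re_le_norm (f ω))).2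
  have him : ∫ ω, (f ω).im ^ 2 ∂μ ≤ V := by
    refine (integral_mono hf.im.integrable_sq hint2 fun ω => ?_).trans hV
    exact sq_le_sq' (abs_le.1 (Complex.abs_im_le_norm (f ω))).1
      (abs_le.1 (Complex.abs_im_le_norm (f ω))).2
  have h1 := measureReal_le_abs_sampleMean_sub_le hf.re hre hN (half_pos hη)
  have h2 := measureReal_le_abs_sampleMean_sub_le hf.im him hN (half_pos hη)
  have hsub : {t : Fin N → Ω | η ≤ ‖(∑ i, f (t i)) / N - ∫ ω, f ω ∂μ‖} ⊆
      {t | η / 2 ≤ |(∑ i, (f (t i)).re) / N - ∫ ω, (f ω).re ∂μ|} ∪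
      {t | η / 2 ≤ |(∑ i, (f (t i)).im) / N - ∫ ω, (f ω).im ∂μ|} := by
    intro t ht
    simp only [Set.mem_ofPred_eq, Set.mem_union] at ht ⊢
    have e1 : ((∑ i, f (t i)) / N - ∫ ω, f ω ∂μ).re =
        (∑ i, (f (t i)).re) / N - ∫ ω, (f ω).re ∂μ := by
      rw [Complex.sub_re, Complex.div_natCast_re, Complex.re_sum]
      congr 1
      exact (integral_re hint).symm
    have e2 : ((∑ i, f (t i)) / N - ∫ ω, f ω ∂μ).im =
        (∑ i, (f (t i)).im) / N - ∫ ω, (f ω).im ∂μ := by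
      rw [Complex.sub_im, Complex.div_natCast_im, Complex.im_sum]
      congr 1
      exact (integral_im hint).symm
    have h3 := Complex.norm_le_abs_re_add_abs_im ((∑ i, f (t i)) / N - ∫ ω, f ω ∂μ)
    rw [e1, e2] at h3
    by_contra! hcon
    linarith [hcon.1, hcon.2]
  refine (measureReal_mono hsub).trans ((measureReal_union_le _ _).trans
    ((add_le_add h1 h2).trans_eq ?_))
  field_simp
  ring

/-- Union bound over the `4 ^ m` subsets of the `2 m` indices: for each subset with at least `m`
elements, independence gives at most `p ^ m`. -/
theorem measureReal_card_filter_le {S : Set Ω} {p : ℝ} (hp : μ.real S ≤ p) (hp1 : p ≤ 1) (m : ℕ) :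
    (Measure.pi fun _ : Fin (2 * m) => μ).real
      {t | ∃ A : Finset (Fin (2 * m)), m ≤ A.card ∧ ∀ j ∈ A, t j ∈ S} ≤ (4 * p) ^ m := by
  have hp0 : 0 ≤ p := measureReal_nonneg.trans hp
  set ν := Measure.pi fun _ : Fin (2 * m) => μ
  have hA : ∀ A : Finset (Fin (2 * m)),
      ν.real {t | m ≤ A.card ∧ ∀ j ∈ A, t j ∈ S} ≤ p ^ m := by
    intro A
    by_cases hm : m ≤ A.card
    · have hset : {t : Fin (2 * m) → Ω | m ≤ A.card ∧ ∀ j ∈ A, t j ∈ S} =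
          (A : Set (Fin (2 * m))).pi fun _ => S := by
        ext t; simp [hm, Set.mem_pi]
      rw [hset, Measure.real, Measure.pi_pi_finset, Finset.prod_const, ENNReal.toReal_pow]
      calc μ.real S ^ A.card ≤ p ^ A.card := by gcongr
        _ ≤ p ^ m := pow_le_pow_of_le_one hp0 hp1 hm
    · simp only [hm, false_and, Set.ofPred_false, measureReal_empty]
      positivity
  have hset : {t : Fin (2 * m) → Ω | ∃ A : Finset (Fin (2 * m)), m ≤ A.card ∧ ∀ j ∈ A, t j ∈ S} =
      ⋃ A : Finset (Fin (2 * m)), {t | m ≤ A.card ∧ ∀ j ∈ A, t j ∈ S} := by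
    ext t; simp
  rw [hset]
  refine (measureReal_iUnion_fintype_le _).trans ((Finset.sum_le_sum fun A _ => hA A).trans_eq ?_)
  rw [Finset.sum_const, Finset.card_univ, Fintype.card_finset, Fintype.card_fin, nsmul_eq_mul,
    mul_pow, pow_mul]
  norm_num

/-- Flattening independent groups of independent samples gives independent samples; both laws agree
on boxes. -/
theorem map_uncurry_pi (μ : Measure Ω) [IsProbabilityMeasure μ] (M N : ℕ) :
    (Measure.pi fun _ : Fin M => Measure.pi fun _ : Fin N => μ).map
      (fun u a => u (finProdFinEquiv.symm a).1 (finProdFinEquiv.symm a).2) =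
      Measure.pi fun _ : Fin (M * N) => μ := by
  symm
  refine Measure.pi_eq fun s hs => ?_
  have hmeas : Measurable fun (u : Fin M → Fin N → Ω) (a : Fin (M * N)) =>
      u (finProdFinEquiv.symm a).1 (finProdFinEquiv.symm a).2 := by fun_prop
  rw [Measure.map_apply hmeas (MeasurableSet.univ_pi hs)]
  have hset : (fun (u : Fin M → Fin N → Ω) (a : Fin (M * N)) =>
      u (finProdFinEquiv.symm a).1 (finProdFinEquiv.symm a).2) ⁻¹' Set.univ.pi s =
      Set.univ.pi fun j => Set.univ.pi fun i => s (finProdFinEquiv (j, i)) := by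
    ext u
    simp only [Set.mem_preimage, Set.mem_pi, Set.mem_univ, true_imp_iff]
    constructor
    · intro h j i
      simpa using h (finProdFinEquiv (j, i))
    · intro h a
      have h1 := h (finProdFinEquiv.symm a).1 (finProdFinEquiv.symm a).2
      rwa [Prod.mk.eta, Equiv.apply_symm_apply] at h1
  rw [hset]
  simp only [Measure.pi_pi]
  rw [← Fintype.prod_prod_type' fun j i => μ (s (finProdFinEquiv (j, i)))]
  exact Fintype.prod_equiv finProdFinEquiv _ _ fun _ => rfl

end SampleMeans

/-! ### Boosting -/

/-- A point that is close to more than half of the given points, if there is one. -/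
def majorityPoint {M : ℕ} (η : ℝ) (g : Fin M → ℂ) : ℂ :=
  open Classical in
  if h : ∃ z : ℂ, M < 2 * (Finset.univ.filter fun j => ‖g j - z‖ < η).card then h.choose else 0

/-- Two majorities share an index, so any point close to more than half of the estimates is within
`2 η` of the true one. This replaces the median for complex values. -/
theorem norm_majorityPoint_sub_lt {m : ℕ} {η : ℝ} {g : Fin (2 * m) → ℂ} {z : ℂ}
    (h : ¬ ∃ A : Finset (Fin (2 * m)), m ≤ A.card ∧ ∀ j ∈ A, η ≤ ‖g j - z‖) :
    ‖majorityPoint η g - z‖ < 2 * η := by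
  classical
  have hz : 2 * m < 2 * (Finset.univ.filter fun j => ‖g j - z‖ < η).card := by
    have h1 : (Finset.univ.filter fun j => ¬ ‖g j - z‖ < η).card < m := by
      by_contra! hc
      exact h ⟨_, hc, fun j hj => by simpa using hj⟩
    have h2 := Finset.card_filter_add_card_filter_not (s := Finset.univ)
      (fun j => ‖g j - z‖ < η)
    rw [Finset.card_univ, Fintype.card_fin] at h2
    omega
  have hex : ∃ z : ℂ, 2 * m < 2 * (Finset.univ.filter fun j => ‖g j - z‖ < η).card := ⟨z, hz⟩
  have hch := hex.choose_spec
  have hdef : majorityPoint η g = hex.choose := by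
    unfold majorityPoint
    rw [dif_pos (by convert hex)]
  rw [hdef]
  set y := hex.choose
  have hne : ((Finset.univ.filter fun j => ‖g j - z‖ < η) ∩
      (Finset.univ.filter fun j => ‖g j - y‖ < η)).Nonempty := by
    refine Finset.inter_nonempty_of_card_lt_card_add_card (Finset.subset_univ _)
      (Finset.subset_univ _) ?_
    rw [Finset.card_univ, Fintype.card_fin]
    omega
  obtain ⟨j, hj⟩ := hne
  simp only [Finset.mem_inter, Finset.mem_filter, Finset.mem_univ, true_and] at hj
  calc ‖y - z‖ = ‖(g j - z) - (g j - y)‖ := by congr 1; ring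
    _ ≤ ‖g j - z‖ + ‖g j - y‖ := norm_sub_le _ _
    _ < 2 * η := by linarith [hj.1, hj.2]

/-- The majority point of the means of `M` groups of `N` samples. -/
def boostedEstimate {Ω : Type*} (f : Ω → ℂ) (η : ℝ) (M N : ℕ) (t : Fin (M * N) → Ω) : ℂ :=
  majorityPoint η fun j => (∑ i, f (t (finProdFinEquiv (j, i)))) / N

theorem lt_measureReal_boostedEstimate {Ω : Type*} [MeasurableSpace Ω] [Countable Ω]
    [MeasurableSingletonClass Ω] {μ : Measure Ω} [IsProbabilityMeasure μ] {f : Ω → ℂ}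
    (hf : MemLp f 2 μ) {V : ℝ} (hV : ∫ ω, ‖f ω‖ ^ 2 ∂μ ≤ V) {ε δ : ℝ} (hε : 0 < ε) {K : ℂ}
    (hK : ‖∫ ω, f ω ∂μ - K‖ ≤ ε / 4) {m N : ℕ} (hN0 : 0 < N) (hN : 2048 * V ≤ N * ε ^ 2)
    (hm : (1 / 4 : ℝ) ^ m < δ) :
    1 - δ < (Measure.pi fun _ : Fin (2 * m * N) => μ).real
      {t | ‖boostedEstimate f (ε / 2) (2 * m) N t - K‖ < ε} := by
  have hN' : (0 : ℝ) < N := by exact_mod_cast hN0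
  rw [← map_uncurry_pi μ (2 * m) N]
  set ν := Measure.pi fun _ : Fin N => μ
  set P := Measure.pi fun _ : Fin (2 * m) => ν
  have hmeas : Measurable fun (u : Fin (2 * m) → Fin N → Ω) (a : Fin (2 * m * N)) =>
      u (finProdFinEquiv.symm a).1 (finProdFinEquiv.symm a).2 := by fun_prop
  rw [map_measureReal_apply hmeas (Set.to_countable _).measurableSet]
  set S : Set (Fin N → Ω) := {t | ε / 4 ≤ ‖(∑ i, f (t i)) / N - ∫ ω, f ω ∂μ‖}
  have hS : ν.real S ≤ 1 / 16 := by
    -- At deviation `ε / 4` the bound is `128 V / (N ε²)`, and `2048 = 16 · 128`. The value `1/16`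
    -- makes the union bound `(4 / 16) ^ m`.
    refine (measureReal_le_norm_sampleMean_sub_le hf hV hN0 (by positivity)).trans ?_
    rw [div_le_div_iff₀ (by positivity) (by norm_num)]
    nlinarith
  have hbad := measureReal_card_filter_le hS (by norm_num) m
  set Bad : Set (Fin (2 * m) → Fin N → Ω) :=
    {t | ∃ A : Finset (Fin (2 * m)), m ≤ A.card ∧ ∀ j ∈ A, t j ∈ S}
  have hBadm : MeasurableSet Bad := (Set.to_countable _).measurableSet
  have hcompl : P.real Badᶜ = 1 - P.real Bad := probReal_compl_eq_one_sub hBadm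
  have hsub : Badᶜ ⊆ (fun (u : Fin (2 * m) → Fin N → Ω) (a : Fin (2 * m * N)) =>
      u (finProdFinEquiv.symm a).1 (finProdFinEquiv.symm a).2) ⁻¹'
        {t | ‖boostedEstimate f (ε / 2) (2 * m) N t - K‖ < ε} := by
    intro u hu
    simp only [Set.mem_preimage, Set.mem_ofPred_eq, boostedEstimate, Equiv.symm_apply_apply]
    -- A good group is within `ε / 4` of the mean and the bias is at most `ε / 4`; the majority vote
    -- doubles the resulting `ε / 2`.
    have h := norm_majorityPoint_sub_lt (m := m) (η := ε / 2) (z := K)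
      (g := fun j => (∑ i, f (u j i)) / N) (by
        rintro ⟨A, hA, hAj⟩
        refine hu ⟨A, hA, fun j hj => ?_⟩
        have h1 := hAj j hj
        have h2 := norm_sub_le_norm_sub_add_norm_sub ((∑ i, f (u j i)) / N) (∫ ω, f ω ∂μ) K
        simp only [S, Set.mem_ofPred_eq]
        linarith)
    rwa [mul_div_cancel₀ _ two_ne_zero] at h
  have hmono := measureReal_mono (μ := P) hsub
  have hpow : (4 * (1 / 16 : ℝ)) ^ m = (1 / 4) ^ m := by norm_num
  rw [hpow] at hbad
  linarith

end

noncomputable section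

open scoped ENNReal

/-! ### Probability mass functions on bit strings as measures -/

instance instDiscreteMeasurableSpaceBitString : DiscreteMeasurableSpace (List Bool) :=
  ⟨fun _ => trivial⟩

theorem lintegral_toMeasure_eq_posExpectation (p : PMF (List Bool)) (g : List Bool → ℝ≥0∞) :
    ∫⁻ y, g y ∂p.toMeasure = posExpectation p g := by
  rw [lintegral_countable']
  refine tsum_congr fun a => ?_
  rw [PMF.toMeasure_apply_singleton p a (MeasurableSet.singleton _), mul_comm]

theorem memLp_two_toMeasure {p : PMF (List Bool)} {f : List Bool → ℂ} {V : ℝ} (hV0 : 0 ≤ V)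
    (hV : posExpectation p (fun y => ‖f y‖ₑ ^ 2) ≤ ENNReal.ofReal V) :
    MemLp f 2 p.toMeasure ∧ ∫ y, ‖f y‖ ^ 2 ∂p.toMeasure ≤ V := by
  have hmeas : Measurable f := measurable_of_countable f
  have hl : ∫⁻ y, ENNReal.ofReal (‖f y‖ ^ 2) ∂p.toMeasure ≤ ENNReal.ofReal V := by
    rw [lintegral_toMeasure_eq_posExpectation]
    simpa only [ENNReal.ofReal_pow (norm_nonneg _), ofReal_norm] using hV
  have hint : Integrable (fun y => ‖f y‖ ^ 2) p.toMeasure := by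
    refine ⟨(hmeas.norm.pow_const 2).aestronglyMeasurable, ?_⟩
    rw [hasFiniteIntegral_iff_ofReal (Filter.Eventually.of_forall fun y => sq_nonneg _)]
    exact hl.trans_lt ENNReal.ofReal_lt_top
  refine ⟨(memLp_two_iff_integrable_sq_norm hmeas.aestronglyMeasurable).2 hint, ?_⟩
  rw [integral_eq_lintegral_of_nonneg_ae (Filter.Eventually.of_forall fun y => sq_nonneg _)
    hint.aestronglyMeasurable]
  exact ENNReal.toReal_le_of_le_ofReal hV0 hl

theorem integral_toMeasure_eq_expectation {p : PMF (List Bool)} {f : List Bool → ℂ}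
    (hf : Integrable f p.toMeasure) : ∫ y, f y ∂p.toMeasure = expectation p f := by
  rw [PMF.integral_eq_tsum p f hf]
  refine tsum_congr fun a => ?_
  rw [Complex.real_smul]

/-! ### Sample complexity -/

/-- For `n ≥ 1`, `n + 1 ≤ 2 e ^ log n`, so the prefactor is at most `2 ^ C e ^ (C (k + log n))`, and
the exponent is bounded by `C a n`. -/
theorem exp_mul_mul_succ_pow_le {n k : ℕ} {a : ℝ} (C : ℕ) (h : (k : ℝ) + Real.log n ≤ a * n) :
    Real.exp (C * k) * (n + 1) ^ C ≤ 2 ^ C * Real.exp (C * a) ^ n := by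
  rcases Nat.eq_zero_or_pos n with rfl | hn
  -- With `Real.log 0 = 0` the condition at `n = 0` reads `k ≤ 0`.
  · have hk : (k : ℝ) = 0 := by
      refine le_antisymm ?_ (Nat.cast_nonneg k)
      simpa using h
    simp [hk, one_le_pow₀]
  · have hn' : (1 : ℝ) ≤ n := by exact_mod_cast hn
    calc Real.exp (C * k) * (n + 1) ^ C ≤ Real.exp (C * k) * (2 * Real.exp (Real.log n)) ^ C := by
          rw [Real.exp_log (by linarith)]
          gcongr
          linarith
      _ = 2 ^ C * Real.exp (C * (k + Real.log n)) := by
          rw [mul_pow, ← Real.exp_nat_mul, mul_add, Real.exp_add]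
          ring
      _ ≤ 2 ^ C * Real.exp (C * (a * n)) := by gcongr
      _ = 2 ^ C * Real.exp (C * a) ^ n := by
          rw [← Real.exp_nat_mul]
          congr 2
          ring

/-- On a bounded range the exponential is `1 + O(x)`, so `e ^ (C α²)` can be merged into the factor
`1 + O(α²)`. -/
theorem exp_le_one_add_mul_exp {x y : ℝ} (h0 : 0 ≤ x) (hxy : x ≤ y) :
    Real.exp x ≤ 1 + x * Real.exp y := by
  have h1 : 1 - x ≤ Real.exp (-x) := by linarith [Real.add_one_le_exp (-x)]
  have h2 : (1 - x) * Real.exp x ≤ 1 := by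
    calc (1 - x) * Real.exp x ≤ Real.exp (-x) * Real.exp x := by gcongr
      _ = 1 := by rw [← Real.exp_add]; simp
  have h3 : x * Real.exp x ≤ x * Real.exp y := by gcongr
  linarith

theorem goodSampleComplexity_of_le {A : KmerAlgorithm} (C : ℕ)
    (h : ∀ (n k : ℕ) (α ε δ : ℝ), α ∈ Set.Icc (-Real.pi) Real.pi → 0 < ε → 0 < δ → δ < 1 →
      (A.samples n k α ε δ : ℝ) ≤
        C * (Real.exp (C * k) * (n + 1) ^ C) * (1 + C * α ^ 2) ^ n * (1 + 1 / ε) ^ C *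
          (1 + Real.log (1 / δ)) ^ C) :
    A.GoodSampleComplexity := by
  set P := (C : ℝ) * Real.exp (C * 16) with hP
  have hP0 : 0 ≤ P := by positivity
  obtain ⟨E, hE⟩ := exists_nat_ge ((C : ℝ) * 2 ^ C + (C + P + 16 * C * P))
  have hE1 : (C : ℝ) * 2 ^ C ≤ E := by
    have : 0 ≤ C + P + 16 * C * P := by positivity
    linarith
  have hE2 : C + P + 16 * C * P ≤ E := by
    have : 0 ≤ (C : ℝ) * 2 ^ C := by positivity
    linarith
  have hCE' : (C : ℝ) ≤ E := by
    have : 0 ≤ P + 16 * C * P := by positivity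
    linarith
  have hCE : C ≤ E := by exact_mod_cast hCE'
  refine ⟨E, fun n k α ε δ hα hε hδ0 hδ1 => ?_⟩
  have hα2 : α ^ 2 ≤ 16 := by
    have h1 := Real.pi_lt_d2
    nlinarith [hα.1, hα.2]
  have hlog : 0 ≤ Real.log (1 / δ) := Real.log_nonneg (by rw [le_div_iff₀ hδ0]; linarith)
  have hb1 : 1 ≤ 1 + 1 / ε := by
    have : 0 < 1 / ε := by positivity
    linarith
  have hb2 : 1 ≤ 1 + Real.log (1 / δ) := by linarith
  have hn1 : (1 : ℝ) ≤ n + 1 := by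
    have : (0 : ℝ) ≤ n := Nat.cast_nonneg n
    linarith
  have hN := h n k α ε δ hα hε hδ0 hδ1
  refine ⟨hN.trans ?_, fun hk => hN.trans ?_⟩
  · gcongr
  · have h1 : (1 + C * α ^ 2) * Real.exp (C * α ^ 2) ≤ 1 + E * α ^ 2 := by
      have h2 : Real.exp (C * α ^ 2) ≤ 1 + C * α ^ 2 * Real.exp (C * 16) :=
        exp_le_one_add_mul_exp (by positivity) (by gcongr)
      have h3 : C * P * (α ^ 2 * α ^ 2) ≤ C * P * (16 * α ^ 2) := by gcongr
      calc (1 + C * α ^ 2) * Real.exp (C * α ^ 2)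
          ≤ (1 + C * α ^ 2) * (1 + C * α ^ 2 * Real.exp (C * 16)) := by gcongr
        _ = 1 + (C + P) * α ^ 2 + C * P * (α ^ 2 * α ^ 2) := by rw [hP]; ring
        _ ≤ 1 + (C + P) * α ^ 2 + C * P * (16 * α ^ 2) := by linarith
        _ = 1 + (C + P + 16 * C * P) * α ^ 2 := by ring
        _ ≤ 1 + E * α ^ 2 := by gcongr
    calc C * (Real.exp (C * k) * (n + 1) ^ C) * (1 + C * α ^ 2) ^ n * (1 + 1 / ε) ^ C *
          (1 + Real.log (1 / δ)) ^ C
        ≤ C * (2 ^ C * Real.exp (C * α ^ 2) ^ n) * (1 + C * α ^ 2) ^ n * (1 + 1 / ε) ^ C *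
          (1 + Real.log (1 / δ)) ^ C := by
          gcongr ?_ * ?_ * _ * _ * _
          exact exp_mul_mul_succ_pow_le C hk
      _ = (C * 2 ^ C) * ((1 + C * α ^ 2) * Real.exp (C * α ^ 2)) ^ n * (1 + 1 / ε) ^ C *
          (1 + Real.log (1 / δ)) ^ C := by
          rw [mul_pow _ (Real.exp _)]
          ring
      _ ≤ E * (1 + E * α ^ 2) ^ n * (1 + 1 / ε) ^ E * (1 + Real.log (1 / δ)) ^ E := by
          gcongr

theorem one_div_four_pow_lt {δ : ℝ} (hδ : 0 < δ) :
    (1 / 4 : ℝ) ^ (⌊Real.log (1 / δ)⌋₊ + 1) < δ := by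
  have h1 : (1 / 4 : ℝ) ≤ Real.exp (-1) := by
    rw [Real.exp_neg, one_div]
    gcongr
    linarith [Real.exp_one_lt_d9]
  have h2 := Nat.lt_floor_add_one (Real.log (1 / δ))
  calc (1 / 4 : ℝ) ^ (⌊Real.log (1 / δ)⌋₊ + 1)
      ≤ Real.exp (-1) ^ (⌊Real.log (1 / δ)⌋₊ + 1) := by gcongr
    _ = Real.exp (-(⌊Real.log (1 / δ)⌋₊ + 1)) := by
        rw [← Real.exp_nat_mul]
        push_cast
        congr 1
        ring
    _ < Real.exp (-Real.log (1 / δ)) := by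
        apply Real.exp_lt_exp.2
        linarith
    _ = δ := by rw [one_div, Real.log_inv, neg_neg, Real.exp_log hδ]

/-- The number of samples per group. -/
def groupSize (D n k : ℕ) (α ε : ℝ) : ℕ :=
  ⌈2048 * estimatorBound D n k α (ε / 4) * (1 / ε) ^ 2⌉₊

/-- In `C`, the number `4098` is `2 · 2049`: twice the group size, with `2048` raised by one for the
rounding. The factor `4 ^ D` comes from the accuracy `ε / 4`, and `D + 2` is the power of `1 / ε`
including Chebyshev's square. -/
theorem group_samples_le {D : ℕ} (hD : 1 ≤ D) (n k : ℕ) (α : ℝ) {ε δ : ℝ} (hε : 0 < ε)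
    (hδ0 : 0 < δ) (hδ1 : δ < 1) {C : ℕ} (hC : C = 4098 * 4 ^ D * D + D + 2) :
    ((2 * (⌊Real.log (1 / δ)⌋₊ + 1) * groupSize D n k α (min ε 1) : ℕ) : ℝ) ≤
      C * (Real.exp (C * k) * (n + 1) ^ C) * (1 + C * α ^ 2) ^ n * (1 + 1 / ε) ^ C *
          (1 + Real.log (1 / δ)) ^ C := by
  set ε' := min ε 1 with hε'
  have hε0 : 0 < ε' := lt_min hε one_pos
  have hε1 : ε' ≤ 1 := min_le_right _ _
  have hinv1 : 1 ≤ 1 / ε' := by rw [le_div_iff₀ hε0]; linarith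
  have hinv : 1 / ε' ≤ 1 + 1 / ε := by
    have h0 : 0 < 1 / ε := by positivity
    rcases min_choice ε 1 with h | h
    · rw [hε', h]; linarith
    · rw [hε', h]; linarith
  have hlog : 0 ≤ Real.log (1 / δ) := Real.log_nonneg (by rw [le_div_iff₀ hδ0]; linarith)
  have hD' : (1 : ℝ) ≤ D := by exact_mod_cast hD
  have hn1 : (1 : ℝ) ≤ n + 1 := by
    have : (0 : ℝ) ≤ n := Nat.cast_nonneg n
    linarith
  set V := estimatorBound D n k α (ε' / 4) with hV
  have hV1 : 1 ≤ V :=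
    hn1.trans (le_estimatorBound hD n k α (by positivity) (by linarith))
  have hW1 : 1 ≤ V * (1 / ε') ^ 2 := one_le_mul_of_one_le_of_one_le hV1 (one_le_pow₀ hinv1)
  have hgroup : (groupSize D n k α ε' : ℝ) ≤ 2049 * (V * (1 / ε') ^ 2) := by
    have h1 := Nat.ceil_lt_add_one (a := 2048 * V * (1 / ε') ^ 2) (by positivity)
    unfold groupSize
    rw [← hV]
    linarith
  have hfloor : ((⌊Real.log (1 / δ)⌋₊ : ℕ) : ℝ) ≤ Real.log (1 / δ) := Nat.floor_le hlog
  have hVeq : V = D * (D : ℝ) ^ k * (n + 1) ^ D * (1 + D * α ^ 2) ^ n *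
      (4 ^ D * (1 / ε') ^ D) := by
    have h1 : 1 / (ε' / 4) = 4 * (1 / ε') := by field_simp
    rw [hV, estimatorBound, h1, mul_pow 4, pow_succ]
    ring
  have hDk : (D : ℝ) ^ k ≤ Real.exp (D * k) := by
    rw [mul_comm, Real.exp_nat_mul]
    gcongr
    linarith [Real.add_one_le_exp (D : ℝ)]
  have hDC : D ≤ C := by omega
  have hDC2 : D + 2 ≤ C := by omega
  have hC1 : ((4098 * 4 ^ D * D : ℕ) : ℝ) ≤ C := by
    exact_mod_cast (by omega : 4098 * 4 ^ D * D ≤ C)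
  push_cast at hC1 ⊢
  have hb1 : 1 ≤ 1 + 1 / ε := hinv1.trans hinv
  calc 2 * ((⌊Real.log (1 / δ)⌋₊ : ℝ) + 1) * groupSize D n k α ε'
      ≤ 2 * (Real.log (1 / δ) + 1) * (2049 * (V * (1 / ε') ^ 2)) := by gcongr
    _ = (4098 * 4 ^ D * D) * ((D : ℝ) ^ k * (n + 1) ^ D) * (1 + D * α ^ 2) ^ n *
        (1 / ε') ^ (D + 2) * (1 + Real.log (1 / δ)) := by
        rw [hVeq, pow_add]
        ring
    _ ≤ (4098 * 4 ^ D * D) * (Real.exp (D * k) * (n + 1) ^ D) * (1 + D * α ^ 2) ^ n *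
        (1 + 1 / ε) ^ (D + 2) * (1 + Real.log (1 / δ)) := by gcongr
    _ ≤ C * (Real.exp (C * k) * (n + 1) ^ C) * (1 + C * α ^ 2) ^ n * (1 + 1 / ε) ^ C *
        (1 + Real.log (1 / δ)) ^ C := by
        gcongr
        exact le_self_pow₀ (by linarith) (by omega)

theorem theorem3 (cs : List SyncChannel) :
    ∃ A : KmerAlgorithm, A.Solves cs ∧ A.GoodSampleComplexity := by
  obtain ⟨D, hD, H⟩ := exists_kmer_estimator_second_moment cs
  -- An algorithm has to be defined for all parameters; outside the admissible range the estimator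
  -- is 0.
  have H' : ∀ (α : ℝ) (n : ℕ) (ε : ℝ) (w : List Bool), ∃ f : List Bool → ℂ,
      α ^ 2 ≤ 16 → 0 < ε → ε ≤ 1 → ∀ x : List Bool, x.length = n →
        posExpectation (compositeTrace cs x) (fun y => ‖f y‖ₑ) ≠ ∞ ∧
        ‖expectation (compositeTrace cs x) f - kmerValue x w α‖ ≤ ε ∧
        posExpectation (compositeTrace cs x) (fun y => ‖f y‖ₑ ^ 2) ≤
          ENNReal.ofReal (estimatorBound D n w.length α ε) := by
    intro α n ε w
    by_cases h : α ^ 2 ≤ 16 ∧ 0 < ε ∧ ε ≤ 1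
    · obtain ⟨f, hf⟩ := H α h.1 n ε h.2.1 h.2.2 w
      exact ⟨f, fun _ _ _ => hf⟩
    · exact ⟨0, fun h1 h2 h3 => absurd ⟨h1, h2, h3⟩ h⟩
  choose f hf using H'
  -- The accuracy is capped at 1, where the estimators are available. The number of groups is `2 m`
  -- with `4 ^ (-m) < δ`; the bias is a quarter of the accuracy.
  refine ⟨⟨fun n k α ε δ => 2 * (⌊Real.log (1 / δ)⌋₊ + 1) * groupSize D n k α (min ε 1),
    fun n k α ε δ w => boostedEstimate (f α n (min ε 1 / 4) (List.ofFn w)) (min ε 1 / 2)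
      (2 * (⌊Real.log (1 / δ)⌋₊ + 1)) (groupSize D n k α (min ε 1))⟩, ?_,
    goodSampleComplexity_of_le (4098 * 4 ^ D * D + D + 2) fun n k α ε δ _ hε hδ0 hδ1 =>
      group_samples_le hD n k α hε hδ0 hδ1 rfl⟩
  intro n k α ε δ hα hε hδ0 hδ1 w x
  have hα2 : α ^ 2 ≤ 16 := by
    have h1 := Real.pi_lt_d2
    nlinarith [hα.1, hα.2]
  set ε' := min ε 1 with hε'
  have hε0 : 0 < ε' := lt_min hε one_pos
  have hε1 : ε' ≤ 1 := min_le_right _ _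
  obtain ⟨-, h2, h3⟩ := hf α n (ε' / 4) (List.ofFn w) hα2 (by positivity) (by linarith)
    (List.ofFn x) (by simp)
  rw [List.length_ofFn] at h3
  have hV0 : 0 < estimatorBound D n k α (ε' / 4) :=
    lt_of_lt_of_le (by positivity)
      (le_estimatorBound hD n k α (ε := ε' / 4) (by positivity) (by linarith))
  obtain ⟨hL, hI⟩ := memLp_two_toMeasure hV0.le h3
  rw [← integral_toMeasure_eq_expectation (hL.integrable (by norm_num))] at h2
  have hsize : 2048 * estimatorBound D n k α (ε' / 4) ≤
      groupSize D n k α ε' * ε' ^ 2 := by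
    have h4 := Nat.le_ceil (2048 * estimatorBound D n k α (ε' / 4) * (1 / ε') ^ 2)
    calc 2048 * estimatorBound D n k α (ε' / 4) =
        2048 * estimatorBound D n k α (ε' / 4) * (1 / ε') ^ 2 * ε' ^ 2 := by field_simp
      _ ≤ _ := mul_le_mul_of_nonneg_right h4 (sq_nonneg _)
  have hpos : 0 < groupSize D n k α ε' := Nat.ceil_pos.2 (by positivity)
  refine (lt_measureReal_boostedEstimate hL hI hε0 h2 hpos hsize
    (one_div_four_pow_lt hδ0)).trans_le ?_
  refine measureReal_mono fun t ht => ?_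
  rw [Set.mem_ofPred_eq] at ht ⊢
  exact ht.trans_le (min_le_left _ _)

end
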